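/- **Setting.** There are $M\ge 1$ clients. Each client $m$ has local data $\mathcal D_m$, either a finite data set of $n$ samples (the same $n$ for all clients) or, in the online case $n=\infty$, a probability distribution. With $f_m(x,z)$ the loss of client $m$ at a sample $z$ (differentiable in $x\in\mathbb R^d$, with finite mean in $z$), let $F_m(x)=\mathbb E_{z\sim\mathcal D_m}f_m(x,z)$, let $f_m(x,\mathcal B)$ be the average of $f_m(x,z)$ over the samples $z$ of a batch $\mathcal B$, and let $F=\frac1M\sum_{m}F_m$, assumed bounded below with $F_*=\inf F$. A batch of given size $s\le n$ is drawn uniformly without replacement from a finite data set, and consists of independent samples in the online case. Assume that there are constants $L>0$, $\sigma\ge0$, $L_\sigma\ge0$ such that for all clients $m$, all $v,w\in\mathbb R^d$ and all batch sizes $1\le|\mathcal B|\le n$ ($|\mathcal B|<\infty$): 1. $F_m$ is differentiable and $\|\nabla F_m(v)-\nabla F_m(w)\|\le L\|v-w\|$; 2. $\mathbb E_{\mathcal B}\|\nabla f_m(v,\mathcal B)-\nabla F_m(v)\|^2\le\sigma^2/|\mathcal B|$; 3. $\mathbb E_{\mathcal B}\|(\nabla f_m(v,\mathcal B)-\nabla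 f_m(w,\mathcal B))-(\nabla F_m(v)-\nabla F_m(w))\|^2\le\frac{L_\sigma^2}{|\mathcal B|}\|v-w\|^2$. **Algorithm (FedAMD with constant anchor probability $p\in(0,1)$).** Start from $x_0\in\mathbb R^d$ and cached gradients $v_0^{(m)}=\nabla f_m(x_0,\mathcal B_{m})$ with independent batches of size $b$. In round $t=0,1,2,\dots$ put $g_t=\frac1M\sum_m v_t^{(m)}$, draw a uniformly random set $\mathcal A$ of $A$ clients ($1\le A\le M$), and let each $i\in\mathcal A$ independently be an anchor with probability $p$ and a miner otherwise. An anchor sets $v_{t+1}^{(i)}=\nabla f_i(x_t,\mathcal B)$ with a fresh batch of size $b$; all other cached gradients are kept. A miner starts from $x^{(i)}_{-1}=x^{(i)}_{0}=x_t$ and $g^{(i)}_{0}=g_t$, and for $k=0,\dots,K-1$ draws a fresh batch $\mathcal B'$ of size $b'$ and sets $g^{(i)}_{k+1}=g^{(i)}_{k}-\nabla f_i(x^{(i)}_{k-1},\mathcal B')+\nabla f_i(x^{(i)}_{k},\mathcal B')$ and $x^{(i)}_{k+1}=x^{(i)}_{k}-\eta_l g^{(i)}_{k+1}$. Finally $x_{t+1}=x_t-\eta_s\cdot\frac1\nu\sum_{i}(x_t-x^{(i)}_{K})$,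 the sum being over the $\nu$ miners of the round, if $\nu\ge1$, and $x_{t+1}=x_t$ if $\nu=0$. All draws are independent. **Theorem.** There is a universal constant $C>0$ such that the following holds. Let $\varepsilon>0$, let the integers $K$, $b$, $b'$ satisfy $K\ge\max\left(1,\frac{2L_\sigma^2}{b'L^2}\right)$, $b=\min\left(\left\lceil\frac{\sigma^2}{M\varepsilon}\right\rceil,n\right)$ and $1\le b'<b$, and let $$\eta_l=\frac1{2\sqrt6\,KL},\qquad \eta_s=\frac{2\sqrt6}{1+\frac{2M}{Ap}\sqrt{1-p^A}}.$$ Then for every integer $T\ge1$ with $$T\ \ge\ C\,\frac{L\,(F(x_0)-F_*)}{\varepsilon}\left(\frac1{1-p^A}+\frac{M}{Ap\sqrt{1-p^A}}\right)$$ one has $\min_{0\le t<T}\mathbb E\|\nabla F(x_t)\|^2\le\varepsilon$ if $b=n$, and $\min_{0\le t<T}\mathbb E\|\nabla F(x_t)\|^2\le C\varepsilon$ if $b<n$. In particular, treating $F(x_0)-F_*$ and $L$ as constants, FedAMD reaches accuracy of order $\varepsilon$ in $T=O\left(\frac1\varepsilon\left(\frac1{1-p^A}+\frac{M}{Ap\sqrt{1-p^A}}\right)\right)$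 rounds. -/

import Mathlib

open MeasureTheory ProbabilityTheory
open scoped ENNReal

noncomputable section

namespace FedAMD

/-- The parameter space `ℝ^d` with its Euclidean norm. -/
abbrev Vec (d : ℕ) := EuclideanSpace ℝ (Fin d)

/-- The law of `x i` when the index `i` is drawn uniformly from the finite set `s`. -/
def uniformLaw {α β : Type*} [MeasurableSpace β] (s : Finset α) (x : α → β) : Measure β :=
  (s.card : ℝ≥0∞)⁻¹ • ∑ i ∈ s, Measure.dirac (x i)

/-- The local training data of `M` clients: either `n` samples per client, or, in the
streaming (online) case, one sampling distribution per client. -/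
inductive ClientData (M : ℕ) (Z : Type*) [MeasurableSpace Z]
  | finite (n : ℕ) (z : Fin M → Fin n → Z) : ClientData M Z
  | online (D : Fin M → ProbabilityMeasure Z) : ClientData M Z

section Data

variable {M d : ℕ} {Z : Type*} [MeasurableSpace Z]

/-- The size `n` of each local data set (`∞` in the online case). -/
def ClientData.size : ClientData M Z → ℕ∞
  | .finite n _ => n
  | .online _ => ⊤

/-- The law of one sample of client `m`. -/
def ClientData.sampleLaw : ClientData M Z → Fin M → Measure Z
  | .finite _ z, m => uniformLaw Finset.univ (z m)
  | .online D, m => (D m : Measure Z)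

/-- The law of a batch of `s` samples of client `m`: drawn uniformly without replacement from a
finite data set (meaningful for `s ≤ n`), independent samples in the online case. -/
def ClientData.batchLaw : ClientData M Z → Fin M → (s : ℕ) → Measure (Fin s → Z)
  | .finite n z, m, s => uniformLaw (Finset.univ : Finset (Fin s ↪ Fin n)) (fun e j => z m (e j))
  | .online D, m, s => Measure.pi (fun _ : Fin s => (D m : Measure Z))

/-- The empirical loss `f_m(x, B)`: the average of the sample losses over the batch. -/
def batchLoss (f : Fin M → Vec d → Z → ℝ) (m : Fin M) {s : ℕ} (B : Fin s → Z) (x : Vec d) : ℝ :=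
  (s : ℝ)⁻¹ * ∑ j, f m x (B j)

/-- The stochastic gradient `∇ f_m(x, B)`. -/
def batchGrad (f : Fin M → Vec d → Z → ℝ) (m : Fin M) {s : ℕ} (B : Fin s → Z) (x : Vec d) :
    Vec d :=
  gradient (batchLoss f m B) x

/-- The local expected loss `F_m`. -/
def localLoss (data : ClientData M Z) (f : Fin M → Vec d → Z → ℝ) (m : Fin M) (x : Vec d) : ℝ :=
  ∫ z, f m x z ∂(data.sampleLaw m)

/-- The objective `F = (1/M) ∑_m F_m`. -/
def globalLoss (data : ClientData M Z) (f : Fin M → Vec d → Z → ℝ) (x : Vec d) : ℝ :=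
  (M : ℝ)⁻¹ * ∑ m, localLoss data f m x

/-- The sample losses are differentiable in the parameter, and random variables with a finite
mean as functions of the sample, so that gradients and expected losses make sense. -/
structure IsLoss (data : ClientData M Z) (f : Fin M → Vec d → Z → ℝ) : Prop where
  differentiable : ∀ m z, Differentiable ℝ (fun x => f m x z)
  measurable : ∀ m x, Measurable (f m x)
  integrable : ∀ m x, Integrable (f m x) (data.sampleLaw m)

/-- `L`-smoothness of all local objectives. -/
def LSmooth (data : ClientData M Z) (f : Fin M → Vec d → Z → ℝ) (L : ℝ) : Prop :=
  ∀ m, Differentiable ℝ (localLoss data f m) ∧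
    ∀ v w, ‖gradient (localLoss data f m) v - gradient (localLoss data f m) w‖ ≤ L * ‖v - w‖

/-- Bounded noise: `E ‖∇f_m(v, B) - ∇F_m(v)‖² ≤ σ² / |B|`. -/
def BoundedNoise (data : ClientData M Z) (f : Fin M → Vec d → Z → ℝ) (σ : ℝ) : Prop :=
  ∀ m (s : ℕ), 1 ≤ s → (s : ℕ∞) ≤ data.size → ∀ v,
    ∫⁻ B, ‖batchGrad f m B v - gradient (localLoss data f m) v‖ₑ ^ 2 ∂(data.batchLaw m s)
      ≤ ENNReal.ofReal (σ ^ 2 / s)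

/-- Average `L`-smoothness:
`E ‖(∇f_m(v, B) - ∇f_m(w, B)) - (∇F_m(v) - ∇F_m(w))‖² ≤ (L_σ² / |B|) ‖v - w‖²`. -/
def AverageLSmooth (data : ClientData M Z) (f : Fin M → Vec d → Z → ℝ) (Lσ : ℝ) : Prop :=
  ∀ m (s : ℕ), 1 ≤ s → (s : ℕ∞) ≤ data.size → ∀ v w,
    ∫⁻ B, ‖(batchGrad f m B v - batchGrad f m B w)
        - (gradient (localLoss data f m) v - gradient (localLoss data f m) w)‖ₑ ^ 2
        ∂(data.batchLaw m s)
      ≤ ENNReal.ofReal (Lσ ^ 2 / s * ‖v - w‖ ^ 2)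

end Data

section Algorithm

variable {M d K b b' : ℕ} {Z : Type*}

/-- The variables of a miner before a local step: the previous local model, the current local
model and the current update direction. -/
structure MinerState (d : ℕ) where
  prev : Vec d
  cur : Vec d
  dir : Vec d

/-- The state of miner `m` after `k ≤ K` local steps, started from the global model `x` and the
global direction `g`, with minibatches `B 0, …, B (K - 1)`. -/
def minerRun (f : Fin M → Vec d → Z → ℝ) (ηl : ℝ) (m : Fin M) (x g : Vec d)
    (B : Fin K → Fin b' → Z) : ℕ → MinerState d
  | 0 => ⟨x, x, g⟩
  | k + 1 =>
    let s := minerRun f ηl m x g B k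
    if h : k < K then
      let g' := s.dir - batchGrad f m (B ⟨k, h⟩) s.prev + batchGrad f m (B ⟨k, h⟩) s.cur
      ⟨s.cur, s.cur - ηl • g', g'⟩
    else s

/-- The model change `x - x_K` that miner `m` sends to the server. -/
def minerChange (f : Fin M → Vec d → Z → ℝ) (ηl : ℝ) (m : Fin M) (x g : Vec d)
    (B : Fin K → Fin b' → Z) : Vec d :=
  x - (minerRun f ηl m x g B K).cur

/-- The global model and the cached gradients at the beginning of a round. -/
structure ServerState (M d : ℕ) where
  model : Vec d
  cache : Fin M → Vec d

/-- The average of the cached gradients. -/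
def ServerState.bullseye (s : ServerState M d) : Vec d := (M : ℝ)⁻¹ • ∑ m, s.cache m

/-- The random draws of one round: the set of participating clients, one coin per client
(`true` makes a participant an anchor, `false` a miner), one large batch per client, and `K`
minibatches per client. -/
abbrev RoundDraw (M K b b' : ℕ) (Z : Type*) :=
  Finset (Fin M) × (Fin M → Bool) × (Fin M → Fin b → Z) × (Fin M → Fin K → Fin b' → Z)

/-- One round of the algorithm. -/
def serverRound (f : Fin M → Vec d → Z → ℝ) (ηl ηs : ℝ) (s : ServerState M d)
    (r : RoundDraw M K b b' Z) : ServerState M d :=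
  let clients := r.1
  let isAnchor := r.2.1
  let large := r.2.2.1
  let small := r.2.2.2
  let miners := clients.filter (fun i => isAnchor i = false)
  { model :=
      if miners.card = 0 then s.model
      else s.model - ηs • ((miners.card : ℝ)⁻¹ •
        ∑ i ∈ miners, minerChange f ηl i s.model s.bullseye (small i))
    cache := fun i =>
      if i ∈ clients ∧ isAnchor i = true then batchGrad f i (large i) s.model
      else s.cache i }

/-- The states of the algorithm at the beginning of the rounds `t = 0, 1, 2, …`, for the initial
model `x₀`, the batches `init` for the initial cached gradients, and the draws of the rounds. -/
def run (f : Fin M → Vec d → Z → ℝ) (ηl ηs : ℝ) (x₀ : Vec d) (init : Fin M → Fin b → Z)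
    (draws : ℕ → RoundDraw M K b b' Z) : ℕ → ServerState M d
  | 0 => ⟨x₀, fun m => batchGrad f m (init m) x₀⟩
  | t + 1 => serverRound f ηl ηs (run f ηl ηs x₀ init draws t) (draws t)

variable [MeasurableSpace Z]

/-- The law of a coin that shows `true` with probability `p`. -/
def coinLaw (p : ℝ) : Measure Bool :=
  ENNReal.ofReal p • Measure.dirac true + ENNReal.ofReal (1 - p) • Measure.dirac false

/-- The law of the draws of one round: a uniformly random set of `A` clients, coins with
success probability `p`, large batches and minibatches, all independent. -/
def roundLaw (data : ClientData M Z) (A K b b' : ℕ) (p : ℝ) : Measure (RoundDraw M K b b' Z) :=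
  (uniformLaw (Finset.powersetCard A (Finset.univ : Finset (Fin M))) id).prod
    ((Measure.pi (fun _ : Fin M => coinLaw p)).prod
      ((Measure.pi (fun m : Fin M => data.batchLaw m b)).prod
        (Measure.pi (fun m : Fin M => Measure.pi (fun _ : Fin K => data.batchLaw m b')))))

/-- The randomness of the algorithm: the initial batches and the draws of all rounds are
independent and have the prescribed laws. -/
structure IsRandomness (data : ClientData M Z) (A K b b' : ℕ) (p : ℝ)
    {Ω : Type*} [MeasurableSpace Ω] (P : Measure Ω)
    (init : Ω → Fin M → Fin b → Z) (draws : ℕ → Ω → RoundDraw M K b b' Z) : Prop where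
  init_law : HasLaw init (Measure.pi (fun m : Fin M => data.batchLaw m b)) P
  draws_law : ∀ t, HasLaw (draws t) (roundLaw data A K b b' p) P
  draws_indep : iIndepFun draws P
  init_indep : IndepFun init (fun ω t => draws t ω) P

end Algorithm

end FedAMD

end

noncomputable section

namespace FedAMD

/-! ### Product measures and second moments in `L²`. -/

section General

/-! The server moves along an average of cached gradients that are both noisy and stale, so the
proof is a Lyapunov argument. Let `N` be the norm of the gradient of `F` at the current model, `G`
the norm of the average of the exact gradients at the points where the caches were filled
(`cleanDir`), `S` the mean over clients of the distance between the current local gradient and that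
exact gradient (`staleness`), and `X` the norm of the averaged cache noise.

The potential is `F - F_* + κ * S * (S + G)`. The product form is the key. Refreshing the anchors
lowers `S` by some amount `R` and raises `G` by at most `R`, so `S + G` grows only through the
motion of the model. The mean of `R` is `Q * S` with `Q = A p / M`. Hence the product loses `Q * S *
(S + G)` in mean, up to terms in the displacement. The choice of `κ`, proportional to `θ γ / Q` with
`θ = 1 - p ^ A` and `γ = ηs ηl K`, puts this gain on the scale `θ γ` of the descent of `F`.

A miner sends nearly `ηl K` times the direction `g` it received: its relative mean error is at most
`1/6` and its second moment at most `36/25` of the ideal one (`minerChange_bounds`). Averaging over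
miners and over the event that a miner exists gives the moments of the server displacement
(`serverStep_moments`). Smoothness of `F`, polarization of the inner product of its gradient with
`g` (`two_inner_ge`) and the real inequality `drift_ineq` then give the one-round decrease
`lintegral_potential_trackedRound_le`: a gain `θ γ N² / 200` against a loss `1500 θ γ X²`.

The noise `X²` has mean at most `v / M`, where `v` bounds the variance of a large batch, because
noises of different clients add like uncorrelated ones (`IsRandomness.lintegral_sum_noise_le`). It
vanishes when `b = n`, and `v / M ≤ ε` when `b < n`. Telescoping
(`IsRandomness.exists_lintegral_gradient_le`), with zero initial staleness and the step-size
arithmetic of `step_sizes`, gives the rate. -/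

theorem measurePreserving_update {ι : Type*} [Fintype ι] [DecidableEq ι] {α : ι → Type*}
    [∀ i, MeasurableSpace (α i)] (μ : ∀ i, Measure (α i)) [∀ i, IsProbabilityMeasure (μ i)]
    (i : ι) :
    MeasurePreserving (fun q : (∀ i, α i) × α i => Function.update q.1 i q.2)
      ((Measure.pi μ).prod (μ i)) (Measure.pi μ) := by
  have hm : Measurable (fun q : (∀ i, α i) × α i => Function.update q.1 i q.2) := by
    refine measurable_pi_lambda _ fun j => ?_
    by_cases h : j = i
    · subst h; simpa using measurable_snd
    · simp only [Function.update_of_ne h]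
      exact (measurable_pi_apply j).comp measurable_fst
  refine ⟨hm, (Measure.pi_eq fun s hs => ?_).symm⟩
  rw [Measure.map_apply hm (MeasurableSet.univ_pi hs)]
  have : (fun q : (∀ i, α i) × α i => Function.update q.1 i q.2) ⁻¹' (Set.univ.pi s)
      = (Set.univ.pi (Function.update s i Set.univ)) ×ˢ s i := by
    ext ⟨x, y⟩
    simp only [Set.mem_preimage, Set.mem_pi, Set.mem_univ, true_implies, Set.mem_prod]
    constructor
    · intro h
      refine ⟨fun j => ?_, by simpa using h i⟩
      by_cases hj : j = i
      · subst hj; simp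
      · simpa [Function.update_of_ne hj] using h j
    · rintro ⟨h1, h2⟩ j
      by_cases hj : j = i
      · subst hj; simpa using h2
      · simpa [Function.update_of_ne hj] using h1 j
  rw [this, Measure.prod_prod, Measure.pi_pi, ← Finset.prod_erase_mul _ _ (Finset.mem_univ i),
    ← Finset.prod_erase_mul (a := i) _ (fun j => μ j (s j)) (Finset.mem_univ i)]
  simp only [Function.update_self, measure_univ, mul_one]
  congr 1
  refine Finset.prod_congr rfl fun j hj => ?_
  rw [Function.update_of_ne (Finset.ne_of_mem_erase hj)]

/-- Resampling one coordinate preserves a product measure. This plays the role of conditioning on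
all other coordinates, and is how a fresh minibatch is averaged out. -/
theorem lintegral_pi_update {ι : Type*} [Fintype ι] [DecidableEq ι] {α : ι → Type*}
    [∀ i, MeasurableSpace (α i)] (μ : ∀ i, Measure (α i)) [∀ i, IsProbabilityMeasure (μ i)]
    (i : ι) {φ : (∀ i, α i) → ℝ≥0∞} (hφ : Measurable φ) :
    ∫⁻ x, φ x ∂Measure.pi μ
      = ∫⁻ x, ∫⁻ y, φ (Function.update x i y) ∂μ i ∂Measure.pi μ := by
  have h := measurePreserving_update μ i
  rw [← h.lintegral_comp hφ]
  exact lintegral_prod _ (hφ.comp h.measurable).aemeasurable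

theorem integral_pi_update {ι : Type*} [Fintype ι] [DecidableEq ι] {α : ι → Type*}
    [∀ i, MeasurableSpace (α i)] (μ : ∀ i, Measure (α i)) [∀ i, IsProbabilityMeasure (μ i)]
    (i : ι) {E : Type*} [NormedAddCommGroup E] [NormedSpace ℝ E]
    {φ : (∀ i, α i) → E} (hφ : Integrable φ (Measure.pi μ)) :
    ∫ x, φ x ∂Measure.pi μ
      = ∫ x, ∫ y, φ (Function.update x i y) ∂μ i ∂Measure.pi μ := by
  have h := measurePreserving_update μ i
  have h2 : Integrable (fun q : (∀ i, α i) × α i => φ (Function.update q.1 i q.2))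
      ((Measure.pi μ).prod (μ i)) := h.integrable_comp_of_integrable hφ
  rw [← integral_prod _ h2]
  conv_lhs => rw [← h.map_eq]
  rw [integral_map h.measurable.aemeasurable]
  rw [h.map_eq]
  exact hφ.aestronglyMeasurable

variable {Ω : Type*} [MeasurableSpace Ω] {μ : Measure Ω}
  {E : Type*} [NormedAddCommGroup E]

theorem memLp_two_iff_lintegral {φ : Ω → E} (hφ : AEStronglyMeasurable φ μ) :
    MemLp φ 2 μ ↔ ∫⁻ x, ‖φ x‖ₑ ^ 2 ∂μ < ∞ := by
  rw [MemLp, and_iff_right hφ,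
    eLpNorm_lt_top_iff_lintegral_rpow_enorm_lt_top (by norm_num) (by norm_num)]
  simp

theorem lintegral_enorm_sq_eq {φ : Ω → E} (hφ : MemLp φ 2 μ) :
    ∫⁻ x, ‖φ x‖ₑ ^ 2 ∂μ = ENNReal.ofReal (∫ x, ‖φ x‖ ^ 2 ∂μ) := by
  rw [ofReal_integral_eq_lintegral_ofReal hφ.norm.integrable_sq
    (Filter.Eventually.of_forall fun _ => by positivity)]
  refine lintegral_congr fun x => ?_
  rw [← ofReal_norm, ENNReal.ofReal_pow (norm_nonneg _)]

theorem integral_norm_sq_le {φ : Ω → E} (hφ : AEStronglyMeasurable φ μ) {c : ℝ} (hc : 0 ≤ c)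
    (h : ∫⁻ x, ‖φ x‖ₑ ^ 2 ∂μ ≤ ENNReal.ofReal c) :
    MemLp φ 2 μ ∧ ∫ x, ‖φ x‖ ^ 2 ∂μ ≤ c := by
  have h1 : MemLp φ 2 μ := (memLp_two_iff_lintegral hφ).2 (h.trans_lt ENNReal.ofReal_lt_top)
  refine ⟨h1, ?_⟩
  rw [lintegral_enorm_sq_eq h1] at h
  exact (ENNReal.ofReal_le_ofReal_iff hc).1 h

/-- The cross term vanishes because the noise is centred; this is Pythagoras for bias and variance.
-/
theorem integral_norm_add_sq [InnerProductSpace ℝ E] [CompleteSpace E]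
    [IsProbabilityMeasure μ] {φ : Ω → E} (hφ : MemLp φ 2 μ)
    (h0 : ∫ x, φ x ∂μ = 0) (c : E) :
    ∫ x, ‖c + φ x‖ ^ 2 ∂μ = ‖c‖ ^ 2 + ∫ x, ‖φ x‖ ^ 2 ∂μ := by
  have hi : Integrable φ μ := hφ.integrable (by norm_num)
  have h1 : ∀ x, ‖c + φ x‖ ^ 2 = ‖c‖ ^ 2 + (2 * inner ℝ c (φ x) + ‖φ x‖ ^ 2) := fun x => by
    rw [norm_add_sq_real]; ring
  simp_rw [h1]
  have h2 : Integrable (fun x => 2 * inner ℝ c (φ x)) μ := (hi.const_inner c).const_mul 2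
  have h3 : Integrable (fun x => 2 * inner ℝ c (φ x) + ‖φ x‖ ^ 2) μ :=
    h2.add hφ.norm.integrable_sq
  rw [integral_add (integrable_const _) h3,
    integral_add h2 hφ.norm.integrable_sq, integral_const_mul, integral_inner hi, h0]
  simp

theorem lintegral_enorm_add_sq [InnerProductSpace ℝ E] [CompleteSpace E]
    [IsProbabilityMeasure μ] {φ : Ω → E} (hφ : MemLp φ 2 μ)
    (h0 : ∫ x, φ x ∂μ = 0) (c : E) :
    ∫⁻ x, ‖c + φ x‖ₑ ^ 2 ∂μ = ‖c‖ₑ ^ 2 + ∫⁻ x, ‖φ x‖ₑ ^ 2 ∂μ := by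
  have h1 : MemLp (fun x => c + φ x) 2 μ := (memLp_const c).add hφ
  rw [lintegral_enorm_sq_eq h1, lintegral_enorm_sq_eq hφ,
    integral_norm_add_sq hφ h0, ENNReal.ofReal_add (by positivity) (by positivity),
    ← ofReal_norm, ENNReal.ofReal_pow (norm_nonneg _)]

theorem norm_integral_sq_le [NormedSpace ℝ E] [IsProbabilityMeasure μ] {φ : Ω → E} (hφ : MemLp φ 2 μ) :
    ‖∫ x, φ x ∂μ‖ ^ 2 ≤ ∫ x, ‖φ x‖ ^ 2 ∂μ := by
  have hi : Integrable φ μ := hφ.integrable (by norm_num)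
  have h1 : ‖∫ x, φ x ∂μ‖ ≤ ∫ x, ‖φ x‖ ∂μ := norm_integral_le_integral_norm _
  have h2 : (∫ x, ‖φ x‖ ∂μ) ^ 2 ≤ ∫ x, ‖φ x‖ ^ 2 ∂μ := by
    have h3 := integral_nonneg (μ := μ) (f := fun x => (‖φ x‖ - ∫ y, ‖φ y‖ ∂μ) ^ 2)
      (fun x => sq_nonneg _)
    have h4 : ∀ x, (‖φ x‖ - ∫ y, ‖φ y‖ ∂μ) ^ 2
        = ‖φ x‖ ^ 2 + (- (2 * ∫ y, ‖φ y‖ ∂μ) * ‖φ x‖ + (∫ y, ‖φ y‖ ∂μ) ^ 2) := fun x => by ring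
    simp_rw [h4] at h3
    have h5 : Integrable (fun x => - (2 * ∫ y, ‖φ y‖ ∂μ) * ‖φ x‖ + (∫ y, ‖φ y‖ ∂μ) ^ 2) μ :=
      (hi.norm.const_mul _).add (integrable_const _)
    rw [integral_add hφ.norm.integrable_sq h5,
      integral_add (hi.norm.const_mul _) (integrable_const _), integral_const_mul] at h3
    simp at h3
    nlinarith
  calc _ ≤ (∫ x, ‖φ x‖ ∂μ) ^ 2 := by gcongr
    _ ≤ _ := h2

/-- Minkowski's inequality in `L²`, for squared norms. -/
theorem integral_norm_add_sq_le {φ ψ : Ω → E} (hφ : MemLp φ 2 μ) (hψ : MemLp ψ 2 μ)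
    {a b V : ℝ} (ha : 0 < a) (hb : 0 < b) (h1 : ∫ x, ‖φ x‖ ^ 2 ∂μ ≤ a ^ 2 * V)
    (h2 : ∫ x, ‖ψ x‖ ^ 2 ∂μ ≤ b ^ 2 * V) :
    ∫ x, ‖φ x + ψ x‖ ^ 2 ∂μ ≤ (a + b) ^ 2 * V := by
  -- Young's inequality with weight `b / a`, the one for which the two bounds recombine exactly to
  -- `(a + b) ^ 2`.
  have h3 : ∀ x, ‖φ x + ψ x‖ ^ 2 ≤ (1 + b / a) * ‖φ x‖ ^ 2 + (1 + a / b) * ‖ψ x‖ ^ 2 := fun x => by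
    have h := norm_add_le (φ x) (ψ x)
    have h4 : ‖φ x + ψ x‖ ^ 2 ≤ (‖φ x‖ + ‖ψ x‖) ^ 2 := by gcongr
    have h5 : (1 + b / a) * ‖φ x‖ ^ 2 + (1 + a / b) * ‖ψ x‖ ^ 2 - (‖φ x‖ + ‖ψ x‖) ^ 2
        = (b * ‖φ x‖ - a * ‖ψ x‖) ^ 2 / (a * b) := by field_simp; ring
    have h6 : 0 ≤ (b * ‖φ x‖ - a * ‖ψ x‖) ^ 2 / (a * b) := by positivity
    linarith
  have i1 := hφ.norm.integrable_sq.const_mul (1 + b / a)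
  have i2 := hψ.norm.integrable_sq.const_mul (1 + a / b)
  calc _ ≤ ∫ x, ((1 + b / a) * ‖φ x‖ ^ 2 + (1 + a / b) * ‖ψ x‖ ^ 2) ∂μ :=
        integral_mono (hφ.add hψ).norm.integrable_sq (i1.add i2) h3
    _ = (1 + b / a) * ∫ x, ‖φ x‖ ^ 2 ∂μ + (1 + a / b) * ∫ x, ‖ψ x‖ ^ 2 ∂μ := by
        rw [integral_add i1 i2, integral_const_mul, integral_const_mul]
    _ ≤ (1 + b / a) * (a ^ 2 * V) + (1 + a / b) * (b ^ 2 * V) := by gcongr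
    _ = _ := by field_simp; ring

end General

/-! ### Functions with Lipschitz gradient. -/

section Smooth

variable {E : Type*} [NormedAddCommGroup E] [InnerProductSpace ℝ E] [CompleteSpace E]

/-- The quadratic upper bound for a function with Lipschitz gradient. -/
theorem le_of_lipschitz_gradient {φ : E → ℝ} {L : ℝ} (hd : Differentiable ℝ φ)
    (hL : ∀ v w, ‖gradient φ v - gradient φ w‖ ≤ L * ‖v - w‖) (x h : E) :
    φ (x + h) ≤ φ x + inner ℝ (gradient φ x) h + L / 2 * ‖h‖ ^ 2 := by
  -- The slack in the quadratic bound along the segment; it vanishes at `0` and is shown to be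
  -- monotone.
  let ψ : ℝ → ℝ := fun t => φ x + t * inner ℝ (gradient φ x) h + L / 2 * t ^ 2 * ‖h‖ ^ 2
    - φ (x + t • h)
  have hψ : ∀ t, HasDerivAt ψ (inner ℝ (gradient φ x) h + L * t * ‖h‖ ^ 2
      - inner ℝ (gradient φ (x + t • h)) h) t := by
    intro t
    have h1 : HasDerivAt (fun t : ℝ => φ (x + t • h)) (inner ℝ (gradient φ (x + t • h)) h) t := by
      have h2 : HasDerivAt (fun t : ℝ => x + t • h) h t := by
        simpa using ((hasDerivAt_id t).smul_const h).const_add x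
      have h3 := (hd (x + t • h)).hasGradientAt.hasFDerivAt
      have h4 := h3.comp_hasDerivAt t h2
      rw [InnerProductSpace.toDual_apply_apply] at h4
      exact h4
    have h4 : HasDerivAt (fun t : ℝ => φ x + t * inner ℝ (gradient φ x) h
        + L / 2 * t ^ 2 * ‖h‖ ^ 2) (inner ℝ (gradient φ x) h + L * t * ‖h‖ ^ 2) t := by
      have h5 := ((hasDerivAt_id t).mul_const (inner ℝ (gradient φ x) h)).const_add (φ x)
      have h6 := (((hasDerivAt_pow 2 t).const_mul (L / 2)).mul_const (‖h‖ ^ 2))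
      refine (h5.add h6).congr_deriv ?_
      push_cast; ring
    exact h4.sub h1
  have hmono : MonotoneOn ψ (Set.Icc 0 1) := by
    refine monotoneOn_of_deriv_nonneg (convex_Icc 0 1)
      (fun t _ => (hψ t).continuousAt.continuousWithinAt)
      (fun t _ => (hψ t).differentiableAt.differentiableWithinAt) fun t ht => ?_
    rw [interior_Icc] at ht
    rw [(hψ t).deriv]
    have h1 : inner ℝ (gradient φ (x + t • h) - gradient φ x) h ≤ L * t * ‖h‖ ^ 2 := by
      refine (real_inner_le_norm _ _).trans ?_
      have := hL (x + t • h) x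
      rw [add_sub_cancel_left, norm_smul, Real.norm_of_nonneg ht.1.le] at this
      calc _ ≤ L * (t * ‖h‖) * ‖h‖ := by gcongr
        _ = _ := by ring
    rw [inner_sub_left] at h1
    linarith
  have := hmono (Set.left_mem_Icc.2 zero_le_one) (Set.right_mem_Icc.2 zero_le_one) zero_le_one
  simp only [ψ, zero_mul, one_mul, add_zero, zero_smul, one_smul, one_pow, mul_one, ne_eq,
    OfNat.ofNat_ne_zero, not_false_eq_true, zero_pow, mul_zero, sub_self] at this
  linarith

theorem continuous_of_lipschitz {d : ℕ} {L : ℝ} {H : Vec d → Vec d}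
    (h : ∀ v w, ‖H v - H w‖ ≤ L * ‖v - w‖) : Continuous H := by
  refine (LipschitzWith.of_dist_le_mul (K := L.toNNReal) fun v w => ?_).continuous
  rw [dist_eq_norm, dist_eq_norm]
  refine (h v w).trans ?_
  gcongr
  exact Real.le_coe_toNNReal L

end Smooth

/-! ### The quadratic inequality behind the decrease of the potential. -/

section Algebra

/-- For small staleness the triangle inequality forces `N ≥ G - S ≥ 9/50 * G`. This lies beyond the
minimum of `49/50 * N ^ 2 - N * G / 3` in `N`, at about `0.17 * G`, so `N` may be replaced by `G -
S`. -/
theorem drift_form_pos_of_le {N G S t : ℝ} (hG : 0 ≤ G) (h : G ≤ N + S)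
    (hSG : S ≤ 41 / 50 * G) :
    1 / 50 * (N ^ 2 + G ^ 2 + S ^ 2) ≤ 5 / 4 * S * (S + G) + N ^ 2 + G ^ 2 - S ^ 2 - N * G / 3
      - 36 / 25 * (G - t) * G - 3 / 4 * t * (2 * S + G) - 9 / 10 * t * (G - t) := by
  have h1 : 49 / 50 * (G - S) ^ 2 - (G - S) * G / 3 ≤ 49 / 50 * N ^ 2 - N * G / 3 := by
    nlinarith [mul_nonneg (sub_nonneg.2 h) hG,
      mul_nonneg (sub_nonneg.2 h) (sub_nonneg.2 hSG), sq_nonneg (N + S - G)]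
  nlinarith [sq_nonneg (S - G / 6 - 3 / 5 * t), sq_nonneg (G - 2 * t),
    sq_nonneg (S - 1 / 2 * G)]

/-- For large staleness the term `5/4 * S * (S + G)` suffices, and the part depending on `N` is just
minimized freely. -/
theorem drift_form_pos_of_ge {N G S t : ℝ} (hG : 0 ≤ G)
    (htG : t ≤ G) (hSG : 41 / 50 * G ≤ S) :
    1 / 50 * (N ^ 2 + G ^ 2 + S ^ 2) ≤ 5 / 4 * S * (S + G) + N ^ 2 + G ^ 2 - S ^ 2 - N * G / 3
      - 36 / 25 * (G - t) * G - 3 / 4 * t * (2 * S + G) - 9 / 10 * t * (G - t) := by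
  have h1 : - (3 / 100) * G ^ 2 ≤ 49 / 50 * N ^ 2 - N * G / 3 := by
    nlinarith [sq_nonneg (N - 17 / 100 * G)]
  rcases le_total S (3 / 2 * G) with h2 | h2
  · nlinarith [sq_nonneg (t - 5 / 6 * S - 7 / 60 * G),
      mul_nonneg (sub_nonneg.2 hSG) (sub_nonneg.2 h2), mul_nonneg hG (sub_nonneg.2 hSG)]
  · nlinarith [mul_nonneg (sub_nonneg.2 htG) (sub_nonneg.2 h2),
      mul_nonneg hG (sub_nonneg.2 htG), sq_nonneg (S - 25 / 46 * G), sq_nonneg (G - t)]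

/-- The inequality behind the one-round decrease of the potential: `N` is the norm of the gradient
of the objective, `G` the norm of the noise-free direction, `S` the mean staleness error, `X` the
norm of the noise and `H` the norm of the direction. -/
theorem drift_ineq {N G S X H w : ℝ} (hN : 0 ≤ N) (hG : 0 ≤ G) (hS : 0 ≤ S) (hX : 0 ≤ X)
    (hH : 0 ≤ H) (hHG : H ≤ G + X) (h : G ≤ N + S) (hw : 0 ≤ w) (hw1 : w ≤ 1) :
    -(5 / 4) * S * (S + G) - (N ^ 2 + G ^ 2 - S ^ 2 - 2 * N * X) + N * H / 3
      + (1 - w) * (36 / 25 * H ^ 2)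
      + 5 / 4 * (w / 2) * (6 / 5 * H * (2 * S + G) + (1 - w) * (36 / 25 * H ^ 2))
      ≤ -(1 / 100) * N ^ 2 + 3000 * X ^ 2 := by
  have hw2 : 0 ≤ 1 - w := by linarith
  have h1 : N * H / 3 + (1 - w) * (36 / 25 * H ^ 2)
      + 5 / 4 * (w / 2) * (6 / 5 * H * (2 * S + G) + (1 - w) * (36 / 25 * H ^ 2))
      ≤ N * (G + X) / 3 + (1 - w) * (36 / 25 * (G + X) ^ 2)
      + 5 / 4 * (w / 2) * (6 / 5 * (G + X) * (2 * S + G) + (1 - w) * (36 / 25 * (G + X) ^ 2)) := by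
    gcongr
  -- The noise-free case `X = 0`, `H = G`, with `t = w * G`. The form is bounded below by a multiple
  -- of the sum of squares, which leaves room for the noise.
  have hmain : 1 / 50 * (N ^ 2 + G ^ 2 + S ^ 2) ≤ 5 / 4 * S * (S + G) + N ^ 2 + G ^ 2 - S ^ 2
      - N * G / 3 - 36 / 25 * (G - w * G) * G - 3 / 4 * (w * G) * (2 * S + G)
      - 9 / 10 * (w * G) * (G - w * G) := by
    have ht : 0 ≤ w * G := by positivity
    have htG : w * G ≤ G := by nlinarith
    rcases le_total S (41 / 50 * G) with h2 | h2
    · exact drift_form_pos_of_le hG h h2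
    · exact drift_form_pos_of_ge hG htG h2
  have hww : (1 - w) * (1 + 5 / 8 * w) ≤ 1 := by nlinarith
  have h3 : (1 - w) * (1 + 5 / 8 * w) * (36 / 25 * (2 * G * X + X ^ 2))
      ≤ 1 * (36 / 25 * (2 * G * X + X ^ 2)) := by gcongr
  have h4 : w * (X * (2 * S + G)) ≤ 1 * (X * (2 * S + G)) := by gcongr
  -- Young's inequality absorbs the products of `X` with `N`, `G` and `S`; this is the source of the
  -- factor `3000`.
  nlinarith [sq_nonneg (N - 200 * X), sq_nonneg (G - 200 * X), sq_nonneg (S - 200 * X)]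

end Algebra

/-! ### Gradients of finite averages. -/

section Gradient

variable {E : Type*} [NormedAddCommGroup E] [InnerProductSpace ℝ E] [CompleteSpace E]

theorem gradient_const_mul_sum {ι : Type*} (s : Finset ι) (c : ℝ) {φ : ι → E → ℝ} {x : E}
    (h : ∀ i, DifferentiableAt ℝ (φ i) x) :
    gradient (fun y => c * ∑ i ∈ s, φ i y) x = c • ∑ i ∈ s, gradient (φ i) x := by
  refine HasGradientAt.gradient ?_
  rw [hasGradientAt_iff_hasFDerivAt]
  have h1 := (HasFDerivAt.fun_sum fun i (_ : i ∈ s) => (h i).hasGradientAt.hasFDerivAt).const_mul c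
  refine h1.congr_fderiv ?_
  ext v
  simp

end Gradient

/-! ### Uniform laws on finite sets and sampling without replacement. -/

section UniformLaw

variable {α β : Type*} [MeasurableSpace β]

theorem isProbabilityMeasure_uniformLaw {s : Finset α} (hs : s.Nonempty) (x : α → β) :
    IsProbabilityMeasure (uniformLaw s x) := by
  constructor
  have h : (s.card : ℝ≥0∞) ≠ 0 := by simpa using hs.ne_empty
  simp [uniformLaw, ENNReal.inv_mul_cancel h (ENNReal.natCast_ne_top _)]

theorem lintegral_uniformLaw (s : Finset α) (x : α → β) {φ : β → ℝ≥0∞} (hφ : Measurable φ) :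
    ∫⁻ y, φ y ∂uniformLaw s x = (s.card : ℝ≥0∞)⁻¹ * ∑ i ∈ s, φ (x i) := by
  simp [uniformLaw, lintegral_dirac' _ hφ]

theorem integral_uniformLaw {E : Type*} [NormedAddCommGroup E] [NormedSpace ℝ E] [CompleteSpace E]
    (s : Finset α) (x : α → β) {φ : β → E} (hφ : StronglyMeasurable φ) :
    ∫ y, φ y ∂uniformLaw s x = (s.card : ℝ)⁻¹ • ∑ i ∈ s, φ (x i) := by
  rw [uniformLaw, integral_smul_measure, integral_finsetSum_measure]
  · simp [integral_dirac' _ _ hφ]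
  · intro i _
    exact integrable_dirac' hφ (by simp)

end UniformLaw

/-- Translations of `Fin n` permute the embeddings. Averaging over all translations makes the value
at `j` run uniformly over `Fin n`, so each entry of a sample without replacement is uniform. -/
theorem sum_embedding_apply {s n : ℕ} (j : Fin s) {E : Type*} [AddCommGroup E] [Module ℝ E]
    (hn : 0 < n) (φ : Fin n → E) :
    ∑ e : Fin s ↪ Fin n, φ (e j)
      = ((Fintype.card (Fin s ↪ Fin n) : ℝ) * (n : ℝ)⁻¹) • ∑ i, φ i := by
  have : NeZero n := ⟨hn.ne'⟩
  have h1 : ∀ c : Fin n, ∑ e : Fin s ↪ Fin n, φ (e j) = ∑ e : Fin s ↪ Fin n, φ (c + e j) := by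
    intro c
    refine (Fintype.sum_equiv (Equiv.embeddingCongr (Equiv.refl _) (Equiv.addLeft c)) _ _ ?_).symm
    intro e
    simp [Equiv.embeddingCongr]
  have h2 : (n : ℝ) • ∑ e : Fin s ↪ Fin n, φ (e j)
      = (Fintype.card (Fin s ↪ Fin n) : ℝ) • ∑ i, φ i := by
    calc (n : ℝ) • ∑ e : Fin s ↪ Fin n, φ (e j)
        = ∑ c : Fin n, ∑ e : Fin s ↪ Fin n, φ (e j) := by
          simp [Nat.cast_smul_eq_nsmul]
      _ = ∑ c : Fin n, ∑ e : Fin s ↪ Fin n, φ (c + e j) := Finset.sum_congr rfl fun c _ => h1 c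
      _ = ∑ e : Fin s ↪ Fin n, ∑ i, φ i := by
          rw [Finset.sum_comm]
          exact Finset.sum_congr rfl fun e _ =>
            Fintype.sum_equiv (Equiv.addRight (e j)) _ _ fun c => rfl
      _ = _ := by simp only [Finset.sum_const, Finset.card_univ, Nat.cast_smul_eq_nsmul]
  have hn' : (n : ℝ) ≠ 0 := by exact_mod_cast hn.ne'
  rw [mul_comm, mul_smul, ← h2, smul_smul, inv_mul_cancel₀ hn', one_smul]

/-! ### Stochastic gradients: measurability, unbiasedness, exactness of full batches. -/

section Problem

variable {M d : ℕ} {Z : Type*} [MeasurableSpace Z] {data : ClientData M Z}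
  {f : Fin M → Vec d → Z → ℝ}

theorem batchGrad_eq (hf : IsLoss data f) (m : Fin M) {s : ℕ} (B : Fin s → Z) (x : Vec d) :
    batchGrad f m B x = (s : ℝ)⁻¹ • ∑ j, gradient (fun y => f m y (B j)) x :=
  gradient_const_mul_sum _ _ fun j => (hf.differentiable m (B j)).differentiableAt

theorem measurable_loss (hf : IsLoss data f) (m : Fin M) :
    Measurable (fun q : Vec d × Z => f m q.1 q.2) :=
  (stronglyMeasurable_uncurry_of_continuous_of_stronglyMeasurable (u := f m)
    (fun z => (hf.differentiable m z).continuous)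
    (fun x => (hf.measurable m x).stronglyMeasurable)).measurable

/-- Joint measurability holds because each directional derivative is a pointwise limit of difference
quotients, which are jointly measurable by the Carathéodory property of the loss. -/
theorem measurable_sampleGrad (hf : IsLoss data f) (m : Fin M) :
    Measurable (fun q : Vec d × Z => gradient (fun y => f m y q.2) q.1) := by
  let b := EuclideanSpace.basisFun (Fin d) ℝ
  have h1 : ∀ v : Vec d, Measurable (fun q : Vec d × Z =>
      inner ℝ v (gradient (fun y => f m y q.2) q.1)) := by
    intro v
    refine measurable_of_tendsto_metrizable (f := fun (n : ℕ) (q : Vec d × Z) =>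
      (n + 1 : ℝ) * (f m (q.1 + ((n : ℝ) + 1)⁻¹ • v) q.2 - f m q.1 q.2)) (fun n => ?_) ?_
    · refine Measurable.const_mul (Measurable.sub ?_ (measurable_loss hf m)) _
      exact (measurable_loss hf m).comp
        ((measurable_fst.add_const (((n : ℝ) + 1)⁻¹ • v)).prodMk measurable_snd)
    · rw [tendsto_pi_nhds]
      intro q
      have h2 := ((hf.differentiable m q.2) q.1).hasGradientAt.hasFDerivAt
      have h3 := h2.hasLineDerivAt v
      have h4 := h3.tendsto_slope_zero_right
      have h5 : Filter.Tendsto (fun n : ℕ => ((n : ℝ) + 1)⁻¹) Filter.atTop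
          (nhdsWithin 0 (Set.Ioi 0)) := by
        refine tendsto_nhdsWithin_iff.2 ⟨?_, Filter.Eventually.of_forall fun n => ?_⟩
        · simpa using tendsto_one_div_add_atTop_nhds_zero_nat (𝕜 := ℝ)
        · exact Set.mem_Ioi.2 (by positivity)
      have h6 := h4.comp h5
      rw [InnerProductSpace.toDual_apply_apply, real_inner_comm] at h6
      refine h6.congr fun n => ?_
      simp
  have h2 : (fun q : Vec d × Z => gradient (fun y => f m y q.2) q.1)
      = fun q => ∑ i, (inner ℝ (b i) (gradient (fun y => f m y q.2) q.1)) • b i := by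
    funext q
    exact (b.sum_repr' _).symm
  rw [h2]
  refine Finset.measurable_sum _ fun i _ => ?_
  exact (h1 (b i)).smul_const (b i)

theorem measurable_batchGrad (hf : IsLoss data f) (m : Fin M) (s : ℕ) :
    Measurable (fun q : Vec d × (Fin s → Z) => batchGrad f m q.2 q.1) := by
  simp_rw [batchGrad_eq hf]
  refine (Finset.measurable_sum (M := Vec d) _ fun j _ => ?_).const_smul (s : ℝ)⁻¹
  exact (measurable_sampleGrad hf m).comp
    (measurable_fst.prodMk ((measurable_pi_apply j).comp measurable_snd))

theorem isProbabilityMeasure_batchLaw (m : Fin M) {s : ℕ} (hs : (s : ℕ∞) ≤ data.size) :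
    IsProbabilityMeasure (data.batchLaw m s) := by
  cases data with
  | finite n z =>
    have hs' : s ≤ n := by simpa [ClientData.size] using hs
    exact isProbabilityMeasure_uniformLaw ⟨Fin.castLEEmb hs', Finset.mem_univ _⟩ _
  | online D => dsimp only [ClientData.batchLaw]; infer_instance

theorem gradient_globalLoss {L : ℝ} (hL : LSmooth data f L) (x : Vec d) :
    gradient (globalLoss data f) x = (M : ℝ)⁻¹ • ∑ m, gradient (localLoss data f m) x :=
  gradient_const_mul_sum _ _ fun m => (hL m).1.differentiableAt

theorem globalLoss_smooth {L : ℝ} (hM : 0 < M) (hL : LSmooth data f L) :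
    Differentiable ℝ (globalLoss data f) ∧ ∀ v w : Vec d,
      ‖gradient (globalLoss data f) v - gradient (globalLoss data f) w‖ ≤ L * ‖v - w‖ := by
  refine ⟨?_, fun v w => ?_⟩
  · exact (Differentiable.fun_sum fun m _ => (hL m).1).const_mul _
  · have hM' : (0 : ℝ) < M := by exact_mod_cast hM
    rw [gradient_globalLoss hL, gradient_globalLoss hL, ← smul_sub, ← Finset.sum_sub_distrib,
      norm_smul, norm_inv, Real.norm_of_nonneg hM'.le, inv_mul_le_iff₀ hM']
    refine (norm_sum_le _ _).trans ((Finset.sum_le_sum fun m _ => (hL m).2 v w).trans ?_)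
    simp

theorem gradient_localLoss_finite {n : ℕ} {z : Fin M → Fin n → Z}
    (hf : IsLoss (ClientData.finite n z) f) (m : Fin M) (x : Vec d) :
    gradient (localLoss (ClientData.finite n z) f m) x
      = (n : ℝ)⁻¹ • ∑ i, gradient (fun y => f m y (z m i)) x := by
  have h : localLoss (ClientData.finite n z) f m
      = fun y => (n : ℝ)⁻¹ * ∑ i, f m y (z m i) := by
    funext y
    rw [localLoss, ClientData.sampleLaw, integral_uniformLaw _ _
      (hf.measurable m y).stronglyMeasurable]
    simp
  rw [h]
  exact gradient_const_mul_sum _ _ fun i => (hf.differentiable m _).differentiableAt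

/-- A batch that exhausts the local data set gives the exact gradient. -/
theorem lintegral_batchGrad_sub_full (hf : IsLoss data f) (m : Fin M) {s : ℕ}
    (hs : (s : ℕ∞) = data.size) (x : Vec d) :
    ∫⁻ B, ‖batchGrad f m B x - gradient (localLoss data f m) x‖ₑ ^ 2 ∂(data.batchLaw m s) = 0 := by
  have hmeas : Measurable fun B : Fin s → Z =>
      ‖batchGrad f m B x - gradient (localLoss data f m) x‖ₑ ^ 2 :=
    (((measurable_batchGrad hf m s).comp measurable_prodMk_left).sub_const _).enorm.pow_const _
  cases data with
  | online D => simp [ClientData.size] at hs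
  | finite n z =>
    obtain rfl : s = n := by simpa [ClientData.size] using hs
    rw [ClientData.batchLaw, lintegral_uniformLaw _ _ hmeas, Finset.sum_eq_zero, mul_zero]
    intro e _
    rw [batchGrad_eq hf, gradient_localLoss_finite hf]
    -- An embedding of `Fin s` into itself is a permutation, so the batch is the whole data set.
    have h := Fintype.sum_bijective e ((Finite.injective_iff_bijective).1 e.injective)
      (fun j => gradient (fun y => f m y (z m (e j))) x)
      (fun i => gradient (fun y => f m y (z m i)) x) (fun _ => rfl)
    rw [h]
    simp

theorem memLp_batchGrad_sub (hf : IsLoss data f) {σ : ℝ} (hσ : BoundedNoise data f σ)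
    (m : Fin M) {s : ℕ} (hs1 : 1 ≤ s) (hs : (s : ℕ∞) ≤ data.size) (x : Vec d) :
    MemLp (fun B : Fin s → Z => batchGrad f m B x - gradient (localLoss data f m) x) 2
      (data.batchLaw m s) := by
  refine (integral_norm_sq_le ?_ (by positivity) (hσ m s hs1 hs x)).1
  exact (((measurable_batchGrad hf m s).comp measurable_prodMk_left).sub_const _).aestronglyMeasurable

/-- The stochastic gradients are unbiased. In the streaming case this follows from the variance
bounds for batches of every size. -/
theorem integral_batchGrad_sub (hf : IsLoss data f) {σ : ℝ} (hσ : BoundedNoise data f σ)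
    (m : Fin M) {s : ℕ} (hs1 : 1 ≤ s) (hs : (s : ℕ∞) ≤ data.size) (x : Vec d) :
    ∫ B, (batchGrad f m B x - gradient (localLoss data f m) x) ∂(data.batchLaw m s) = 0 := by
  have hmem := fun (r : ℕ) (h1 : 1 ≤ r) (h2 : (r : ℕ∞) ≤ data.size) =>
    memLp_batchGrad_sub hf hσ m h1 h2 x
  have hsg : Measurable fun z : Z => gradient (fun y => f m y z) x :=
    (measurable_sampleGrad hf m).comp measurable_prodMk_left
  have hbg : ∀ r : ℕ, Measurable fun B : Fin r → Z =>
      batchGrad f m B x - gradient (localLoss data f m) x := fun r =>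
    ((measurable_batchGrad hf m r).comp measurable_prodMk_left).sub_const _
  cases data with
  | finite n z =>
    have hsn : s ≤ n := by simpa [ClientData.size] using hs
    have hcard : (0 : ℝ) < Fintype.card (Fin s ↪ Fin n) := by
      exact_mod_cast Fintype.card_pos_iff.2 ⟨Fin.castLEEmb hsn⟩
    have hs0 : (s : ℝ) ≠ 0 := by positivity
    rw [ClientData.batchLaw, integral_uniformLaw _ _ (hbg s).stronglyMeasurable,
      Finset.sum_sub_distrib]
    simp_rw [batchGrad_eq hf]
    rw [← Finset.smul_sum, Finset.sum_comm]
    simp_rw [sum_embedding_apply _ (hs1.trans hsn)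
      (fun i => gradient (fun y => f m y (z m i)) x)]
    rw [gradient_localLoss_finite hf]
    simp only [Finset.sum_const, Finset.card_univ, Fintype.card_fin, ← Nat.cast_smul_eq_nsmul ℝ,
      smul_smul]
    rw [inv_mul_cancel_left₀ hs0, sub_self, smul_zero]
  | online D =>
    set g := gradient (localLoss (ClientData.online D) f m) x with hg
    let h : Z → Vec d := fun z => gradient (fun y => f m y z) x - g
    have hbh : ∀ (r : ℕ), 1 ≤ r → ∀ B : Fin r → Z,
        batchGrad f m B x - g = (r : ℝ)⁻¹ • ∑ j, h (B j) := by
      intro r hr B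
      have hr0 : (r : ℝ) ≠ 0 := by positivity
      simp only [h, batchGrad_eq hf, Finset.sum_sub_distrib, smul_sub, Finset.sum_const,
        Finset.card_univ, Fintype.card_fin, ← Nat.cast_smul_eq_nsmul ℝ, smul_smul,
        inv_mul_cancel₀ hr0, one_smul]
    have hhm : Measurable h := hsg.sub_const _
    have hint : Integrable h (D m : Measure Z) := by
      have := isProbabilityMeasure_batchLaw (data := ClientData.online D) m (s := 1)
        (by simp [ClientData.size])
      have h1 := (hmem 1 le_rfl (by simp [ClientData.size])).integrable (by norm_num)
      simp_rw [hbh 1 le_rfl] at h1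
      have h2 := measurePreserving_eval (fun _ : Fin 1 => (D m : Measure Z)) 0
      rw [← h2.integrable_comp hhm.aestronglyMeasurable]
      simpa [Function.comp_def, ClientData.batchLaw] using h1
    -- The bias does not depend on the batch size, while its squared norm is at most `σ ^ 2 / r`; a
    -- large `r` forces it to vanish. No exchange of gradient and expectation is needed.
    have hmean : ∀ r : ℕ, 1 ≤ r →
        ∫ B, (batchGrad f m B x - g) ∂((ClientData.online D).batchLaw m r)
          = ∫ z, h z ∂(D m : Measure Z) := by
      intro r hr
      have hr0 : (r : ℝ) ≠ 0 := by positivity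
      simp_rw [hbh r hr]
      rw [integral_smul, ClientData.batchLaw, integral_finsetSum]
      · have : ∀ j : Fin r, ∫ B : Fin r → Z, h (B j) ∂(Measure.pi fun _ => (D m : Measure Z))
            = ∫ z, h z ∂(D m : Measure Z) := fun j => by
          have h2 := measurePreserving_eval (fun _ : Fin r => (D m : Measure Z)) j
          conv_rhs => rw [← h2.map_eq]
          rw [integral_map h2.measurable.aemeasurable hhm.aestronglyMeasurable]
        simp_rw [this]
        simp [← Nat.cast_smul_eq_nsmul ℝ, smul_smul, hr0]
      · intro j _
        have h2 := measurePreserving_eval (fun _ : Fin r => (D m : Measure Z)) j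
        exact (h2.integrable_comp hhm.aestronglyMeasurable).2 hint
    rw [hmean s hs1]
    by_contra hne
    have hpos : 0 < ‖∫ z, h z ∂(D m : Measure Z)‖ ^ 2 := by positivity
    obtain ⟨r, hr⟩ := exists_nat_gt (σ ^ 2 / ‖∫ z, h z ∂(D m : Measure Z)‖ ^ 2)
    have hr1 : 1 ≤ r := by
      by_contra h0
      have : r = 0 := by omega
      rw [this, Nat.cast_zero] at hr
      exact absurd hr (not_lt.2 (by positivity))
    have hr' : (0 : ℝ) < r := by positivity
    have := isProbabilityMeasure_batchLaw (data := ClientData.online D) m (s := r)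
      (by simp [ClientData.size])
    have h3 := norm_integral_sq_le (hmem r hr1 (by simp [ClientData.size]))
    have h4 := (integral_norm_sq_le (hbg r).aestronglyMeasurable (by positivity)
      (hσ m r hr1 (by simp [ClientData.size]) x)).2
    have h5 := h3.trans h4
    rw [hmean r hr1, le_div_iff₀ hr'] at h5
    rw [div_lt_iff₀ hpos] at hr
    linarith

end Problem

/-! ### Second moments of sums. -/

section SecondMoments

variable {Ω : Type*} [MeasurableSpace Ω] {μ : Measure Ω} {E : Type*} [NormedAddCommGroup E]

theorem norm_sum_sq_le {ι : Type*} (s : Finset ι) (v : ι → E) :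
    ‖∑ i ∈ s, v i‖ ^ 2 ≤ s.card * ∑ i ∈ s, ‖v i‖ ^ 2 := by
  calc ‖∑ i ∈ s, v i‖ ^ 2 ≤ (∑ i ∈ s, ‖v i‖) ^ 2 := by gcongr; exact norm_sum_le _ _
    _ ≤ _ := sq_sum_le_card_mul_sum_sq

theorem integral_norm_sum_sq_le {ι : Type*} (s : Finset ι) {φ : ι → Ω → E}
    (h : ∀ i ∈ s, MemLp (φ i) 2 μ) :
    ∫ x, ‖∑ i ∈ s, φ i x‖ ^ 2 ∂μ ≤ s.card * ∑ i ∈ s, ∫ x, ‖φ i x‖ ^ 2 ∂μ := by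
  rw [← integral_finsetSum s fun i hi => (h i hi).norm.integrable_sq, ← integral_const_mul]
  refine integral_mono (memLp_finsetSum s h).norm.integrable_sq
    ((integrable_finsetSum s fun i hi => (h i hi).norm.integrable_sq).const_mul _) fun x => ?_
  exact norm_sum_sq_le s fun i => φ i x

/-- Against the constant `g` only the mean of `φ` matters and the centred `ψ` drops out, so `ψ`
enters only through its second moment. -/
theorem integral_norm_const_add_add_sq_le [InnerProductSpace ℝ E] [CompleteSpace E]
    [IsProbabilityMeasure μ] {φ ψ : Ω → E} (hφ : MemLp φ 2 μ) (hψ : MemLp ψ 2 μ)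
    (h0 : ∫ x, ψ x ∂μ = 0) (g : E) :
    ∫ x, ‖g + φ x + ψ x‖ ^ 2 ∂μ ≤ ‖g‖ ^ 2 + 2 * ‖g‖ * ‖∫ x, φ x ∂μ‖
      + 2 * ∫ x, ‖φ x‖ ^ 2 ∂μ + 2 * ∫ x, ‖ψ x‖ ^ 2 ∂μ := by
  have iφ : Integrable φ μ := hφ.integrable (by norm_num)
  have iψ : Integrable ψ μ := hψ.integrable (by norm_num)
  have h1 : ∀ x, ‖g + φ x + ψ x‖ ^ 2 ≤ (‖g‖ ^ 2 + 2 * inner ℝ g (φ x + ψ x))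
      + (2 * ‖φ x‖ ^ 2 + 2 * ‖ψ x‖ ^ 2) := fun x => by
    rw [add_assoc, norm_add_sq_real]
    have := norm_add_le (φ x) (ψ x)
    nlinarith [sq_nonneg (‖φ x‖ - ‖ψ x‖), norm_nonneg (φ x + ψ x)]
  have i1 : Integrable (fun x => 2 * inner ℝ g (φ x + ψ x)) μ :=
    ((iφ.add iψ).const_inner g).const_mul 2
  have i2 : Integrable (fun x => ‖g‖ ^ 2 + 2 * inner ℝ g (φ x + ψ x)) μ :=
    (integrable_const _).add i1
  have i3 := hφ.norm.integrable_sq.const_mul 2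
  have i4 := hψ.norm.integrable_sq.const_mul 2
  have i5 : Integrable (fun x => 2 * ‖φ x‖ ^ 2 + 2 * ‖ψ x‖ ^ 2) μ := i3.add i4
  have h2 := integral_mono (((memLp_const g).add hφ).add hψ).norm.integrable_sq (i2.add i5) h1
  refine h2.trans ?_
  have h3 : ∫ x, inner ℝ g (φ x + ψ x) ∂μ = inner ℝ g (∫ x, φ x ∂μ) := by
    have i6 : Integrable (fun x => φ x + ψ x) μ := iφ.add iψ
    rw [integral_inner i6, integral_add iφ iψ, h0, add_zero]
  have h4 := real_inner_le_norm g (∫ x, φ x ∂μ)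
  calc _ = ‖g‖ ^ 2 + 2 * inner ℝ g (∫ x, φ x ∂μ)
        + (2 * ∫ x, ‖φ x‖ ^ 2 ∂μ + 2 * ∫ x, ‖ψ x‖ ^ 2 ∂μ) := by
        simp only [Pi.add_apply]
        rw [integral_add i2 i5, integral_add (integrable_const _) i1, integral_add i3 i4,
          integral_const_mul, integral_const_mul, integral_const_mul, h3]
        simp
    _ ≤ _ := by linarith

end SecondMoments

/-! ### The local iteration of a miner and its fresh noise. -/

section Miner

variable {M d K b' : ℕ} {Z : Type*} {f : Fin M → Vec d → Z → ℝ} {ηl : ℝ} {m : Fin M} {x g : Vec d}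

theorem minerRun_succ_prev {B : Fin K → Fin b' → Z} {k : ℕ} (h : k < K) :
    (minerRun f ηl m x g B (k + 1)).prev = (minerRun f ηl m x g B k).cur := by
  simp [minerRun, h]

theorem minerRun_succ_dir {B : Fin K → Fin b' → Z} {k : ℕ} (h : k < K) :
    (minerRun f ηl m x g B (k + 1)).dir = (minerRun f ηl m x g B k).dir
      - batchGrad f m (B ⟨k, h⟩) (minerRun f ηl m x g B k).prev
      + batchGrad f m (B ⟨k, h⟩) (minerRun f ηl m x g B k).cur := by
  simp [minerRun, h]

theorem minerRun_succ_cur {B : Fin K → Fin b' → Z} {k : ℕ} (h : k < K) :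
    (minerRun f ηl m x g B (k + 1)).cur = (minerRun f ηl m x g B k).cur
      - ηl • (minerRun f ηl m x g B (k + 1)).dir := by
  simp [minerRun, h]

/-- The state after `k` steps has used only the minibatches with index below `k`, so minibatch `j ≥
k` is still fresh. -/
theorem minerRun_update {B : Fin K → Fin b' → Z} {k : ℕ} (j : Fin K) (y : Fin b' → Z)
    (h : k ≤ j) :
    minerRun f ηl m x g (Function.update B j y) k = minerRun f ηl m x g B k := by
  induction k with
  | zero => rfl
  | succ k ih =>
    have hk : k < K := lt_of_lt_of_le h j.2.le
    have hne : (⟨k, hk⟩ : Fin K) ≠ j := by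
      intro h2; rw [← h2] at h; simp at h
    simp only [minerRun, hk, dif_pos, ih (by omega), Function.update_of_ne hne]

theorem minerChange_eq_sum (B : Fin K → Fin b' → Z) :
    minerChange f ηl m x g B
      = ηl • ∑ k ∈ Finset.range K, (minerRun f ηl m x g B (k + 1)).dir := by
  have h : ∀ k ≤ K, x - (minerRun f ηl m x g B k).cur
      = ηl • ∑ j ∈ Finset.range k, (minerRun f ηl m x g B (j + 1)).dir := by
    intro k hk
    induction k with
    | zero => simp [minerRun]
    | succ k ih =>
      rw [Finset.sum_range_succ, smul_add, ← ih (by omega), minerRun_succ_cur (by omega)]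
      abel
  exact h K le_rfl

variable [MeasurableSpace Z]

/-- Differences of stochastic gradients are unbiased estimates of the differences of the `L`-Lipschitz
field `H`, with variance at most `c` times the squared distance. -/
structure IsGradientOracle (f : Fin M → Vec d → Z → ℝ) (m : Fin M) (ν : Measure (Fin b' → Z))
    (H : Vec d → Vec d) (L c : ℝ) : Prop where
  measurable : Measurable (fun q : Vec d × (Fin b' → Z) => batchGrad f m q.2 q.1)
  mean : ∀ v w, ∫ y, (batchGrad f m y v - batchGrad f m y w - (H v - H w)) ∂ν = 0
  variance : ∀ v w, ∫⁻ y, ‖batchGrad f m y v - batchGrad f m y w - (H v - H w)‖ₑ ^ 2 ∂ν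
    ≤ ENNReal.ofReal (c * ‖v - w‖ ^ 2)
  lipschitz : ∀ v w, ‖H v - H w‖ ≤ L * ‖v - w‖
  nonneg : 0 ≤ c

theorem measurable_batchGrad_comp {α : Type*} [MeasurableSpace α]
    (hf : Measurable (fun q : Vec d × (Fin b' → Z) => batchGrad f m q.2 q.1))
    {u : α → Vec d} {B : α → Fin b' → Z} (hu : Measurable u) (hB : Measurable B) :
    Measurable fun a => batchGrad f m (B a) (u a) := by
  have h := hf.comp (hu.prodMk hB)
  simpa only [Function.comp_def] using h

theorem measurable_minerRun
    (hf : Measurable (fun q : Vec d × (Fin b' → Z) => batchGrad f m q.2 q.1)) (k : ℕ) :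
    Measurable (fun q : Vec d × Vec d × (Fin K → Fin b' → Z) =>
      (minerRun f ηl m q.1 q.2.1 q.2.2 k).prev) ∧
    Measurable (fun q : Vec d × Vec d × (Fin K → Fin b' → Z) =>
      (minerRun f ηl m q.1 q.2.1 q.2.2 k).cur) ∧
    Measurable (fun q : Vec d × Vec d × (Fin K → Fin b' → Z) =>
      (minerRun f ηl m q.1 q.2.1 q.2.2 k).dir) := by
  induction k with
  | zero =>
    exact ⟨measurable_fst, measurable_fst, measurable_snd.fst⟩
  | succ k ih =>
    by_cases hk : k < K
    · have hB : Measurable fun q : Vec d × Vec d × (Fin K → Fin b' → Z) => q.2.2 ⟨k, hk⟩ :=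
        (measurable_pi_apply _).comp measurable_snd.snd
      have hd : Measurable (fun q : Vec d × Vec d × (Fin K → Fin b' → Z) =>
          (minerRun f ηl m q.1 q.2.1 q.2.2 (k + 1)).dir) := by
        simp_rw [minerRun_succ_dir hk]
        have h1 : Measurable (fun q : Vec d × Vec d × (Fin K → Fin b' → Z) =>
            batchGrad f m (q.2.2 ⟨k, hk⟩) (minerRun f ηl m q.1 q.2.1 q.2.2 k).prev) :=
          measurable_batchGrad_comp hf ih.1 hB
        have h2 : Measurable (fun q : Vec d × Vec d × (Fin K → Fin b' → Z) =>
            batchGrad f m (q.2.2 ⟨k, hk⟩) (minerRun f ηl m q.1 q.2.1 q.2.2 k).cur) :=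
          measurable_batchGrad_comp hf ih.2.1 hB
        exact (ih.2.2.sub h1).add h2
      refine ⟨?_, ?_, hd⟩
      · simp_rw [minerRun_succ_prev hk]
        exact ih.2.1
      · simp_rw [minerRun_succ_cur hk]
        exact ih.2.1.sub (hd.const_smul ηl)
    · simpa only [minerRun, hk, dif_neg, not_false_eq_true] using ih

theorem measurable_minerChange
    (hf : Measurable (fun q : Vec d × (Fin b' → Z) => batchGrad f m q.2 q.1)) :
    Measurable (fun q : Vec d × Vec d × (Fin K → Fin b' → Z) =>
      minerChange f ηl m q.1 q.2.1 q.2.2) :=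
  measurable_fst.sub (measurable_minerRun hf K).2.1

variable {ν : Measure (Fin b' → Z)} [IsProbabilityMeasure ν] {H : Vec d → Vec d} {L c : ℝ}

/-- Adding the noise of a fresh minibatch. -/
theorem IsGradientOracle.add_noise (hG : IsGradientOracle f m ν H L c) (j : Fin K)
    {n u v : (Fin K → Fin b' → Z) → Vec d} (hn : Measurable n) (hu : Measurable u)
    (hv : Measurable v) (hn' : ∀ B y, n (Function.update B j y) = n B)
    (hu' : ∀ B y, u (Function.update B j y) = u B) (hv' : ∀ B y, v (Function.update B j y) = v B)
    (hn2 : MemLp n 2 (Measure.pi fun _ => ν)) (hn0 : ∫ B, n B ∂(Measure.pi fun _ => ν) = 0)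
    (huv : MemLp (fun B => u B - v B) 2 (Measure.pi fun _ => ν))
    {ζ : (Fin K → Fin b' → Z) → Vec d}
    (hζ : ∀ B, ζ B = n B + (batchGrad f m (B j) (u B) - batchGrad f m (B j) (v B)
      - (H (u B) - H (v B)))) :
    MemLp ζ 2 (Measure.pi fun _ => ν) ∧ ∫ B, ζ B ∂(Measure.pi fun _ => ν) = 0 ∧
    ∫ B, ‖ζ B‖ ^ 2 ∂(Measure.pi fun _ => ν) ≤ ∫ B, ‖n B‖ ^ 2 ∂(Measure.pi fun _ => ν)
      + c * ∫ B, ‖u B - v B‖ ^ 2 ∂(Measure.pi fun _ => ν) := by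
  have hH : Measurable H := (continuous_of_lipschitz hG.lipschitz).measurable
  have hξ : ∀ v w, MemLp (fun y => batchGrad f m y v - batchGrad f m y w - (H v - H w)) 2 ν := by
    intro v w
    refine (integral_norm_sq_le ?_ (mul_nonneg hG.nonneg (sq_nonneg _)) (hG.variance v w)).1
    exact (((hG.measurable.comp measurable_prodMk_left).sub
      (hG.measurable.comp measurable_prodMk_left)).sub_const _).aestronglyMeasurable
  have hm : Measurable ζ := by
    rw [funext hζ]
    have hj : Measurable fun B : Fin K → Fin b' → Z => B j := measurable_pi_apply j
    exact hn.add (((measurable_batchGrad_comp hG.measurable hu hj).sub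
      (measurable_batchGrad_comp hG.measurable hv hj)).sub ((hH.comp hu).sub (hH.comp hv)))
  have hupd : ∀ B y, ζ (Function.update B j y) = n B + (batchGrad f m y (u B)
      - batchGrad f m y (v B) - (H (u B) - H (v B))) := fun B y => by
    rw [hζ, hn', hu', hv', Function.update_self]
  have huv' : Measurable fun B => u B - v B := hu.sub hv
  have hbound : ∫⁻ B, ‖ζ B‖ₑ ^ 2 ∂(Measure.pi fun _ => ν)
      ≤ ENNReal.ofReal (∫ B, ‖n B‖ ^ 2 ∂(Measure.pi fun _ => ν)
      + c * ∫ B, ‖u B - v B‖ ^ 2 ∂(Measure.pi fun _ => ν)) := by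
    -- Minibatch `j` is integrated first: given the others, the points and the old noise are
    -- constants and the new increment is centred.
    rw [lintegral_pi_update (fun _ : Fin K => ν) j (hm.enorm.pow_const 2)]
    simp_rw [hupd]
    calc _ = ∫⁻ B, (‖n B‖ₑ ^ 2 + ∫⁻ y, ‖batchGrad f m y (u B)
        - batchGrad f m y (v B) - (H (u B) - H (v B))‖ₑ ^ 2 ∂ν) ∂(Measure.pi fun _ => ν) :=
          lintegral_congr fun B => lintegral_enorm_add_sq (hξ _ _) (hG.mean _ _) _
      _ ≤ ∫⁻ B, (‖n B‖ₑ ^ 2 + ENNReal.ofReal c * ‖u B - v B‖ₑ ^ 2)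
            ∂(Measure.pi fun _ => ν) := by
          refine lintegral_mono fun B => ?_
          gcongr
          refine (hG.variance _ _).trans_eq ?_
          rw [ENNReal.ofReal_mul hG.nonneg, ENNReal.ofReal_pow (norm_nonneg _), ofReal_norm]
      _ = _ := by
          rw [lintegral_add_left (hn.enorm.pow_const 2),
            lintegral_const_mul _ (huv'.enorm.pow_const 2), lintegral_enorm_sq_eq hn2,
            lintegral_enorm_sq_eq huv, ← ENNReal.ofReal_mul hG.nonneg,
            ← ENNReal.ofReal_add (by positivity) (mul_nonneg hG.nonneg (by positivity))]
  obtain ⟨h1, h2⟩ := integral_norm_sq_le hm.aestronglyMeasurable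
    (add_nonneg (by positivity) (mul_nonneg hG.nonneg (by positivity))) hbound
  refine ⟨h1, ?_, h2⟩
  rw [integral_pi_update (fun _ : Fin K => ν) j (h1.integrable (by norm_num))]
  simp_rw [hupd]
  rw [← hn0]
  refine integral_congr_ae (Filter.Eventually.of_forall fun B => ?_)
  simp only
  rw [integral_add (integrable_const _) ((hξ _ _).integrable (by norm_num)), hG.mean]
  simp

end Miner

/-! ### Moment bounds for the local iteration. -/

section MinerBounds

variable {M d K b' : ℕ} {Z : Type*} {f : Fin M → Vec d → Z → ℝ} {ηl : ℝ} {m : Fin M} {x g : Vec d}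
  {H : Vec d → Vec d}

/-- The accumulated noise of the update direction of a miner. -/
def minerNoise (f : Fin M → Vec d → Z → ℝ) (ηl : ℝ) (m : Fin M) (x g : Vec d) (H : Vec d → Vec d)
    (B : Fin K → Fin b' → Z) (k : ℕ) : Vec d :=
  (minerRun f ηl m x g B k).dir - g - (H (minerRun f ηl m x g B k).prev - H x)

theorem minerNoise_succ {B : Fin K → Fin b' → Z} {k : ℕ} (h : k < K) :
    minerNoise f ηl m x g H B (k + 1) = minerNoise f ηl m x g H B k
      + (batchGrad f m (B ⟨k, h⟩) (minerRun f ηl m x g B k).cur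
        - batchGrad f m (B ⟨k, h⟩) (minerRun f ηl m x g B k).prev
        - (H (minerRun f ηl m x g B k).cur - H (minerRun f ηl m x g B k).prev)) := by
  simp only [minerNoise, minerRun_succ_dir h, minerRun_succ_prev h]
  abel

/-- The first local step evaluates one minibatch twice at the same point, so the two gradients
cancel. The noise therefore accumulates only from the second step on. -/
theorem minerNoise_one (B : Fin K → Fin b' → Z) (h : 0 < K) :
    minerNoise f ηl m x g H B 1 = 0 := by
  rw [minerNoise_succ h]
  simp [minerNoise, minerRun]

/-- The direction splits into the received `g`, a deterministic drift controlled by the distance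
travelled, and centred noise. -/
theorem minerRun_dir_succ_eq {B : Fin K → Fin b' → Z} {k : ℕ} (h : k < K) :
    (minerRun f ηl m x g B (k + 1)).dir = g + (H (minerRun f ηl m x g B k).cur - H x)
      + minerNoise f ηl m x g H B (k + 1) := by
  simp only [minerNoise, minerRun_succ_prev h]
  abel

variable [MeasurableSpace Z] {ν : Measure (Fin b' → Z)} [IsProbabilityMeasure ν] {L c : ℝ}

theorem measurable_minerRun_batch
    (hf : Measurable (fun q : Vec d × (Fin b' → Z) => batchGrad f m q.2 q.1)) (k : ℕ) :
    Measurable (fun B : Fin K → Fin b' → Z => (minerRun f ηl m x g B k).prev) ∧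
    Measurable (fun B : Fin K → Fin b' → Z => (minerRun f ηl m x g B k).cur) ∧
    Measurable (fun B : Fin K → Fin b' → Z => (minerRun f ηl m x g B k).dir) := by
  have h : Measurable fun B : Fin K → Fin b' → Z => ((x, g, B) : Vec d × Vec d × _) :=
    measurable_const.prodMk (measurable_const.prodMk measurable_id)
  obtain ⟨h1, h2, h3⟩ := measurable_minerRun (ηl := ηl) (K := K) hf k
  exact ⟨h1.comp h, h2.comp h, h3.comp h⟩

theorem IsGradientOracle.memLp_sub (hG : IsGradientOracle f m ν H L c)
    {Ω : Type*} [MeasurableSpace Ω] {μ : Measure Ω} {u : Ω → Vec d} (hu : Measurable u)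
    (h2 : MemLp (fun B => u B - x) 2 μ) :
    MemLp (fun B => H (u B) - H x) 2 μ ∧
      ∫ B, ‖H (u B) - H x‖ ^ 2 ∂μ ≤ L ^ 2 * ∫ B, ‖u B - x‖ ^ 2 ∂μ := by
  have h1 : MemLp (fun B => H (u B) - H x) 2 μ :=
    MemLp.of_le_mul h2 (((continuous_of_lipschitz hG.lipschitz).measurable.comp hu).sub_const _).aestronglyMeasurable
      (Filter.Eventually.of_forall fun B => hG.lipschitz (u B) x)
  refine ⟨h1, ?_⟩
  rw [← integral_const_mul]
  refine integral_mono h1.norm.integrable_sq (h2.norm.integrable_sq.const_mul _) fun B => ?_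
  simp only
  rw [← mul_pow]
  have := hG.lipschitz (u B) x
  gcongr

theorem minerRun_dir_bound (hG : IsGradientOracle f m ν H L c) (hL : 0 < L) (hη : 0 < ηl)
    (hηKL : (ηl * K * L) ^ 2 = 1 / 24) {k : ℕ} (hk : k < K)
    (h1 : MemLp (fun B => (minerRun f ηl m x g B k).cur - x) 2
      (Measure.pi fun _ : Fin K => ν))
    (h2 : ∫ B, ‖(minerRun f ηl m x g B k).cur - x‖ ^ 2 ∂(Measure.pi fun _ : Fin K => ν)
      ≤ (ηl * k) ^ 2 * (2 * ‖g‖ ^ 2))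
    (h3 : MemLp (fun B => minerNoise f ηl m x g H B (k + 1)) 2 (Measure.pi fun _ : Fin K => ν))
    (h4 : ∫ B, minerNoise f ηl m x g H B (k + 1) ∂(Measure.pi fun _ : Fin K => ν) = 0)
    (h5 : ∫ B, ‖minerNoise f ηl m x g H B (k + 1)‖ ^ 2 ∂(Measure.pi fun _ : Fin K => ν)
      ≤ ‖g‖ ^ 2 / 24) :
    MemLp (fun B => (minerRun f ηl m x g B (k + 1)).dir) 2 (Measure.pi fun _ : Fin K => ν) ∧
    ∫ B, ‖(minerRun f ηl m x g B (k + 1)).dir‖ ^ 2 ∂(Measure.pi fun _ : Fin K => ν)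
      ≤ 2 * ‖g‖ ^ 2 := by
  obtain ⟨h6, h7⟩ := hG.memLp_sub (measurable_minerRun_batch hG.measurable k).2.1 h1
  simp_rw [minerRun_dir_succ_eq (H := H) hk]
  refine ⟨((memLp_const g).add h6).add h3, ?_⟩
  refine (integral_norm_const_add_add_sq_le h6 h3 h4 g).trans ?_
  have h8 : ∫ B, ‖H (minerRun f ηl m x g B k).cur - H x‖ ^ 2 ∂(Measure.pi fun _ : Fin K => ν)
      ≤ ‖g‖ ^ 2 / 12 := by
    have hk' : (k : ℝ) ≤ K := by exact_mod_cast hk.le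
    calc _ ≤ L ^ 2 * ((ηl * k) ^ 2 * (2 * ‖g‖ ^ 2)) := h7.trans (by gcongr)
      _ ≤ L ^ 2 * ((ηl * K) ^ 2 * (2 * ‖g‖ ^ 2)) := by gcongr
      _ = (ηl * K * L) ^ 2 * (2 * ‖g‖ ^ 2) := by ring
      _ = _ := by rw [hηKL]; ring
  have h9 := (norm_integral_sq_le h6).trans h8
  -- Here `3/10` exceeds `√(1/12)`. The total is then `1 + 3/5 + 1/6 + 1/12 < 2` times `‖g‖ ^ 2`.
  have h10 : ‖∫ B, (H (minerRun f ηl m x g B k).cur - H x) ∂(Measure.pi fun _ : Fin K => ν)‖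
      ≤ 3 / 10 * ‖g‖ := by
    refine abs_le_of_sq_le_sq' ?_ (by positivity) |>.2
    nlinarith [sq_nonneg ‖g‖]
  nlinarith [mul_le_mul_of_nonneg_left h10 (norm_nonneg g), sq_nonneg ‖g‖]

/-- Distance and noise are bounded by a joint induction: together they bound the next direction by
`2 * ‖g‖ ^ 2` in mean square, which in turn bounds the next displacement and the next noise
increment. Minkowski's inequality keeps the growth of the distance linear in `k`. -/
theorem minerRun_bounds (hG : IsGradientOracle f m ν H L c) (hL : 0 < L) (hη : 0 < ηl)
    (hηKL : (ηl * K * L) ^ 2 = 1 / 24) (hc : c ≤ K * L ^ 2 / 2) {k : ℕ} (hk : k < K) :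
    MemLp (fun B => (minerRun f ηl m x g B k).cur - x) 2 (Measure.pi fun _ : Fin K => ν) ∧
    ∫ B, ‖(minerRun f ηl m x g B k).cur - x‖ ^ 2 ∂(Measure.pi fun _ : Fin K => ν)
      ≤ (ηl * k) ^ 2 * (2 * ‖g‖ ^ 2) ∧
    MemLp (fun B => minerNoise f ηl m x g H B (k + 1)) 2 (Measure.pi fun _ : Fin K => ν) ∧
    ∫ B, minerNoise f ηl m x g H B (k + 1) ∂(Measure.pi fun _ : Fin K => ν) = 0 ∧
    ∫ B, ‖minerNoise f ηl m x g H B (k + 1)‖ ^ 2 ∂(Measure.pi fun _ : Fin K => ν)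
      ≤ k * (‖g‖ ^ 2 / (24 * K)) := by
  have hK : (0 : ℝ) < K := by exact_mod_cast (Nat.zero_le k).trans_lt hk
  induction k with
  | zero => simp [minerRun, minerNoise_one _ hk]
  | succ k ih =>
    have hk0 : k < K := by omega
    obtain ⟨h1, h2, h3, h4, h5⟩ := ih hk0
    have hkK : (k : ℝ) ≤ K := by exact_mod_cast hk0.le
    have h5' : ∫ B, ‖minerNoise f ηl m x g H B (k + 1)‖ ^ 2 ∂(Measure.pi fun _ : Fin K => ν)
        ≤ ‖g‖ ^ 2 / 24 := by
      refine h5.trans ?_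
      calc (k : ℝ) * (‖g‖ ^ 2 / (24 * K)) ≤ K * (‖g‖ ^ 2 / (24 * K)) := by gcongr
        _ = _ := by field_simp
    obtain ⟨h6, h7⟩ := minerRun_dir_bound hG hL hη hηKL hk0 h1 h2 h3 h4 h5'
    have hcur : ∀ B : Fin K → Fin b' → Z, (minerRun f ηl m x g B (k + 1)).cur - x
        = ((minerRun f ηl m x g B k).cur - x) + (-ηl) • (minerRun f ηl m x g B (k + 1)).dir := by
      intro B
      rw [minerRun_succ_cur hk0, neg_smul]
      abel
    have h6' := h6.const_smul (-ηl)
    have h7' : ∫ B, ‖(-ηl) • (minerRun f ηl m x g B (k + 1)).dir‖ ^ 2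
        ∂(Measure.pi fun _ : Fin K => ν) ≤ ηl ^ 2 * (2 * ‖g‖ ^ 2) := by
      simp_rw [norm_smul, mul_pow, norm_neg, Real.norm_eq_abs, sq_abs]
      rw [integral_const_mul]
      gcongr
    have hb1 : MemLp (fun B => (minerRun f ηl m x g B (k + 1)).cur - x) 2
        (Measure.pi fun _ : Fin K => ν) := by
      simp_rw [hcur]
      exact h1.add h6'
    have hb2 : ∫ B, ‖(minerRun f ηl m x g B (k + 1)).cur - x‖ ^ 2
        ∂(Measure.pi fun _ : Fin K => ν) ≤ (ηl * (k + 1 : ℕ)) ^ 2 * (2 * ‖g‖ ^ 2) := by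
      -- The Minkowski bound needs positive weights, so the step from the starting point is
      -- separate.
      rcases Nat.eq_zero_or_pos k with rfl | hkpos
      · refine le_trans (le_of_eq ?_) (h7'.trans_eq (by simp))
        refine integral_congr_ae (Filter.Eventually.of_forall fun B => ?_)
        simp only [hcur]
        simp [minerRun]
      · have hkp : (0 : ℝ) < k := by exact_mod_cast hkpos
        simp_rw [hcur]
        refine (integral_norm_add_sq_le h1 h6' (by positivity) hη h2 h7').trans_eq ?_
        push_cast; ring
    refine ⟨hb1, hb2, ?_⟩
    have hdiff : ∀ B : Fin K → Fin b' → Z, (minerRun f ηl m x g B (k + 1)).cur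
        - (minerRun f ηl m x g B (k + 1)).prev
        = (-ηl) • (minerRun f ηl m x g B (k + 1)).dir := by
      intro B
      rw [minerRun_succ_cur hk0, minerRun_succ_prev hk0, neg_smul]
      abel
    have hmr := measurable_minerRun_batch (ηl := ηl) (x := x) (g := g) (K := K) hG.measurable
    have hnm : Measurable fun B : Fin K → Fin b' → Z => minerNoise f ηl m x g H B (k + 1) :=
      ((hmr (k + 1)).2.2.sub_const g).sub
        (((continuous_of_lipschitz hG.lipschitz).measurable.comp (hmr (k + 1)).1).sub_const _)
    obtain ⟨hn1, hn2, hn3⟩ := hG.add_noise ⟨k + 1, hk⟩ hnm (hmr (k + 1)).2.1 (hmr (k + 1)).1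
      (fun B y => by simp only [minerNoise, minerRun_update (⟨k + 1, hk⟩ : Fin K) y le_rfl])
      (fun B y => by rw [minerRun_update (⟨k + 1, hk⟩ : Fin K) y le_rfl])
      (fun B y => by rw [minerRun_update (⟨k + 1, hk⟩ : Fin K) y le_rfl]) h3 h4
      (by simp_rw [hdiff]; exact h6') (fun B => minerNoise_succ hk)
    refine ⟨hn1, hn2, hn3.trans ?_⟩
    simp_rw [hdiff]
    -- The lower bound on `K`, in the form `c ≤ K * L ^ 2 / 2`, makes each noise increment at most a
    -- `1 / (24 K)` fraction of `‖g‖ ^ 2`.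
    have hsmall : c * (ηl ^ 2 * (2 * ‖g‖ ^ 2)) ≤ ‖g‖ ^ 2 / (24 * K) := by
      calc c * (ηl ^ 2 * (2 * ‖g‖ ^ 2)) ≤ K * L ^ 2 / 2 * (ηl ^ 2 * (2 * ‖g‖ ^ 2)) := by gcongr
        _ = (ηl * K * L) ^ 2 * ‖g‖ ^ 2 / K := by field_simp
        _ = _ := by rw [hηKL]; field_simp
    have := mul_le_mul_of_nonneg_left h7' hG.nonneg
    push_cast
    linarith

/-- The model change sent by a miner is close, in mean and in mean square, to a step along the
direction it received. -/
theorem minerChange_bounds (hG : IsGradientOracle f m ν H L c) (hL : 0 < L) (hη : 0 < ηl)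
    (hηKL : (ηl * K * L) ^ 2 = 1 / 24) (hc : c ≤ K * L ^ 2 / 2) (hK : 0 < K) :
    MemLp (fun B => minerChange f ηl m x g B) 2 (Measure.pi fun _ : Fin K => ν) ∧
    ‖∫ B, minerChange f ηl m x g B ∂(Measure.pi fun _ : Fin K => ν) - (ηl * K) • g‖
      ≤ ηl * K * (‖g‖ / 6) ∧
    ∫ B, ‖minerChange f ηl m x g B‖ ^ 2 ∂(Measure.pi fun _ : Fin K => ν)
      ≤ (ηl * K) ^ 2 * (36 / 25 * ‖g‖ ^ 2) := by
  have hK' : (0 : ℝ) < K := by exact_mod_cast hK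
  set π := (Measure.pi fun _ : Fin K => ν) with hπ
  have hb := fun k (hk : k ∈ Finset.range K) => minerRun_bounds (x := x) (g := g) hG hL hη hηKL hc
    (Finset.mem_range.1 hk)
  have hd := fun k (hk : k ∈ Finset.range K) => hG.memLp_sub
    (measurable_minerRun_batch hG.measurable k).2.1 (hb k hk).1
  -- Averages over the local steps of the drift (`φ`) and of the centred noise (`ψ`).
  let φ : (Fin K → Fin b' → Z) → Vec d := fun B =>
    (K : ℝ)⁻¹ • ∑ k ∈ Finset.range K, (H (minerRun f ηl m x g B k).cur - H x)
  let ψ : (Fin K → Fin b' → Z) → Vec d := fun B =>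
    (K : ℝ)⁻¹ • ∑ k ∈ Finset.range K, minerNoise f ηl m x g H B (k + 1)
  have hch : ∀ B, minerChange f ηl m x g B = (ηl * K) • (g + φ B + ψ B) := by
    intro B
    rw [minerChange_eq_sum, mul_smul]
    congr 1
    rw [Finset.sum_congr rfl fun k hk => minerRun_dir_succ_eq (H := H) (Finset.mem_range.1 hk)]
    simp only [φ, ψ, smul_add, smul_smul, Finset.sum_add_distrib, mul_inv_cancel₀ hK'.ne',
      one_smul, Finset.sum_const, Finset.card_range, Nat.cast_smul_eq_nsmul]
  have hφ : MemLp φ 2 π := (memLp_finsetSum _ fun k hk => (hd k hk).1).const_smul (K : ℝ)⁻¹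
  have hψ : MemLp ψ 2 π := (memLp_finsetSum _ fun k hk => (hb k hk).2.2.1).const_smul (K : ℝ)⁻¹
  have hψ0 : ∫ B, ψ B ∂π = 0 := by
    simp only [ψ]
    rw [integral_smul, integral_finsetSum _ fun k hk => (hb k hk).2.2.1.integrable (by norm_num),
      Finset.sum_eq_zero fun k hk => (hb k hk).2.2.2.1, smul_zero]
  have hsq : ∑ k ∈ Finset.range K, (k : ℝ) ^ 2 ≤ (K : ℝ) ^ 3 / 3 := by
    have : ∀ n : ℕ, ∑ k ∈ Finset.range n, (k : ℝ) ^ 2 ≤ (n : ℝ) ^ 3 / 3 := by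
      intro n
      induction n with
      | zero => simp
      | succ n ih =>
        rw [Finset.sum_range_succ]; push_cast
        nlinarith [(Nat.cast_nonneg n : (0 : ℝ) ≤ n)]
    exact this K
  have hlin : ∑ k ∈ Finset.range K, (k : ℝ) ≤ (K : ℝ) ^ 2 / 2 := by
    have : ∀ n : ℕ, ∑ k ∈ Finset.range n, (k : ℝ) ≤ (n : ℝ) ^ 2 / 2 := by
      intro n
      induction n with
      | zero => simp
      | succ n ih =>
        rw [Finset.sum_range_succ]; push_cast
        nlinarith [(Nat.cast_nonneg n : (0 : ℝ) ≤ n)]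
    exact this K
  have havg : ∀ (v : ℕ → (Fin K → Fin b' → Z) → Vec d),
      (∀ k ∈ Finset.range K, MemLp (v k) 2 π) →
      ∫ B, ‖(K : ℝ)⁻¹ • ∑ k ∈ Finset.range K, v k B‖ ^ 2 ∂π
        ≤ (K : ℝ)⁻¹ * ∑ k ∈ Finset.range K, ∫ B, ‖v k B‖ ^ 2 ∂π := by
    intro v hv
    simp_rw [norm_smul, mul_pow]
    rw [integral_const_mul]
    have := integral_norm_sum_sq_le (Finset.range K) hv
    rw [Finset.card_range] at this
    calc _ ≤ ‖(K : ℝ)⁻¹‖ ^ 2 * (K * ∑ k ∈ Finset.range K, ∫ B, ‖v k B‖ ^ 2 ∂π) := by gcongr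
      _ = _ := by
        rw [norm_inv, Real.norm_of_nonneg hK'.le]; field_simp
  -- Averaging `k ^ 2` over the steps gains a factor `3` over the worst case `1/12`, giving `1/36`
  -- and hence the relative mean error `1/6`.
  have hφ2 : ∫ B, ‖φ B‖ ^ 2 ∂π ≤ ‖g‖ ^ 2 / 36 := by
    refine (havg _ fun k hk => (hd k hk).1).trans ?_
    have : ∀ k ∈ Finset.range K, ∫ B, ‖H (minerRun f ηl m x g B k).cur - H x‖ ^ 2 ∂π
        ≤ ‖g‖ ^ 2 / (12 * K ^ 2) * (k : ℝ) ^ 2 := by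
      intro k hk
      calc _ ≤ L ^ 2 * ((ηl * k) ^ 2 * (2 * ‖g‖ ^ 2)) :=
            (hd k hk).2.trans (by gcongr; exact (hb k hk).2.1)
        _ = (ηl * K * L) ^ 2 * (2 * ‖g‖ ^ 2 * k ^ 2 / K ^ 2) := by field_simp
        _ = _ := by rw [hηKL]; field_simp; ring
    calc _ ≤ (K : ℝ)⁻¹ * ∑ k ∈ Finset.range K, ‖g‖ ^ 2 / (12 * K ^ 2) * (k : ℝ) ^ 2 := by
          gcongr with k hk; exact this k hk
      _ ≤ (K : ℝ)⁻¹ * (‖g‖ ^ 2 / (12 * K ^ 2) * ((K : ℝ) ^ 3 / 3)) := by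
          rw [← Finset.mul_sum]; gcongr
      _ = _ := by field_simp; ring
  have hψ2 : ∫ B, ‖ψ B‖ ^ 2 ∂π ≤ ‖g‖ ^ 2 / 48 := by
    refine (havg _ fun k hk => (hb k hk).2.2.1).trans ?_
    calc _ ≤ (K : ℝ)⁻¹ * ∑ k ∈ Finset.range K, (k : ℝ) * (‖g‖ ^ 2 / (24 * K)) := by
          gcongr with k hk; exact (hb k hk).2.2.2.2
      _ ≤ (K : ℝ)⁻¹ * ((K : ℝ) ^ 2 / 2 * (‖g‖ ^ 2 / (24 * K))) := by
          rw [← Finset.sum_mul]; gcongr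
      _ = _ := by field_simp; ring
  have hmean : ‖∫ B, φ B ∂π‖ ≤ ‖g‖ / 6 := by
    refine abs_le_of_sq_le_sq' ?_ (by positivity) |>.2
    have := (norm_integral_sq_le hφ).trans hφ2
    linarith
  have hmem : MemLp (fun B => g + φ B + ψ B) 2 π := ((memLp_const g).add hφ).add hψ
  have iφ : Integrable φ π := hφ.integrable (by norm_num)
  have iψ : Integrable ψ π := hψ.integrable (by norm_num)
  have iφ' : Integrable (fun B => g + φ B) π := (integrable_const g).add iφ
  refine ⟨?_, ?_, ?_⟩
  · simp_rw [hch]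
    exact hmem.const_smul (ηl * K)
  · simp_rw [hch]
    rw [integral_smul, integral_add iφ' iψ, integral_add (integrable_const g) iφ, hψ0, add_zero,
      ← smul_sub]
    simp only [integral_const, probReal_univ, one_smul, add_sub_cancel_left]
    rw [norm_smul, Real.norm_of_nonneg (by positivity)]
    gcongr
  · simp_rw [hch, norm_smul, mul_pow]
    rw [integral_const_mul, Real.norm_of_nonneg (by positivity), ← mul_pow]
    gcongr
    refine (integral_norm_const_add_add_sq_le hφ hψ hψ0 g).trans ?_
    -- The coefficients add up to `1 + 1/3 + 1/18 + 1/24`, which is below `36/25`.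
    nlinarith [mul_le_mul_of_nonneg_left hmean (norm_nonneg g), sq_nonneg ‖g‖]

end MinerBounds

/-! ### Random selection of clients, anchors and miners. -/

section ClientSampling

variable {M : ℕ}

/-- The law of the participating clients and of the coins. -/
def selectionLaw (M A : ℕ) (p : ℝ) : Measure (Finset (Fin M) × (Fin M → Bool)) :=
  (uniformLaw (Finset.powersetCard A (Finset.univ : Finset (Fin M))) id).prod
    (Measure.pi (fun _ : Fin M => coinLaw p))

/-- The miners of a round. -/
def minersOf (q : Finset (Fin M) × (Fin M → Bool)) : Finset (Fin M) :=
  q.1.filter (fun i => q.2 i = false)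

/-- The anchors of a round. -/
def anchorsOf (q : Finset (Fin M) × (Fin M → Bool)) : Finset (Fin M) :=
  q.1.filter (fun i => q.2 i = true)

theorem isProbabilityMeasure_coinLaw {p : ℝ} (hp : 0 ≤ p) (hp1 : p ≤ 1) :
    IsProbabilityMeasure (coinLaw p) := by
  constructor
  simp [coinLaw, ← ENNReal.ofReal_add hp (sub_nonneg.2 hp1)]

theorem coinLaw_singleton_true (p : ℝ) : coinLaw p {true} = ENNReal.ofReal p := by
  simp [coinLaw]

theorem powersetCard_univ_nonempty {A : ℕ} (hA : A ≤ M) :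
    (Finset.powersetCard A (Finset.univ : Finset (Fin M))).Nonempty :=
  Finset.powersetCard_nonempty.2 (by simpa using hA)

theorem isProbabilityMeasure_selectionLaw {A : ℕ} (hA : A ≤ M) {p : ℝ} (hp : 0 ≤ p) (hp1 : p ≤ 1) :
    IsProbabilityMeasure (selectionLaw M A p) := by
  have := isProbabilityMeasure_coinLaw hp hp1
  have := isProbabilityMeasure_uniformLaw (powersetCard_univ_nonempty hA) id
  unfold selectionLaw
  infer_instance

theorem pi_coinLaw_forall_true (c : Finset (Fin M)) {p : ℝ} (hp : 0 ≤ p) (hp1 : p ≤ 1) :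
    (Measure.pi (fun _ : Fin M => coinLaw p)).real {x | ∀ i ∈ c, x i = true} = p ^ c.card := by
  have := isProbabilityMeasure_coinLaw hp hp1
  have h : {x : Fin M → Bool | ∀ i ∈ c, x i = true}
      = Set.univ.pi fun i => if i ∈ c then {true} else Set.univ := by
    ext x
    simp only [Set.mem_ofPred_eq, Set.mem_pi, Set.mem_univ, true_implies]
    refine forall_congr' fun i => ?_
    by_cases hi : i ∈ c <;> simp [hi]
  rw [Measure.real, h, Measure.pi_pi]
  have h2 : ∀ i, coinLaw p (if i ∈ c then {true} else Set.univ)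
      = if i ∈ c then ENNReal.ofReal p else 1 := by
    intro i
    by_cases hi : i ∈ c
    · simp [hi, coinLaw_singleton_true]
    · rw [if_neg hi, if_neg hi, measure_univ]
  simp_rw [h2]
  rw [Finset.prod_ite, Finset.prod_const, Finset.prod_const_one, mul_one]
  simp [ENNReal.toReal_ofReal hp]

theorem integral_selectionLaw {A : ℕ} (hA : A ≤ M) {p : ℝ} (hp : 0 ≤ p) (hp1 : p ≤ 1)
    (φ : Finset (Fin M) × (Fin M → Bool) → ℝ) :
    ∫ q, φ q ∂selectionLaw M A p
      = ((Finset.powersetCard A (Finset.univ : Finset (Fin M))).card : ℝ)⁻¹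
        * ∑ c ∈ Finset.powersetCard A (Finset.univ : Finset (Fin M)),
          ∫ x, φ (c, x) ∂(Measure.pi (fun _ : Fin M => coinLaw p)) := by
  have := isProbabilityMeasure_coinLaw hp hp1
  have := isProbabilityMeasure_uniformLaw (powersetCard_univ_nonempty hA) id
  rw [selectionLaw, integral_prod _ Integrable.of_finite, integral_uniformLaw]
  · simp
  · exact (Measurable.of_discrete).stronglyMeasurable

/-- There is no miner exactly when all `A` participants draw an anchor coin, whatever the set of
participants. -/
theorem integral_miners_nonempty {A : ℕ} (hA : A ≤ M) {p : ℝ} (hp : 0 ≤ p) (hp1 : p ≤ 1) :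
    ∫ q, (if (minersOf q).Nonempty then (1 : ℝ) else 0) ∂selectionLaw M A p = 1 - p ^ A := by
  have := isProbabilityMeasure_coinLaw hp hp1
  rw [integral_selectionLaw hA hp hp1]
  have h : ∀ c ∈ Finset.powersetCard A (Finset.univ : Finset (Fin M)),
      ∫ x, (if (minersOf (c, x)).Nonempty then (1 : ℝ) else 0)
        ∂(Measure.pi (fun _ : Fin M => coinLaw p)) = 1 - p ^ A := by
    intro c hc
    have h1 : ∀ x : Fin M → Bool, (if (minersOf (c, x)).Nonempty then (1 : ℝ) else 0)
        = 1 - Set.indicator {x | ∀ i ∈ c, x i = true} (fun _ => 1) x := by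
      intro x
      have : (minersOf (c, x)).Nonempty ↔ ¬ ∀ i ∈ c, x i = true := by
        simp [minersOf, Finset.Nonempty]
      by_cases hx : ∀ i ∈ c, x i = true
      · rw [if_neg (by rw [this, not_not]; exact hx), Set.indicator_of_mem (by exact hx), sub_self]
      · rw [if_pos (this.2 hx), Set.indicator_of_notMem (by exact hx), sub_zero]
    simp_rw [h1]
    rw [integral_sub (integrable_const _) Integrable.of_finite,
      integral_indicator_const _ (Set.toFinite _).measurableSet, pi_coinLaw_forall_true c hp hp1,
      (Finset.mem_powersetCard.1 hc).2]
    simp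
  rw [Finset.sum_congr rfl h, Finset.sum_const, nsmul_eq_mul, inv_mul_cancel_left₀]
  exact_mod_cast (powersetCard_univ_nonempty hA).card_pos.ne'

/-- A client participates with probability `A / M`, by counting the `A`-subsets that contain it
through Pascal's rule, and is then an anchor with probability `p`. -/
theorem integral_mem_anchors {A : ℕ} (hA1 : 1 ≤ A) (hA : A ≤ M) {p : ℝ} (hp : 0 ≤ p) (hp1 : p ≤ 1)
    (i : Fin M) :
    ∫ q, (if i ∈ anchorsOf q then (1 : ℝ) else 0) ∂selectionLaw M A p = A * p / M := by
  have := isProbabilityMeasure_coinLaw hp hp1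
  rw [integral_selectionLaw hA hp hp1]
  have h : ∀ c ∈ Finset.powersetCard A (Finset.univ : Finset (Fin M)),
      ∫ x, (if i ∈ anchorsOf (c, x) then (1 : ℝ) else 0)
        ∂(Measure.pi (fun _ : Fin M => coinLaw p)) = if i ∈ c then p else 0 := by
    intro c _
    by_cases hi : i ∈ c
    · have h1 : ∀ x : Fin M → Bool, (if i ∈ anchorsOf (c, x) then (1 : ℝ) else 0)
          = Set.indicator {x | ∀ j ∈ ({i} : Finset (Fin M)), x j = true} (fun _ => 1) x := by
        intro x
        by_cases hx : x i = true <;> simp [anchorsOf, hi, hx, Set.indicator]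
      simp_rw [h1]
      rw [integral_indicator_const _ (Set.toFinite _).measurableSet,
        pi_coinLaw_forall_true {i} hp hp1]
      simp [hi]
    · simp [anchorsOf, hi]
  rw [Finset.sum_congr rfl h, ← Finset.sum_filter, Finset.sum_const, nsmul_eq_mul,
    Finset.card_powersetCard, Finset.card_univ, Fintype.card_fin]
  have h2 : ((Finset.powersetCard A (Finset.univ : Finset (Fin M))).filter (i ∈ ·)).card
      + (M - 1).choose A = M.choose A := by
    have h3 : (Finset.powersetCard A (Finset.univ : Finset (Fin M))).filter (¬ i ∈ ·)
        = Finset.powersetCard A (Finset.univ.erase i) := by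
      ext c
      simp only [Finset.mem_filter, Finset.mem_powersetCard, Finset.subset_erase]
      tauto
    have h4 := Finset.card_filter_add_card_filter_not
      (s := Finset.powersetCard A (Finset.univ : Finset (Fin M))) (i ∈ ·)
    rw [h3, Finset.card_powersetCard, Finset.card_powersetCard] at h4
    simpa using h4
  obtain ⟨a, rfl⟩ : ∃ a, A = a + 1 := ⟨A - 1, by omega⟩
  obtain ⟨n, rfl⟩ : ∃ n, M = n + 1 := ⟨M - 1, by omega⟩
  have h5 := Nat.add_one_mul_choose_eq n a
  rw [Nat.choose_succ_succ', Nat.add_sub_cancel] at h2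
  have h6 : ((Finset.powersetCard (a + 1) (Finset.univ : Finset (Fin (n + 1)))).filter
      (i ∈ ·)).card = n.choose a := by omega
  have h7 : (0 : ℝ) < (n + 1).choose (a + 1) := by exact_mod_cast Nat.choose_pos hA
  have h8 : ((n : ℝ) + 1) * n.choose a = (n + 1).choose (a + 1) * ((a : ℝ) + 1) := by
    exact_mod_cast h5
  rw [h6]
  push_cast
  field_simp
  linear_combination p * h8

end ClientSampling

/-! ### The law of one round. -/

section RoundLaw

variable {M K b b' A : ℕ} {Z : Type*} [MeasurableSpace Z] {data : ClientData M Z} {p : ℝ}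

theorem isProbabilityMeasure_roundLaw (hA : A ≤ M) (hp : 0 ≤ p) (hp1 : p ≤ 1)
    (hb : (b : ℕ∞) ≤ data.size) (hb' : (b' : ℕ∞) ≤ data.size) :
    IsProbabilityMeasure (roundLaw data A K b b' p) := by
  have := isProbabilityMeasure_coinLaw hp hp1
  have := isProbabilityMeasure_uniformLaw (powersetCard_univ_nonempty hA) id
  have := fun m => isProbabilityMeasure_batchLaw (data := data) m hb
  have := fun m => isProbabilityMeasure_batchLaw (data := data) m hb'
  unfold roundLaw
  infer_instance

/-- The displacement of the model depends only on the selection and the minibatches, so the large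
batches can be integrated out. -/
theorem measurePreserving_selection_small (hA : A ≤ M) (hp : 0 ≤ p) (hp1 : p ≤ 1)
    (hb : (b : ℕ∞) ≤ data.size) (hb' : (b' : ℕ∞) ≤ data.size) :
    MeasurePreserving (fun r : RoundDraw M K b b' Z => ((r.1, r.2.1), r.2.2.2))
      (roundLaw data A K b b' p)
      ((selectionLaw M A p).prod
        (Measure.pi fun m => Measure.pi fun _ : Fin K => data.batchLaw m b')) := by
  have := isProbabilityMeasure_coinLaw hp hp1
  have := isProbabilityMeasure_uniformLaw (powersetCard_univ_nonempty hA) id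
  have := fun m => isProbabilityMeasure_batchLaw (data := data) m hb
  have := fun m => isProbabilityMeasure_batchLaw (data := data) m hb'
  have h1 := (MeasurePreserving.id (uniformLaw (Finset.powersetCard A
    (Finset.univ : Finset (Fin M))) id)).prod ((MeasurePreserving.id (Measure.pi (fun _ : Fin M =>
      coinLaw p))).prod (measurePreserving_snd (μ := Measure.pi (fun m => data.batchLaw m b))
        (ν := Measure.pi (fun m : Fin M => Measure.pi (fun _ : Fin K => data.batchLaw m b')))))
  have h2 := (measurePreserving_prodAssoc (uniformLaw (Finset.powersetCard A
    (Finset.univ : Finset (Fin M))) id) (Measure.pi (fun _ : Fin M => coinLaw p))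
      (Measure.pi fun m => Measure.pi fun _ : Fin K => data.batchLaw m b')).symm
  exact h2.comp h1

end RoundLaw

/-! ### The displacement of the global model. -/

section ServerStep

theorem integral_comp_measurePreserving
    {α β : Type*} [MeasurableSpace α] [MeasurableSpace β] {μ : Measure α} {κ : Measure β}
    {h : α → β} (hh : MeasurePreserving h μ κ) {E : Type*} [NormedAddCommGroup E] [NormedSpace ℝ E]
    {φ : β → E} (hφ : AEStronglyMeasurable φ κ) : ∫ a, φ (h a) ∂μ = ∫ y, φ y ∂κ := by
  conv_rhs => rw [← hh.map_eq]
  rw [← hh.map_eq] at hφ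
  rw [integral_map hh.measurable.aemeasurable hφ]

variable {M d K b b' : ℕ} {Z : Type*} {f : Fin M → Vec d → Z → ℝ} {ηl ηs : ℝ} {x g : Vec d}

/-- The displacement of the global model in one round. -/
def serverStep (f : Fin M → Vec d → Z → ℝ) (ηl ηs : ℝ) (x g : Vec d)
    (q : Finset (Fin M) × (Fin M → Bool)) (small : Fin M → Fin K → Fin b' → Z) : Vec d :=
  -(ηs • (((minersOf q).card : ℝ)⁻¹ • ∑ i ∈ minersOf q, minerChange f ηl i x g (small i)))

theorem serverRound_model (s : ServerState M d) (r : RoundDraw M K b b' Z) :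
    (serverRound f ηl ηs s r).model
      = s.model + serverStep f ηl ηs s.model s.bullseye (r.1, r.2.1) r.2.2.2 := by
  simp only [serverRound, serverStep, minersOf]
  split_ifs with h
  -- Without miners the sum is empty, so the formula for `serverStep` already gives zero and needs
  -- no case distinction.
  · simp [Finset.card_eq_zero.1 h]
  · rw [← sub_eq_add_neg]

variable [MeasurableSpace Z] {ν : Fin M → Measure (Fin b' → Z)} [∀ i, IsProbabilityMeasure (ν i)]
  {H : Fin M → Vec d → Vec d} {L c : ℝ}

theorem measurable_serverStep
    (hf : ∀ i, Measurable (fun q : Vec d × (Fin b' → Z) => batchGrad f i q.2 q.1)) :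
    Measurable fun a : (Finset (Fin M) × (Fin M → Bool)) ×
      (Vec d × Vec d × (Fin M → Fin K → Fin b' → Z)) =>
        serverStep f ηl ηs a.2.1 a.2.2.1 a.1 a.2.2.2 := by
  refine measurable_from_prod_countable_right fun q => ?_
  have h : Measurable fun a : Vec d × Vec d × (Fin M → Fin K → Fin b' → Z) =>
      ∑ i ∈ minersOf q, minerChange f ηl i a.1 a.2.1 (a.2.2 i) := by
    refine Finset.measurable_sum _ fun i _ => ?_
    have h := (measurable_minerChange (ηl := ηl) (K := K) (hf i)).comp
      (measurable_fst.prodMk (measurable_snd.fst.prodMk ((measurable_pi_apply i).comp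
        measurable_snd.snd)) : Measurable fun a : Vec d × Vec d × (Fin M → Fin K → Fin b' → Z) =>
          (a.1, a.2.1, a.2.2 i))
    simpa only [Function.comp_def] using h
  exact ((h.const_smul ((minersOf q).card : ℝ)⁻¹).const_smul ηs).neg

/-- For a fixed selection the step is an average of miner changes with common bounds. Cauchy–Schwarz
loses nothing beyond the bound of a single miner, so the number of miners disappears. -/
theorem serverStep_bounds (hG : ∀ i, IsGradientOracle f i (ν i) (H i) L c) (hL : 0 < L)
    (hη : 0 < ηl) (hηs : 0 ≤ ηs) (hηKL : (ηl * K * L) ^ 2 = 1 / 24) (hc : c ≤ K * L ^ 2 / 2)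
    (hK : 0 < K) (q : Finset (Fin M) × (Fin M → Bool)) {γ δ : ℝ} (hγ : γ = ηs * (ηl * K))
    (hδ : δ = if (minersOf q).Nonempty then 1 else 0) :
    MemLp (serverStep f ηl ηs x g q) 2 (Measure.pi fun i => Measure.pi fun _ : Fin K => ν i) ∧
    ‖∫ B, serverStep f ηl ηs x g q B ∂(Measure.pi fun i => Measure.pi fun _ : Fin K => ν i)
      + (γ * δ) • g‖ ≤ δ * (γ * (‖g‖ / 6)) ∧
    ∫ B, ‖serverStep f ηl ηs x g q B‖ ^ 2 ∂(Measure.pi fun i => Measure.pi fun _ : Fin K => ν i)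
      ≤ δ * (γ ^ 2 * (36 / 25 * ‖g‖ ^ 2)) := by
  set π := Measure.pi fun i => Measure.pi fun _ : Fin K => ν i with hπ
  have hK' : (0 : ℝ) < K := by exact_mod_cast hK
  have hγ0 : 0 ≤ γ := by rw [hγ]; positivity
  by_cases hne : (minersOf q).Nonempty
  swap
  · rw [if_neg hne] at hδ
    rw [Finset.not_nonempty_iff_eq_empty] at hne
    have h0 : serverStep (K := K) (b' := b') f ηl ηs x g q = fun _ => 0 := by
      funext B; simp [serverStep, hne]
    rw [h0, hδ]
    simp
  rw [if_pos hne] at hδ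
  have hn : (0 : ℝ) < (minersOf q).card := by exact_mod_cast hne.card_pos
  have hb := fun i => minerChange_bounds (x := x) (g := g) (hG i) hL hη hηKL hc hK
  have hev : ∀ i, MeasurePreserving (fun B : Fin M → Fin K → Fin b' → Z => B i) π
      (Measure.pi fun _ : Fin K => ν i) := fun i => measurePreserving_eval _ i
  have hmem : ∀ i, MemLp (fun B : Fin M → Fin K → Fin b' → Z => minerChange f ηl i x g (B i)) 2 π :=
    fun i => (hb i).1.comp_measurePreserving (hev i)
  have hsum : MemLp (fun B : Fin M → Fin K → Fin b' → Z =>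
      ∑ i ∈ minersOf q, minerChange f ηl i x g (B i)) 2 π := memLp_finsetSum _ fun i _ => hmem i
  have hform : serverStep f ηl ηs x g q = fun B : Fin M → Fin K → Fin b' → Z =>
      (-(ηs * ((minersOf q).card : ℝ)⁻¹)) • ∑ i ∈ minersOf q, minerChange f ηl i x g (B i) := by
    funext B
    rw [serverStep, neg_smul, mul_smul]
  rw [hform]
  refine ⟨hsum.const_smul (-(ηs * ((minersOf q).card : ℝ)⁻¹)), ?_, ?_⟩
  · rw [integral_smul, integral_finsetSum _ fun i _ => (hmem i).integrable (by norm_num)]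
    have h1 : ∀ i, ∫ B, minerChange f ηl i x g (B i) ∂π
        = ∫ B, minerChange f ηl i x g B ∂(Measure.pi fun _ : Fin K => ν i) := fun i =>
      integral_comp_measurePreserving (hev i) (hb i).1.1
    simp_rw [h1]
    have h2 : (-(ηs * ((minersOf q).card : ℝ)⁻¹)) • ∑ i ∈ minersOf q,
          ∫ B, minerChange f ηl i x g B ∂(Measure.pi fun _ : Fin K => ν i) + (γ * δ) • g
        = (-(ηs * ((minersOf q).card : ℝ)⁻¹)) • ∑ i ∈ minersOf q,
          (∫ B, minerChange f ηl i x g B ∂(Measure.pi fun _ : Fin K => ν i)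
            - (ηl * K) • g) := by
      rw [Finset.sum_sub_distrib, smul_sub, Finset.sum_const, ← Nat.cast_smul_eq_nsmul ℝ, smul_smul,
        smul_smul, sub_eq_add_neg, ← neg_smul, hδ, hγ]
      congr 2
      field_simp
    rw [h2, norm_smul, norm_neg, Real.norm_of_nonneg (by positivity), hδ, hγ]
    calc _ ≤ ηs * ((minersOf q).card : ℝ)⁻¹ * ∑ i ∈ minersOf q, ηl * K * (‖g‖ / 6) := by
          gcongr
          exact (norm_sum_le _ _).trans (Finset.sum_le_sum fun i _ => (hb i).2.1)
      _ = _ := by rw [Finset.sum_const, nsmul_eq_mul]; field_simp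
  · simp_rw [norm_smul, mul_pow]
    rw [integral_const_mul, norm_neg, Real.norm_of_nonneg (by positivity), hδ, hγ]
    have h1 := integral_norm_sum_sq_le (minersOf q) (fun i _ => hmem i)
    have h2 : ∀ i, ∫ B, ‖minerChange f ηl i x g (B i)‖ ^ 2 ∂π
        ≤ (ηl * K) ^ 2 * (36 / 25 * ‖g‖ ^ 2) := fun i => by
      rw [integral_comp_measurePreserving (hev i) (hb i).1.norm.integrable_sq.1]
      exact (hb i).2.2
    calc _ ≤ (ηs * ((minersOf q).card : ℝ)⁻¹) ^ 2 * ((minersOf q).card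
            * ∑ i ∈ minersOf q, (ηl * K) ^ 2 * (36 / 25 * ‖g‖ ^ 2)) := by
          gcongr
          exact h1.trans (by gcongr with i _; exact h2 i)
      _ = _ := by rw [Finset.sum_const, nsmul_eq_mul]; field_simp

/-- The moments of the displacement of the global model. -/
theorem serverStep_moments (hG : ∀ i, IsGradientOracle f i (ν i) (H i) L c) (hL : 0 < L)
    (hη : 0 < ηl) (hηs : 0 ≤ ηs) (hηKL : (ηl * K * L) ^ 2 = 1 / 24) (hc : c ≤ K * L ^ 2 / 2)
    (hK : 0 < K) {A : ℕ} (hA : A ≤ M) {p : ℝ} (hp : 0 ≤ p) (hp1 : p ≤ 1)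
    {γ θ : ℝ} (hγ : γ = ηs * (ηl * K)) (hθ : θ = 1 - p ^ A)
    {π : Measure ((Finset (Fin M) × (Fin M → Bool)) × (Fin M → Fin K → Fin b' → Z))}
    (hπ : π = (selectionLaw M A p).prod (Measure.pi fun i => Measure.pi fun _ : Fin K => ν i)) :
    MemLp (fun a => serverStep f ηl ηs x g a.1 a.2) 2 π ∧
    ‖∫ a, serverStep f ηl ηs x g a.1 a.2 ∂π + (θ * γ) • g‖ ≤ θ * (γ * (‖g‖ / 6)) ∧
    ∫ a, ‖serverStep f ηl ηs x g a.1 a.2‖ ∂π ≤ θ * (γ * (6 / 5 * ‖g‖)) ∧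
    ∫ a, ‖serverStep f ηl ηs x g a.1 a.2‖ ^ 2 ∂π ≤ θ * (γ ^ 2 * (36 / 25 * ‖g‖ ^ 2)) := by
  have := isProbabilityMeasure_selectionLaw (M := M) hA hp hp1
  have hb := fun q => serverStep_bounds (x := x) (g := g) hG hL hη hηs hηKL hc hK q hγ rfl
  have hγ0 : 0 ≤ γ := by rw [hγ]; positivity
  have hπp : IsProbabilityMeasure π := by rw [hπ]; infer_instance
  have hmeas : Measurable fun a : (Finset (Fin M) × (Fin M → Bool)) ×
      (Fin M → Fin K → Fin b' → Z) => serverStep f ηl ηs x g a.1 a.2 := by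
    have h := (measurable_serverStep (ηl := ηl) (ηs := ηs) (K := K) fun i => (hG i).measurable).comp
      (measurable_fst.prodMk (measurable_const.prodMk (measurable_const.prodMk measurable_snd)) :
        Measurable fun a : (Finset (Fin M) × (Fin M → Bool)) × (Fin M → Fin K → Fin b' → Z) =>
          (a.1, x, g, a.2))
    simpa only [Function.comp_def] using h
  have hθint := integral_miners_nonempty (M := M) hA hp hp1
  rw [← hθ] at hθint
  have hmem : MemLp (fun a => serverStep f ηl ηs x g a.1 a.2) 2 π := by
    rw [memLp_two_iff_lintegral hmeas.aestronglyMeasurable, hπ,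
      lintegral_prod _ (hmeas.enorm.pow_const 2).aemeasurable]
    simp_rw [lintegral_enorm_sq_eq (hb _).1]
    exact Integrable.of_finite.lintegral_lt_top
  have hint : Integrable (fun a => serverStep f ηl ηs x g a.1 a.2) π :=
    hmem.integrable (by norm_num)
  refine ⟨hmem, ?_, ?_, ?_⟩
  · have h1 : (θ * γ) • g = ∫ q, (γ * if (minersOf q).Nonempty then (1 : ℝ) else 0) • g
        ∂selectionLaw M A p := by
      rw [integral_smul_const, integral_const_mul, hθint, mul_comm]
    rw [hπ] at hint ⊢
    rw [integral_prod _ hint, h1, ← integral_add Integrable.of_finite Integrable.of_finite]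
    refine (norm_integral_le_of_norm_le Integrable.of_finite
      (Filter.Eventually.of_forall fun q => (hb q).2.1)).trans_eq ?_
    rw [integral_mul_const, hθint]
  · rw [hπ] at hint ⊢
    rw [integral_prod _ hint.norm]
    calc _ ≤ ∫ q, (if (minersOf q).Nonempty then (1 : ℝ) else 0) * (γ * (6 / 5 * ‖g‖))
          ∂selectionLaw M A p := by
          refine integral_mono Integrable.of_finite Integrable.of_finite fun q => ?_
          -- The first moment is bounded for each fixed selection, where the indicator equals its
          -- square. Thus `θ` enters linearly; Jensen over the whole round would give only `√θ`.
          have h1 := norm_integral_sq_le (hb q).1.norm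
          simp only [norm_norm] at h1
          have h2 := h1.trans (hb q).2.2
          simp only
          refine abs_le_of_sq_le_sq' ?_ ?_ |>.2
          · rw [Real.norm_eq_abs, sq_abs] at h2
            refine h2.trans_eq ?_
            split_ifs <;> ring
          · split_ifs <;> positivity
      _ = _ := by rw [integral_mul_const, hθint]
  · have hint2 := hmem.norm.integrable_sq
    rw [hπ] at hint2 ⊢
    rw [integral_prod _ hint2]
    calc _ ≤ ∫ q, (if (minersOf q).Nonempty then (1 : ℝ) else 0) * (γ ^ 2 * (36 / 25 * ‖g‖ ^ 2))
          ∂selectionLaw M A p :=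
          integral_mono Integrable.of_finite Integrable.of_finite fun q => (hb q).2.2
      _ = _ := by rw [integral_mul_const, hθint]

end ServerStep

/-! ### Staleness of the cached gradients. -/

section Tracked

/-- The global model, the cached gradients, and the exact gradients at the points where the cached
ones were computed. -/
abbrev TrackedState (M d : ℕ) := Vec d × (Fin M → Vec d) × (Fin M → Vec d)

variable {M d K b b' : ℕ} {Z : Type*} {f : Fin M → Vec d → Z → ℝ} {ηl ηs : ℝ}
  {H : Fin M → Vec d → Vec d}

/-- One round of the algorithm on tracked states. -/
def trackedRound (f : Fin M → Vec d → Z → ℝ) (H : Fin M → Vec d → Vec d) (ηl ηs : ℝ)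
    (s : TrackedState M d) (r : RoundDraw M K b b' Z) : TrackedState M d :=
  (s.1 + serverStep f ηl ηs s.1 ((M : ℝ)⁻¹ • ∑ i, s.2.1 i) (r.1, r.2.1) r.2.2.2,
    fun i => if i ∈ anchorsOf (r.1, r.2.1) then batchGrad f i (r.2.2.1 i) s.1 else s.2.1 i,
    fun i => if i ∈ anchorsOf (r.1, r.2.1) then H i s.1 else s.2.2 i)

/-- The tracked states at the beginning of the rounds. -/
def trackedRun (f : Fin M → Vec d → Z → ℝ) (H : Fin M → Vec d → Vec d) (ηl ηs : ℝ) (x₀ : Vec d)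
    (init : Fin M → Fin b → Z) (draws : ℕ → RoundDraw M K b b' Z) : ℕ → TrackedState M d
  | 0 => (x₀, fun i => batchGrad f i (init i) x₀, fun i => H i x₀)
  | t + 1 => trackedRound f H ηl ηs (trackedRun f H ηl ηs x₀ init draws t) (draws t)

/-- The exact gradients at the cache points are bookkeeping for the analysis: they never influence
the model or the caches. -/
theorem run_eq_trackedRun (x₀ : Vec d) (init : Fin M → Fin b → Z)
    (draws : ℕ → RoundDraw M K b b' Z) (t : ℕ) :
    run f ηl ηs x₀ init draws t = ⟨(trackedRun f H ηl ηs x₀ init draws t).1,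
      (trackedRun f H ηl ηs x₀ init draws t).2.1⟩ := by
  induction t with
  | zero => rfl
  | succ t ih =>
    have h := serverRound_model (f := f) (ηl := ηl) (ηs := ηs) (run f ηl ηs x₀ init draws t)
      (draws t)
    have h2 : (serverRound f ηl ηs (run f ηl ηs x₀ init draws t) (draws t)).cache
        = (trackedRun f H ηl ηs x₀ init draws (t + 1)).2.1 := by
      rw [ih]
      funext i
      simp [serverRound, trackedRun, trackedRound, anchorsOf]
    rw [run]
    rw [ih] at h h2 ⊢
    rw [← h2]
    have h3 : (trackedRun f H ηl ηs x₀ init draws (t + 1)).1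
      = (serverRound f ηl ηs ⟨(trackedRun f H ηl ηs x₀ init draws t).1,
      (trackedRun f H ηl ηs x₀ init draws t).2.1⟩ (draws t)).model := by
      rw [h]; rfl
    rw [h3]

/-- The mean staleness error of the clients. -/
def staleness (H : Fin M → Vec d → Vec d) (s : TrackedState M d) : ℝ :=
  (M : ℝ)⁻¹ * ∑ i, ‖H i s.1 - s.2.2 i‖

/-- The average of the noise-free cached gradients. -/
def cleanDir (s : TrackedState M d) : Vec d := (M : ℝ)⁻¹ • ∑ i, s.2.2 i

/-- The part of the staleness error that a set of anchors removes. -/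
def refreshed (H : Fin M → Vec d → Vec d) (s : TrackedState M d) (I : Finset (Fin M)) : ℝ :=
  (M : ℝ)⁻¹ * ∑ i, if i ∈ I then ‖H i s.1 - s.2.2 i‖ else 0

theorem staleness_nonneg (s : TrackedState M d) : 0 ≤ staleness H s := by
  unfold staleness; positivity

theorem refreshed_nonneg (s : TrackedState M d) (I : Finset (Fin M)) : 0 ≤ refreshed H s I :=
  mul_nonneg (by positivity) (Finset.sum_nonneg fun i _ => by split_ifs <;> positivity)

theorem refreshed_le (s : TrackedState M d) (I : Finset (Fin M)) :
    refreshed H s I ≤ staleness H s := by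
  unfold refreshed staleness
  gcongr with i
  split_ifs
  · exact le_rfl
  · positivity

variable {L : ℝ}

/-- An anchor's old error disappears, and moving the model by `h` adds at most `L * ‖h‖` to every
client's error. -/
theorem staleness_trackedRound_le (hM : 0 < M) (hH : ∀ i v w, ‖H i v - H i w‖ ≤ L * ‖v - w‖)
    (s : TrackedState M d) (r : RoundDraw M K b b' Z) :
    staleness H (trackedRound f H ηl ηs s r) ≤ staleness H s
      - refreshed H s (anchorsOf (r.1, r.2.1))
      + L * ‖serverStep f ηl ηs s.1 ((M : ℝ)⁻¹ • ∑ i, s.2.1 i) (r.1, r.2.1) r.2.2.2‖ := by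
  have hM' : (0 : ℝ) < M := by exact_mod_cast hM
  set h := serverStep f ηl ηs s.1 ((M : ℝ)⁻¹ • ∑ i, s.2.1 i) (r.1, r.2.1) r.2.2.2 with hh
  have h1 : L * ‖h‖ = (M : ℝ)⁻¹ * ∑ _i : Fin M, L * ‖h‖ := by
    rw [Finset.sum_const, nsmul_eq_mul, Finset.card_univ, Fintype.card_fin,
      inv_mul_cancel_left₀ hM'.ne']
  rw [h1, staleness, staleness, refreshed, ← mul_sub, ← mul_add, ← Finset.sum_sub_distrib,
    ← Finset.sum_add_distrib]
  gcongr with i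
  simp only [trackedRound, ← hh]
  have h2 : ‖H i (s.1 + h) - H i s.1‖ ≤ L * ‖h‖ := by
    simpa using hH i (s.1 + h) s.1
  split_ifs
  · simpa using h2
  · rw [sub_zero]
    calc _ = ‖(H i s.1 - s.2.2 i) + (H i (s.1 + h) - H i s.1)‖ := by congr 1; abel
      _ ≤ _ := (norm_add_le _ _).trans (by gcongr)

theorem norm_cleanDir_trackedRound_le (s : TrackedState M d) (r : RoundDraw M K b b' Z) :
    ‖cleanDir (trackedRound f H ηl ηs s r)‖
      ≤ ‖cleanDir s‖ + refreshed H s (anchorsOf (r.1, r.2.1)) := by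
  have h1 : cleanDir (trackedRound f H ηl ηs s r) = cleanDir s
      + (M : ℝ)⁻¹ • ∑ i, if i ∈ anchorsOf (r.1, r.2.1) then H i s.1 - s.2.2 i else 0 := by
    rw [cleanDir, cleanDir, ← smul_add, ← Finset.sum_add_distrib]
    congr 1
    refine Finset.sum_congr rfl fun i _ => ?_
    simp only [trackedRound]
    split_ifs <;> simp
  rw [h1]
  refine (norm_add_le _ _).trans ?_
  rw [norm_smul, norm_inv, Real.norm_natCast, refreshed]
  gcongr
  refine (norm_sum_le _ _).trans (Finset.sum_le_sum fun i _ => ?_)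
  split_ifs <;> simp

/-- The refreshed part cancels in the sum of staleness and clean norm, so the second factor grows
only by `L * D` while the first one shrinks. -/
theorem staleness_potential_le (hM : 0 < M) (hH : ∀ i v w, ‖H i v - H i w‖ ≤ L * ‖v - w‖)
    (hL : 0 ≤ L) (s : TrackedState M d) (r : RoundDraw M K b b' Z) {D : ℝ}
    (hD : D = ‖serverStep f ηl ηs s.1 ((M : ℝ)⁻¹ • ∑ i, s.2.1 i) (r.1, r.2.1) r.2.2.2‖) :
    staleness H (trackedRound f H ηl ηs s r) * (staleness H (trackedRound f H ηl ηs s r)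
        + ‖cleanDir (trackedRound f H ηl ηs s r)‖)
      ≤ (staleness H s - refreshed H s (anchorsOf (r.1, r.2.1))) * (staleness H s + ‖cleanDir s‖)
        + L * D * (2 * staleness H s + ‖cleanDir s‖) + L ^ 2 * D ^ 2 := by
  have h1 := staleness_trackedRound_le (f := f) (ηl := ηl) (ηs := ηs) hM hH s r
  have h2 := norm_cleanDir_trackedRound_le (f := f) (H := H) (ηl := ηl) (ηs := ηs) s r
  rw [← hD] at h1
  have hD0 : 0 ≤ D := hD ▸ norm_nonneg _
  have h3 := staleness_nonneg (H := H) (trackedRound f H ηl ηs s r)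
  have h4 := refreshed_nonneg (H := H) s (anchorsOf (r.1, r.2.1))
  have h5 := refreshed_le (H := H) s (anchorsOf (r.1, r.2.1))
  set S := staleness H s
  set R := refreshed H s (anchorsOf (r.1, r.2.1))
  have hLD : 0 ≤ L * D := by positivity
  calc _ ≤ (S - R + L * D) * (S + ‖cleanDir s‖ + L * D) := by
        refine mul_le_mul h1 (by linarith) (by positivity) (by linarith)
    _ ≤ _ := by nlinarith [mul_nonneg hLD h4]

theorem norm_sub_cleanDir_le (s : TrackedState M d) :
    ‖(M : ℝ)⁻¹ • ∑ i, H i s.1 - cleanDir s‖ ≤ staleness H s := by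
  rw [cleanDir, ← smul_sub, ← Finset.sum_sub_distrib, norm_smul, norm_inv, Real.norm_natCast,
    staleness]
  gcongr
  exact norm_sum_le _ _

variable [MeasurableSpace Z]

theorem measurable_trackedRound
    (hf : ∀ i s, Measurable (fun q : Vec d × (Fin s → Z) => batchGrad f i q.2 q.1))
    (hH : ∀ i, Measurable (H i)) :
    Measurable fun a : TrackedState M d × RoundDraw M K b b' Z =>
      trackedRound f H ηl ηs a.1 a.2 := by
  have hq : Measurable fun a : TrackedState M d × RoundDraw M K b b' Z =>
      ((a.2.1, a.2.2.1) : Finset (Fin M) × (Fin M → Bool)) :=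
    measurable_snd.fst.prodMk measurable_snd.snd.fst
  have hI : ∀ i, MeasurableSet {a : TrackedState M d × RoundDraw M K b b' Z |
      i ∈ anchorsOf (a.2.1, a.2.2.1)} := fun i =>
    hq (MeasurableSet.of_discrete (s := {q | i ∈ anchorsOf q}))
  have hx : Measurable fun a : TrackedState M d × RoundDraw M K b b' Z => a.1.1 :=
    measurable_fst.fst
  have hg : Measurable fun a : TrackedState M d × RoundDraw M K b b' Z =>
      (M : ℝ)⁻¹ • ∑ i, a.1.2.1 i := by
    refine Measurable.const_smul (M := ℝ) (Finset.measurable_sum _ fun i _ => ?_) (M : ℝ)⁻¹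
    exact (measurable_pi_apply i).comp measurable_fst.snd.fst
  refine Measurable.prodMk ?_ (Measurable.prodMk (measurable_pi_lambda _ fun i => ?_)
    (measurable_pi_lambda _ fun i => ?_))
  · refine hx.add ?_
    have h := (measurable_serverStep (ηl := ηl) (ηs := ηs) (K := K) fun i => hf i b').comp
      (hq.prodMk (hx.prodMk (hg.prodMk measurable_snd.snd.snd.snd)))
    simpa only [Function.comp_def] using h
  · refine Measurable.ite (hI i) ?_ ((measurable_pi_apply i).comp measurable_fst.snd.fst)
    exact measurable_batchGrad_comp (hf i b) hx
      ((measurable_pi_apply i).comp measurable_snd.snd.snd.fst)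
  · exact Measurable.ite (hI i) ((hH i).comp hx)
      ((measurable_pi_apply i).comp measurable_fst.snd.snd)

theorem integral_refreshed {A : ℕ} (hA1 : 1 ≤ A) (hA : A ≤ M) {p : ℝ} (hp : 0 ≤ p) (hp1 : p ≤ 1)
    (s : TrackedState M d) :
    ∫ q, refreshed H s (anchorsOf q) ∂selectionLaw M A p = A * p / M * staleness H s := by
  have := isProbabilityMeasure_selectionLaw (M := M) hA hp hp1
  have h : ∀ (q : Finset (Fin M) × (Fin M → Bool)) (i : Fin M),
      (if i ∈ anchorsOf q then ‖H i s.1 - s.2.2 i‖ else 0)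
        = (if i ∈ anchorsOf q then (1 : ℝ) else 0) * ‖H i s.1 - s.2.2 i‖ := by
    intro q i; split_ifs <;> simp
  simp_rw [refreshed, h]
  rw [integral_const_mul, integral_finsetSum _ fun i _ => Integrable.of_finite]
  simp_rw [integral_mul_const, integral_mem_anchors hA1 hA hp hp1]
  rw [← Finset.mul_sum, staleness]
  ring

end Tracked

/-! ### Expected decrease of the potential in one round. -/

section Drift

variable {M d K b b' A : ℕ} {Z : Type*} [MeasurableSpace Z] {data : ClientData M Z}
  {f : Fin M → Vec d → Z → ℝ} {ηl ηs L c p : ℝ} {H : Fin M → Vec d → Vec d}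

/-- The potential: the optimality gap plus a multiple of the staleness term. -/
def potential (Φ : Vec d → ℝ) (Φ₀ : ℝ) (H : Fin M → Vec d → Vec d) (κ : ℝ)
    (s : TrackedState M d) : ℝ :=
  Φ s.1 - Φ₀ + κ * (staleness H s * (staleness H s + ‖cleanDir s‖))

/-- The average noise of the cached gradients. -/
def cacheNoise (s : TrackedState M d) : Vec d := (M : ℝ)⁻¹ • ∑ i, (s.2.1 i - s.2.2 i)

/-- Polarization turns the inner product with the clean direction into squares, so stale gradients
cost only `S ^ 2`. -/
theorem two_inner_ge {E : Type*} [NormedAddCommGroup E] [InnerProductSpace ℝ E] (a g e : E)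
    {S : ℝ} (h : ‖a - g‖ ≤ S) :
    ‖a‖ ^ 2 + ‖g‖ ^ 2 - S ^ 2 - 2 * ‖a‖ * ‖e‖ ≤ 2 * inner ℝ a (g + e) := by
  have h1 := norm_sub_sq_real a g
  have h2 := abs_le.1 (abs_real_inner_le_norm a e)
  have h3 : ‖a - g‖ ^ 2 ≤ S ^ 2 := by gcongr
  rw [inner_add_right]
  linarith [h2.1]

theorem serverStep_moments_roundLaw
    (hG : ∀ i, IsGradientOracle f i (data.batchLaw i b') (H i) L c) (hL : 0 < L)
    (hη : 0 < ηl) (hηs : 0 ≤ ηs) (hηKL : (ηl * K * L) ^ 2 = 1 / 24) (hc : c ≤ K * L ^ 2 / 2)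
    (hK : 0 < K) (hA : A ≤ M) (hp : 0 ≤ p) (hp1 : p ≤ 1)
    (hb : (b : ℕ∞) ≤ data.size) (hb' : (b' : ℕ∞) ≤ data.size)
    {γ θ : ℝ} (hγ : γ = ηs * (ηl * K)) (hθ : θ = 1 - p ^ A) (x g : Vec d)
    {ρ : Measure (RoundDraw M K b b' Z)} (hρ : ρ = roundLaw data A K b b' p) :
    MemLp (fun r : RoundDraw M K b b' Z =>
      serverStep f ηl ηs x g (r.1, r.2.1) r.2.2.2) 2 ρ ∧
    ‖∫ r, serverStep f ηl ηs x g (r.1, r.2.1) r.2.2.2 ∂ρ + (θ * γ) • g‖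
      ≤ θ * (γ * (‖g‖ / 6)) ∧
    ∫ r, ‖serverStep f ηl ηs x g (r.1, r.2.1) r.2.2.2‖ ∂ρ ≤ θ * (γ * (6 / 5 * ‖g‖)) ∧
    ∫ r, ‖serverStep f ηl ηs x g (r.1, r.2.1) r.2.2.2‖ ^ 2 ∂ρ
      ≤ θ * (γ ^ 2 * (36 / 25 * ‖g‖ ^ 2)) := by
  have := fun i => isProbabilityMeasure_batchLaw (data := data) i hb'
  have hsel := measurePreserving_selection_small (K := K) (b := b) (b' := b') (data := data)
    hA hp hp1 hb hb'
  rw [← hρ] at hsel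
  obtain ⟨m1, m2, m3, m4⟩ := serverStep_moments (x := x) (g := g) hG hL hη hηs hηKL hc hK hA
    hp hp1 hγ hθ rfl
  have hmem := m1.comp_measurePreserving hsel
  have e1 := integral_comp_measurePreserving hsel m1.1
  have e2 := integral_comp_measurePreserving hsel m1.1.norm
  have e3 := integral_comp_measurePreserving hsel m1.norm.integrable_sq.1
  rw [← e1] at m2
  rw [← e2] at m3
  rw [← e3] at m4
  exact ⟨by simpa only [Function.comp_def] using hmem, m2, m3, m4⟩

/-- The one-round decrease of the potential. -/
theorem lintegral_potential_trackedRound_le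
    (hG : ∀ i, IsGradientOracle f i (data.batchLaw i b') (H i) L c) (hL : 0 < L)
    (hη : 0 < ηl) (hηs : 0 ≤ ηs) (hηKL : (ηl * K * L) ^ 2 = 1 / 24) (hc : c ≤ K * L ^ 2 / 2)
    (hK : 0 < K) (hA1 : 1 ≤ A) (hA : A ≤ M) (hp : 0 < p) (hp1 : p ≤ 1)
    (hb : (b : ℕ∞) ≤ data.size) (hb' : (b' : ℕ∞) ≤ data.size)
    {Φ : Vec d → ℝ} {Φ₀ : ℝ} (hΦ : Differentiable ℝ Φ)
    (hΦL : ∀ v w, ‖gradient Φ v - gradient Φ w‖ ≤ L * ‖v - w‖)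
    (hΦH : ∀ v, gradient Φ v = (M : ℝ)⁻¹ • ∑ i, H i v) (hΦ₀ : ∀ v, Φ₀ ≤ Φ v)
    {γ θ Q κ : ℝ} (hγ : γ = ηs * (ηl * K)) (hθ : θ = 1 - p ^ A) (hQ : Q = A * p / M)
    (hκ : κ = 5 / 8 * (θ * γ) / Q) (hu : L * γ ≤ 1) (hz : θ * (L * γ) / Q ≤ (1 - L * γ) / 2)
    (s : TrackedState M d) :
    ∫⁻ r, ENNReal.ofReal (potential Φ Φ₀ H κ (trackedRound f H ηl ηs s r))
        ∂(roundLaw data A K b b' p) + ENNReal.ofReal (θ * γ / 200 * ‖gradient Φ s.1‖ ^ 2)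
      ≤ ENNReal.ofReal (potential Φ Φ₀ H κ s)
        + ENNReal.ofReal (1500 * (θ * γ) * ‖cacheNoise s‖ ^ 2) := by
  have hM : 0 < M := by omega
  have hM' : (0 : ℝ) < M := by exact_mod_cast hM
  have hA' : (0 : ℝ) < A := by exact_mod_cast hA1
  have hQ0 : 0 < Q := by rw [hQ]; positivity
  have hγ0 : 0 ≤ γ := by rw [hγ]; positivity
  have hθ0 : 0 ≤ θ := by rw [hθ, sub_nonneg]; exact pow_le_one₀ hp.le hp1
  have hκ0 : 0 ≤ κ := by rw [hκ]; positivity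
  have := fun i => isProbabilityMeasure_batchLaw (data := data) i hb'
  have := isProbabilityMeasure_selectionLaw (M := M) hA hp.le hp1
  set ρ := roundLaw data A K b b' p with hρ
  have hρp : IsProbabilityMeasure ρ := isProbabilityMeasure_roundLaw hA hp.le hp1 hb hb'
  have hsel := measurePreserving_selection_small (K := K) (b := b) (b' := b') (data := data)
    hA hp.le hp1 hb hb'
  rw [← hρ] at hsel
  set g : Vec d := (M : ℝ)⁻¹ • ∑ i, s.2.1 i with hg
  set N := ‖gradient Φ s.1‖ with hN
  set G := ‖cleanDir s‖ with hGdef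
  set S := staleness H s with hS
  set X := ‖cacheNoise s‖ with hX
  have hS0 : 0 ≤ S := staleness_nonneg s
  have hsplit : g = cleanDir s + cacheNoise s := by
    rw [hg, cleanDir, cacheNoise, ← smul_add, ← Finset.sum_add_distrib]
    simp
  obtain ⟨hmem, m2, m3, m4⟩ := serverStep_moments_roundLaw hG hL hη hηs hηKL hc hK hA hp.le hp1 hb
    hb' hγ hθ s.1 g hρ
  obtain ⟨h, hh⟩ : ∃ h : RoundDraw M K b b' Z → Vec d,
    h = fun r => serverStep f ηl ηs s.1 g (r.1, r.2.1) r.2.2.2 := ⟨_, rfl⟩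
  have hhr : ∀ r : RoundDraw M K b b' Z, serverStep f ηl ηs s.1 g (r.1, r.2.1) r.2.2.2 = h r :=
    fun r => by rw [hh]
  simp_rw [hhr] at hmem m2 m3 m4
  have hint : Integrable h ρ := hmem.integrable (by norm_num)
  have hR := integral_refreshed (H := H) hA1 hA hp.le hp1 s
  rw [← hQ, ← hS] at hR
  have hselA : MeasurePreserving (fun r : RoundDraw M K b b' Z => (r.1, r.2.1)) ρ
      (selectionLaw M A p) := measurePreserving_fst.comp hsel
  have e4 := integral_comp_measurePreserving hselA
    (Integrable.of_finite (f := fun q => refreshed H s (anchorsOf q))).1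
  rw [hR] at e4
  have hRint : Integrable (fun r : RoundDraw M K b b' Z => refreshed H s (anchorsOf (r.1, r.2.1))) ρ :=
    (hselA.integrable_comp (Integrable.of_finite (f := fun q => refreshed H s (anchorsOf q))).1).2
      Integrable.of_finite
  -- A pointwise upper bound for the new potential, built only from quantities with known moments
  -- under the round law.
  let U : RoundDraw M K b b' Z → ℝ := fun r =>
    (Φ s.1 - Φ₀ + κ * (S * (S + G)) - κ * (S + G) * refreshed H s (anchorsOf (r.1, r.2.1)))
      + (inner ℝ (gradient Φ s.1) (h r) + ((L / 2 + κ * L ^ 2) * ‖h r‖ ^ 2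
        + κ * L * (2 * S + G) * ‖h r‖))
  have hVU : ∀ r, potential Φ Φ₀ H κ (trackedRound f H ηl ηs s r) ≤ U r := by
    intro r
    have h1 := le_of_lipschitz_gradient hΦ hΦL s.1 (h r)
    have h2 := staleness_potential_le (f := f) (ηl := ηl) (ηs := ηs) hM
      (fun i => (hG i).lipschitz) hL.le s r rfl
    have h3 : (trackedRound f H ηl ηs s r).1 = s.1 + h r := by rw [← hhr]; rfl
    rw [← hg, hhr] at h2
    have h4 := mul_le_mul_of_nonneg_left h2 hκ0
    simp only [U]
    rw [potential, h3]
    have h5 : κ * ((S - refreshed H s (anchorsOf (r.1, r.2.1))) * (S + G)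
        + L * ‖h r‖ * (2 * S + G) + L ^ 2 * ‖h r‖ ^ 2)
      = κ * (S * (S + G)) - κ * (S + G) * refreshed H s (anchorsOf (r.1, r.2.1))
        + (κ * L ^ 2 * ‖h r‖ ^ 2 + κ * L * (2 * S + G) * ‖h r‖) := by ring
    have h6 := h4.trans_eq h5
    linarith
  have i1 : Integrable (fun r : RoundDraw M K b b' Z => Φ s.1 - Φ₀ + κ * (S * (S + G))
      - κ * (S + G) * refreshed H s (anchorsOf (r.1, r.2.1))) ρ :=
    (integrable_const _).sub (hRint.const_mul _)
  have i2 : Integrable (fun r => inner ℝ (gradient Φ s.1) (h r)) ρ := hint.const_inner _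
  have i3 : Integrable (fun r => (L / 2 + κ * L ^ 2) * ‖h r‖ ^ 2) ρ :=
    hmem.norm.integrable_sq.const_mul _
  have i4 : Integrable (fun r => κ * L * (2 * S + G) * ‖h r‖) ρ := hint.norm.const_mul _
  have i34 : Integrable (fun r => (L / 2 + κ * L ^ 2) * ‖h r‖ ^ 2
      + κ * L * (2 * S + G) * ‖h r‖) ρ := i3.add i4
  have i234 : Integrable (fun r => inner ℝ (gradient Φ s.1) (h r)
      + ((L / 2 + κ * L ^ 2) * ‖h r‖ ^ 2 + κ * L * (2 * S + G) * ‖h r‖)) ρ := i2.add i34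
  have hU : Integrable U ρ := i1.add i234
  have hUint : ∫ r, U r ∂ρ = (Φ s.1 - Φ₀ + κ * (S * (S + G)) - κ * (S + G) * (Q * S))
      + (inner ℝ (gradient Φ s.1) (∫ r, h r ∂ρ) + ((L / 2 + κ * L ^ 2) * ∫ r, ‖h r‖ ^ 2 ∂ρ
        + κ * L * (2 * S + G) * ∫ r, ‖h r‖ ∂ρ)) := by
    simp only [U]
    rw [integral_add i1 i234, integral_add i2 i34, integral_add i3 i4,
      integral_sub (integrable_const _) (hRint.const_mul _), integral_const_mul,
      integral_const_mul, integral_const_mul, integral_inner hint, e4]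
    simp
  have hinner : inner ℝ (gradient Φ s.1) (∫ r, h r ∂ρ)
      ≤ θ * γ * (-inner ℝ (gradient Φ s.1) g + N * ‖g‖ / 6) := by
    have h1 : ∫ r, h r ∂ρ = (∫ r, h r ∂ρ + (θ * γ) • g) - (θ * γ) • g := by abel
    rw [h1, inner_sub_right, inner_smul_right]
    have h2 := (real_inner_le_norm (gradient Φ s.1) (∫ r, h r ∂ρ + (θ * γ) • g)).trans
      (mul_le_mul_of_nonneg_left m2 (norm_nonneg _))
    rw [← hN] at h2
    linarith
  have hTN := two_inner_ge (gradient Φ s.1) (cleanDir s) (cacheNoise s) (S := S) (by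
    rw [hΦH]; exact norm_sub_cleanDir_le s)
  rw [← hsplit, ← hN, ← hGdef, ← hX] at hTN
  have hgle : ‖g‖ ≤ G + X := by rw [hsplit]; exact norm_add_le _ _
  have hGN : G ≤ N + S := by
    have h1 := norm_sub_cleanDir_le (H := H) s
    rw [← hΦH] at h1
    have h2 := norm_sub_norm_le (cleanDir s) (gradient Φ s.1)
    rw [norm_sub_rev] at h2
    linarith
  -- With this `w`, the smoothness term has weight `1 - w = L * γ`, and the step-size condition `hz`
  -- bounds the weight of the staleness terms by `w / 2`.
  have hdrift := drift_ineq (w := 1 - L * γ) (norm_nonneg _ : 0 ≤ N) (norm_nonneg _ : 0 ≤ G) hS0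
    (norm_nonneg _ : 0 ≤ X) (norm_nonneg g) hgle hGN (by linarith) (by
      have : 0 ≤ L * γ := by positivity
      linarith)
  have hzz : 5 / 4 * (θ * (L * γ) / Q) * (6 / 5 * ‖g‖ * (2 * S + G)
        + (1 - (1 - L * γ)) * (36 / 25 * ‖g‖ ^ 2))
      ≤ 5 / 4 * ((1 - L * γ) / 2) * (6 / 5 * ‖g‖ * (2 * S + G)
        + (1 - (1 - L * γ)) * (36 / 25 * ‖g‖ ^ 2)) := by
    have h0 : 0 ≤ 1 - (1 - L * γ) := by rw [sub_sub_cancel]; positivity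
    gcongr
  have hfinal : ∫ r, U r ∂ρ + θ * γ / 200 * N ^ 2
      ≤ potential Φ Φ₀ H κ s + 1500 * (θ * γ) * X ^ 2 := by
    rw [hUint, potential]
    have h1 : (L / 2 + κ * L ^ 2) * ∫ r, ‖h r‖ ^ 2 ∂ρ
        ≤ (L / 2 + κ * L ^ 2) * (θ * (γ ^ 2 * (36 / 25 * ‖g‖ ^ 2))) := by gcongr
    have h2 : κ * L * (2 * S + G) * ∫ r, ‖h r‖ ∂ρ
        ≤ κ * L * (2 * S + G) * (θ * (γ * (6 / 5 * ‖g‖))) := by gcongr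
    -- This is where `κ` is fixed: the expected refresh yields `5/4 * S * (S + G)` on the scale `θ *
    -- γ / 2`, more than the `S ^ 2` lost to staleness.
    have h3 : κ * (S + G) * (Q * S) = θ * γ / 2 * (5 / 4 * S * (S + G)) := by
      rw [hκ]; field_simp; ring
    have h4 : (L / 2 + κ * L ^ 2) * (θ * (γ ^ 2 * (36 / 25 * ‖g‖ ^ 2)))
        + κ * L * (2 * S + G) * (θ * (γ * (6 / 5 * ‖g‖)))
        = θ * γ / 2 * (L * γ * (36 / 25 * ‖g‖ ^ 2) + 5 / 4 * (θ * (L * γ) / Q)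
          * (6 / 5 * ‖g‖ * (2 * S + G) + (1 - (1 - L * γ)) * (36 / 25 * ‖g‖ ^ 2))) := by
      rw [hκ]; field_simp; ring
    have hθγ : 0 ≤ θ * γ / 2 := by positivity
    rw [← hS, ← hGdef]
    set P := 5 / 4 * S * (S + G)
    set P' := L * γ * (36 / 25 * ‖g‖ ^ 2) + 5 / 4 * (θ * (L * γ) / Q)
          * (6 / 5 * ‖g‖ * (2 * S + G) + (1 - (1 - L * γ)) * (36 / 25 * ‖g‖ ^ 2)) with hP'
    have h5 : -P - 2 * inner ℝ (gradient Φ s.1) g + N * ‖g‖ / 3 + P'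
        ≤ -(1 / 100) * N ^ 2 + 3000 * X ^ 2 := by
      refine le_trans ?_ hdrift
      simp only [P, hP']
      linarith
    have h6 := mul_le_mul_of_nonneg_left h5 hθγ
    have h7 : θ * γ / 2 * (-P - 2 * inner ℝ (gradient Φ s.1) g + N * ‖g‖ / 3 + P')
        = -(θ * γ / 2 * P) + θ * γ * (-inner ℝ (gradient Φ s.1) g + N * ‖g‖ / 6)
          + θ * γ / 2 * P' := by ring
    have h8 : θ * γ / 2 * (-(1 / 100) * N ^ 2 + 3000 * X ^ 2)
        = -(θ * γ / 200 * N ^ 2) + 1500 * (θ * γ) * X ^ 2 := by ring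
    rw [h7, h8] at h6
    rw [h3]
    linarith
  have hVnn : ∀ s' : TrackedState M d, 0 ≤ potential Φ Φ₀ H κ s' := fun s' => by
    have h1 := staleness_nonneg (H := H) s'
    have h2 := sub_nonneg.2 (hΦ₀ s'.1)
    unfold potential
    positivity
  have hUnn : 0 ≤ᵐ[ρ] U := Filter.Eventually.of_forall fun r => (hVnn _).trans (hVU r)
  calc _ ≤ ∫⁻ r, ENNReal.ofReal (U r) ∂ρ + ENNReal.ofReal (θ * γ / 200 * N ^ 2) := by
        gcongr with r
        exact hVU r
    _ = ENNReal.ofReal (∫ r, U r ∂ρ + θ * γ / 200 * N ^ 2) := by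
        rw [← ofReal_integral_eq_lintegral_ofReal hU hUnn,
          ENNReal.ofReal_add (integral_nonneg_of_ae hUnn) (by positivity)]
    _ ≤ ENNReal.ofReal (potential Φ Φ₀ H κ s + 1500 * (θ * γ) * X ^ 2) :=
        ENNReal.ofReal_le_ofReal hfinal
    _ = _ := ENNReal.ofReal_add (hVnn s) (by positivity)

end Drift

/-! ### Noise of independently refreshed caches. -/

section Noise

variable {M d K b b' A : ℕ} {Z : Type*} [MeasurableSpace Z] {data : ClientData M Z}
  {f : Fin M → Vec d → Z → ℝ} {ηl ηs p : ℝ} {H : Fin M → Vec d → Vec d}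

/-- Adding one independent centred term at a time, Pythagoras makes the variances add without cross
terms. -/
theorem lintegral_enorm_add_sum_sq_le {ι : Type*} [Fintype ι] [DecidableEq ι] {Y : ι → Type*}
    [∀ i, MeasurableSpace (Y i)] {ν : ∀ i, Measure (Y i)} [∀ i, IsProbabilityMeasure (ν i)]
    {E : Type*} [NormedAddCommGroup E] [InnerProductSpace ℝ E] [CompleteSpace E]
    [MeasurableSpace E] [BorelSpace E] [SecondCountableTopology E]
    {ζ : ∀ i, Y i → E} (hm : ∀ i, Measurable (ζ i)) (h0 : ∀ i, ∫ y, ζ i y ∂ν i = 0)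
    {τ : ℝ≥0∞} (hτ : τ ≠ ∞) (h2 : ∀ i, ∫⁻ y, ‖ζ i y‖ₑ ^ 2 ∂ν i ≤ τ) (c : E) (I : Finset ι) :
    ∫⁻ B, ‖c + ∑ i ∈ I, ζ i (B i)‖ₑ ^ 2 ∂Measure.pi ν ≤ ‖c‖ₑ ^ 2 + I.card * τ := by
  induction I using Finset.induction_on with
  | empty => simp
  | insert j I hj ih =>
    have hmeas : ∀ J : Finset ι, Measurable fun B : ∀ i, Y i => c + ∑ i ∈ J, ζ i (B i) := fun J =>
      (Finset.measurable_sum _ fun i _ => (hm i).comp (measurable_pi_apply i)).const_add c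
    have hmem : MemLp (ζ j) 2 (ν j) :=
      (memLp_two_iff_lintegral (hm j).aestronglyMeasurable).2 ((h2 j).trans_lt hτ.lt_top)
    rw [lintegral_pi_update ν j ((hmeas _).enorm.pow_const 2)]
    have hupd : ∀ (B : ∀ i, Y i) (y : Y j), c + ∑ i ∈ insert j I, ζ i (Function.update B j y i)
        = (c + ∑ i ∈ I, ζ i (B i)) + ζ j y := by
      intro B y
      have hI : ∑ i ∈ I, ζ i (Function.update B j y i) = ∑ i ∈ I, ζ i (B i) :=
        Finset.sum_congr rfl fun i hi => by
          rw [Function.update_of_ne (ne_of_mem_of_not_mem hi hj)]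
      rw [Finset.sum_insert hj, Function.update_self, hI]
      abel
    simp_rw [hupd, lintegral_enorm_add_sq hmem (h0 j)]
    rw [lintegral_add_left ((hmeas I).enorm.pow_const 2), Finset.card_insert_of_notMem hj]
    simp only [lintegral_const, measure_univ, mul_one]
    push_cast
    calc _ ≤ (‖c‖ₑ ^ 2 + I.card * τ) + τ := add_le_add ih (h2 j)
      _ = _ := by ring

/-- For a fixed choice of the anchors, the noise of the refreshed caches is independent. -/
theorem lintegral_noise_trackedRound_le
    (hf : ∀ i, Measurable (fun q : Vec d × (Fin b → Z) => batchGrad f i q.2 q.1))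
    {ν : Fin M → Measure (Fin b → Z)} [∀ i, IsProbabilityMeasure (ν i)]
    (h0 : ∀ i x, ∫ B, (batchGrad f i B x - H i x) ∂ν i = 0) {τ : ℝ≥0∞} (hτ : τ ≠ ∞)
    (h2 : ∀ i x, ∫⁻ B, ‖batchGrad f i B x - H i x‖ₑ ^ 2 ∂ν i ≤ τ)
    (s : TrackedState M d) (c : Finset (Fin M)) (x : Fin M → Bool)
    (small : Fin M → Fin K → Fin b' → Z) (J : Finset (Fin M)) :
    ∫⁻ B, ‖∑ i ∈ J, ((trackedRound f H ηl ηs s (c, x, B, small)).2.1 i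
        - (trackedRound f H ηl ηs s (c, x, B, small)).2.2 i)‖ₑ ^ 2 ∂Measure.pi ν
      ≤ ‖∑ i ∈ J \ anchorsOf (c, x), (s.2.1 i - s.2.2 i)‖ₑ ^ 2
        + (J ∩ anchorsOf (c, x)).card * τ := by
  refine (lintegral_congr fun B => ?_).trans_le (lintegral_enorm_add_sum_sq_le
    (ζ := fun i y => batchGrad f i y s.1 - H i s.1)
    (fun i => ((hf i).comp measurable_prodMk_left).sub_const _) (fun i => h0 i s.1) hτ
    (fun i => h2 i s.1) _ _)
  congr 2
  rw [← Finset.sum_sdiff (Finset.inter_subset_left : J ∩ anchorsOf (c, x) ⊆ J),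
    Finset.sdiff_inter_self_left]
  congr 1
  · refine Finset.sum_congr rfl fun i hi => ?_
    simp [trackedRound, (Finset.mem_sdiff.1 hi).2]
  · refine Finset.sum_congr rfl fun i hi => ?_
    simp [trackedRound, (Finset.mem_inter.1 hi).2]

end Noise

/-! ### Independence of rounds and the law of the state. -/

section Law

variable {M d K b b' A : ℕ} {Z : Type*} [MeasurableSpace Z] {data : ClientData M Z}
  {f : Fin M → Vec d → Z → ℝ} {ηl ηs p : ℝ} {H : Fin M → Vec d → Vec d}

theorem indepFun_prodMk_left {Ω α β γ : Type*} [MeasurableSpace Ω] [MeasurableSpace α]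
    [MeasurableSpace β] [MeasurableSpace γ] {P : Measure Ω} [IsProbabilityMeasure P] {X : Ω → α}
    {Y : Ω → β} {W : Ω → γ} (hX : AEMeasurable X P) (hY : AEMeasurable Y P) (hW : AEMeasurable W P)
    (h1 : IndepFun X (fun ω => (Y ω, W ω)) P) (h2 : IndepFun Y W P) :
    IndepFun (fun ω => (X ω, Y ω)) W P := by
  have hXY : IndepFun X Y P := h1.comp measurable_id measurable_fst
  rw [indepFun_iff_map_prod_eq_prod_map_map hX (hY.prodMk hW)] at h1
  rw [indepFun_iff_map_prod_eq_prod_map_map hY hW] at h2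
  rw [indepFun_iff_map_prod_eq_prod_map_map hX hY] at hXY
  rw [indepFun_iff_map_prod_eq_prod_map_map (hX.prodMk hY) hW, hXY]
  have := Measure.isProbabilityMeasure_map hX
  have := Measure.isProbabilityMeasure_map hY
  have := Measure.isProbabilityMeasure_map hW
  rw [h2] at h1
  have h3 := (measurePreserving_prodAssoc (P.map X) (P.map Y) (P.map W)).symm
  rw [← h3.map_eq, ← h1, AEMeasurable.map_map_of_aemeasurable h3.measurable.aemeasurable
    (hX.prodMk (hY.prodMk hW))]
  rfl

theorem trackedRun_congr (x₀ : Vec d) (init : Fin M → Fin b → Z)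
    {draws draws' : ℕ → RoundDraw M K b b' Z} {t : ℕ} (h : ∀ s < t, draws s = draws' s) :
    trackedRun f H ηl ηs x₀ init draws t = trackedRun f H ηl ηs x₀ init draws' t := by
  induction t with
  | zero => rfl
  | succ t ih => rw [trackedRun, trackedRun, ih fun s hs => h s (by omega), h t (by omega)]

theorem measurable_trackedRun
    (hf : ∀ i s, Measurable (fun q : Vec d × (Fin s → Z) => batchGrad f i q.2 q.1))
    (hH : ∀ i, Measurable (H i)) (x₀ : Vec d) (t : ℕ) :
    Measurable fun a : (Fin M → Fin b → Z) × (ℕ → RoundDraw M K b b' Z) =>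
      trackedRun f H ηl ηs x₀ a.1 a.2 t := by
  induction t with
  | zero =>
    refine Measurable.prodMk measurable_const (Measurable.prodMk
      (measurable_pi_lambda _ fun i => ?_) measurable_const)
    exact measurable_batchGrad_comp (hf i b) measurable_const
      ((measurable_pi_apply i).comp measurable_fst)
  | succ t ih =>
    have h := (measurable_trackedRound (ηl := ηl) (ηs := ηs) hf hH).comp
      (ih.prodMk ((measurable_pi_apply t).comp measurable_snd))
    simpa only [Function.comp_def, trackedRun] using h

variable {Ω : Type*} [MeasurableSpace Ω] {P : Measure Ω} [IsProbabilityMeasure P]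
  {init : Ω → Fin M → Fin b → Z} {draws : ℕ → Ω → RoundDraw M K b b' Z}

theorem IsRandomness.aemeasurable_trackedRun (hR : IsRandomness data A K b b' p P init draws)
    (hf : ∀ i s, Measurable (fun q : Vec d × (Fin s → Z) => batchGrad f i q.2 q.1))
    (hH : ∀ i, Measurable (H i)) (x₀ : Vec d) (t : ℕ) :
    AEMeasurable (fun ω => trackedRun f H ηl ηs x₀ (init ω) (fun s => draws s ω) t) P := by
  have h := (measurable_trackedRun (K := K) (b' := b') (ηl := ηl) (ηs := ηs) hf hH x₀
    t).comp_aemeasurable (hR.init_law.aemeasurable.prodMk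
      (aemeasurable_pi_lambda _ fun s => (hR.draws_law s).aemeasurable))
  simpa only [Function.comp_def] using h

theorem IsRandomness.indepFun_trackedRun (hR : IsRandomness data A K b b' p P init draws)
    (hf : ∀ i s, Measurable (fun q : Vec d × (Fin s → Z) => batchGrad f i q.2 q.1))
    (hH : ∀ i, Measurable (H i)) (x₀ : Vec d) (t : ℕ) :
    IndepFun (fun ω => trackedRun f H ηl ηs x₀ (init ω) (fun s => draws s ω) t) (draws t) P := by
  obtain ⟨ω₀⟩ : Nonempty Ω := nonempty_of_isProbabilityMeasure P
  have hd : ∀ s, AEMeasurable (draws s) P := fun s => (hR.draws_law s).aemeasurable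
  have h1 : IndepFun (fun ω (i : Finset.range t) => draws i ω) (draws t) P := by
    have h := hR.draws_indep.indepFun_finset₀ (Finset.range t) {t} (by simp) hd
    exact h.comp measurable_id (measurable_pi_apply (⟨t, by simp⟩ : ({t} : Finset ℕ)))
  have h2 : IndepFun init (fun ω => ((fun (i : Finset.range t) => draws i ω), draws t ω)) P := by
    refine hR.init_indep.comp (φ := id)
      (ψ := fun g : ℕ → RoundDraw M K b b' Z => ((fun (i : Finset.range t) => g i), g t))
      measurable_id ?_
    exact (measurable_pi_lambda _ fun i => measurable_pi_apply _).prodMk (measurable_pi_apply t)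
  have h3 := indepFun_prodMk_left hR.init_law.aemeasurable
    (aemeasurable_pi_lambda _ fun i => hd _) (hd t) h2 h1
  -- The values from round `t` on are an arbitrary default, since the state at time `t` depends only
  -- on earlier draws.
  let ext : (Finset.range t → RoundDraw M K b b' Z) → ℕ → RoundDraw M K b b' Z := fun g s =>
    if h : s ∈ Finset.range t then g ⟨s, h⟩ else draws 0 ω₀
  have hext : Measurable ext := by
    refine measurable_pi_lambda _ fun s => ?_
    by_cases h : s ∈ Finset.range t
    · simp only [ext, h, dif_pos]; exact measurable_pi_apply _
    · simp only [ext, h, dif_neg, not_false_eq_true]; exact measurable_const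
  have h4 := h3.comp ((measurable_trackedRun (K := K) (b' := b') (ηl := ηl) (ηs := ηs) hf hH x₀
    t).comp (measurable_fst.prodMk (hext.comp measurable_snd))) measurable_id
  have h5 : (fun ω => trackedRun f H ηl ηs x₀ (init ω) (fun s => draws s ω) t)
      = fun ω => trackedRun f H ηl ηs x₀ (init ω)
        (ext fun i : Finset.range t => draws i ω) t := by
    funext ω
    refine trackedRun_congr x₀ _ fun s hs => ?_
    simp [ext, hs]
  rw [h5]
  simpa only [Function.comp_def, id] using h4

/-- The law of the tracked state at the beginning of round `t`. -/
def stateLaw (f : Fin M → Vec d → Z → ℝ) (H : Fin M → Vec d → Vec d) (ηl ηs : ℝ) (x₀ : Vec d)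
    (P : Measure Ω) (init : Ω → Fin M → Fin b → Z) (draws : ℕ → Ω → RoundDraw M K b b' Z)
    (t : ℕ) : Measure (TrackedState M d) :=
  P.map fun ω => trackedRun f H ηl ηs x₀ (init ω) (fun s => draws s ω) t

/-- The Markov property: the draw of round `t` is independent of the state at its beginning. -/
theorem IsRandomness.lintegral_stateLaw_succ (hR : IsRandomness data A K b b' p P init draws)
    (hf : ∀ i s, Measurable (fun q : Vec d × (Fin s → Z) => batchGrad f i q.2 q.1))
    (hH : ∀ i, Measurable (H i)) (x₀ : Vec d) (t : ℕ) {φ : TrackedState M d → ℝ≥0∞}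
    (hφ : Measurable φ) :
    ∫⁻ s, φ s ∂stateLaw f H ηl ηs x₀ P init draws (t + 1)
      = ∫⁻ s, ∫⁻ r, φ (trackedRound f H ηl ηs s r) ∂roundLaw data A K b b' p
        ∂stateLaw f H ηl ηs x₀ P init draws t := by
  have hX := hR.aemeasurable_trackedRun (ηl := ηl) (ηs := ηs) hf hH x₀
  have hd := (hR.draws_law t).aemeasurable
  have h1 := (indepFun_iff_map_prod_eq_prod_map_map (hX t) hd).1
    (hR.indepFun_trackedRun hf hH x₀ t)
  rw [(hR.draws_law t).map_eq] at h1
  have hm : Measurable fun a : TrackedState M d × RoundDraw M K b b' Z =>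
      φ (trackedRound f H ηl ηs a.1 a.2) := hφ.comp (measurable_trackedRound hf hH)
  have : IsProbabilityMeasure (roundLaw data A K b b' p) := by
    rw [← (hR.draws_law t).map_eq]; exact Measure.isProbabilityMeasure_map hd
  rw [stateLaw, lintegral_map' hφ.aemeasurable (hX (t + 1)), stateLaw,
    ← lintegral_prod _ hm.aemeasurable, ← h1,
    lintegral_map' hm.aemeasurable ((hX t).prodMk hd)]
  rfl

theorem IsRandomness.isProbabilityMeasure_stateLaw
    (hR : IsRandomness data A K b b' p P init draws)
    (hf : ∀ i s, Measurable (fun q : Vec d × (Fin s → Z) => batchGrad f i q.2 q.1))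
    (hH : ∀ i, Measurable (H i)) (x₀ : Vec d) (t : ℕ) :
    IsProbabilityMeasure (stateLaw f H ηl ηs x₀ P init draws t) :=
  Measure.isProbabilityMeasure_map (hR.aemeasurable_trackedRun hf hH x₀ t)

/-- The noise of the cached gradients of different clients stays uncorrelated. -/
theorem IsRandomness.lintegral_sum_noise_le (hR : IsRandomness data A K b b' p P init draws)
    (hf : ∀ i s, Measurable (fun q : Vec d × (Fin s → Z) => batchGrad f i q.2 q.1))
    (hH : ∀ i, Measurable (H i)) (x₀ : Vec d) (hA : A ≤ M) (hp : 0 ≤ p) (hp1 : p ≤ 1)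
    (hb : (b : ℕ∞) ≤ data.size) (hb' : (b' : ℕ∞) ≤ data.size)
    (h0 : ∀ i x, ∫ B, (batchGrad f i B x - H i x) ∂data.batchLaw i b = 0) {τ : ℝ≥0∞} (hτ : τ ≠ ∞)
    (h2 : ∀ i x, ∫⁻ B, ‖batchGrad f i B x - H i x‖ₑ ^ 2 ∂data.batchLaw i b ≤ τ)
    (t : ℕ) (J : Finset (Fin M)) :
    ∫⁻ s, ‖∑ i ∈ J, (s.2.1 i - s.2.2 i)‖ₑ ^ 2 ∂stateLaw f H ηl ηs x₀ P init draws t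
      ≤ J.card * τ := by
  have := fun i => isProbabilityMeasure_batchLaw (data := data) i hb
  have := fun i => isProbabilityMeasure_batchLaw (data := data) i hb'
  have := isProbabilityMeasure_coinLaw hp hp1
  have := isProbabilityMeasure_uniformLaw (powersetCard_univ_nonempty hA) id
  have hφ : ∀ J : Finset (Fin M), Measurable fun s : TrackedState M d =>
      ‖∑ i ∈ J, (s.2.1 i - s.2.2 i)‖ₑ ^ 2 := fun J =>
    (Finset.measurable_sum J fun i _ => ((measurable_pi_apply i).comp measurable_snd.fst).sub
      ((measurable_pi_apply i).comp measurable_snd.snd)).enorm.pow_const 2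
  -- The bound must be carried for every set of clients: the anchors of the round contribute fresh
  -- independent noise, and the remaining clients `J \ anchorsOf q` are covered by the induction
  -- hypothesis for that smaller set.
  induction t generalizing J with
  | zero =>
    rw [stateLaw, lintegral_map' (hφ J).aemeasurable (hR.aemeasurable_trackedRun hf hH x₀ 0)]
    simp only [trackedRun]
    have hζ : ∀ i, Measurable fun B : Fin b → Z => batchGrad f i B x₀ - H i x₀ := fun i =>
      (measurable_batchGrad_comp (hf i b) measurable_const measurable_id).sub_const _
    have h := lintegral_enorm_add_sum_sq_le (ν := fun i => data.batchLaw i b)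
      (ζ := fun i B => batchGrad f i B x₀ - H i x₀)
      hζ (fun i => h0 i x₀) hτ (fun i => h2 i x₀) 0 J
    have hm : Measurable fun B : Fin M → Fin b → Z =>
        ‖∑ i ∈ J, (batchGrad f i (B i) x₀ - H i x₀)‖ₑ ^ 2 :=
      (Finset.measurable_sum J fun i _ => (measurable_batchGrad_comp (hf i b) measurable_const
        (measurable_pi_apply i)).sub_const _).enorm.pow_const 2
    simp only [zero_add, enorm_zero, ne_eq, OfNat.ofNat_ne_zero, not_false_eq_true, zero_pow] at h
    rw [← hR.init_law.map_eq, lintegral_map' hm.aemeasurable hR.init_law.aemeasurable] at h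
    exact h
  | succ t ih =>
    rw [hR.lintegral_stateLaw_succ hf hH x₀ t (hφ J)]
    have hstate := hR.isProbabilityMeasure_stateLaw (ηl := ηl) (ηs := ηs) hf hH x₀ t
    have hsel := isProbabilityMeasure_selectionLaw (M := M) hA hp hp1
    set μ := stateLaw f H ηl ηs x₀ P init draws t
    have hβ : Measurable fun a : TrackedState M d × (Finset (Fin M) × (Fin M → Bool)) =>
        ‖∑ i ∈ J \ anchorsOf a.2, (a.1.2.1 i - a.1.2.2 i)‖ₑ ^ 2
          + ((J ∩ anchorsOf a.2).card : ℝ≥0∞) * τ :=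
      measurable_from_prod_countable_left fun q =>
        (hφ (J \ anchorsOf q)).add_const (((J ∩ anchorsOf q).card : ℝ≥0∞) * τ)
    have hround : ∀ s : TrackedState M d,
        ∫⁻ r : RoundDraw M K b b' Z, ‖∑ i ∈ J, ((trackedRound f H ηl ηs s r).2.1 i
          - (trackedRound f H ηl ηs s r).2.2 i)‖ₑ ^ 2 ∂roundLaw data A K b b' p
        ≤ ∫⁻ q, (‖∑ i ∈ J \ anchorsOf q, (s.2.1 i - s.2.2 i)‖ₑ ^ 2
          + ((J ∩ anchorsOf q).card : ℝ≥0∞) * τ) ∂selectionLaw M A p := by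
      intro s
      have hF : Measurable fun r : RoundDraw M K b b' Z => ‖∑ i ∈ J,
          ((trackedRound f H ηl ηs s r).2.1 i - (trackedRound f H ηl ηs s r).2.2 i)‖ₑ ^ 2 := by
        have h := (hφ J).comp ((measurable_trackedRound (K := K) (b := b) (b' := b') (ηl := ηl)
          (ηs := ηs) hf hH).comp (measurable_prodMk_left (x := s)))
        simpa only [Function.comp_def] using h
      have hβs : Measurable fun q : Finset (Fin M) × (Fin M → Bool) =>
          ‖∑ i ∈ J \ anchorsOf q, (s.2.1 i - s.2.2 i)‖ₑ ^ 2
            + ((J ∩ anchorsOf q).card : ℝ≥0∞) * τ := Measurable.of_discrete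
      rw [roundLaw, lintegral_prod _ hF.aemeasurable, selectionLaw,
        lintegral_prod _ hβs.aemeasurable]
      refine lintegral_mono fun c => ?_
      have hF1 := hF.comp (measurable_prodMk_left (x := c))
      simp only [Function.comp_def] at hF1
      rw [lintegral_prod _ hF1.aemeasurable]
      refine lintegral_mono fun x => ?_
      have hF2 := hF1.comp (measurable_prodMk_left (x := x))
      simp only [Function.comp_def] at hF2
      rw [lintegral_prod_symm _ hF2.aemeasurable]
      calc _ ≤ ∫⁻ _, (‖∑ i ∈ J \ anchorsOf (c, x), (s.2.1 i - s.2.2 i)‖ₑ ^ 2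
          + ((J ∩ anchorsOf (c, x)).card : ℝ≥0∞) * τ)
            ∂(Measure.pi fun m : Fin M => Measure.pi fun _ : Fin K => data.batchLaw m b') := by
            refine lintegral_mono fun small => ?_
            exact lintegral_noise_trackedRound_le (fun i => hf i b) h0 hτ h2 s c x small J
        _ = _ := by simp
    calc _ ≤ ∫⁻ s, ∫⁻ q, (‖∑ i ∈ J \ anchorsOf q, (s.2.1 i - s.2.2 i)‖ₑ ^ 2
          + ((J ∩ anchorsOf q).card : ℝ≥0∞) * τ) ∂selectionLaw M A p ∂μ := lintegral_mono hround
      _ = ∫⁻ q, ∫⁻ s, (‖∑ i ∈ J \ anchorsOf q, (s.2.1 i - s.2.2 i)‖ₑ ^ 2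
          + ((J ∩ anchorsOf q).card : ℝ≥0∞) * τ) ∂μ ∂selectionLaw M A p :=
          -- The selection is independent of the state, so it can be fixed first and the induction
          -- hypothesis applied to a deterministic set.
          lintegral_lintegral_swap hβ.aemeasurable
      _ ≤ ∫⁻ _, J.card * τ ∂selectionLaw M A p := by
          refine lintegral_mono fun q => ?_
          rw [lintegral_add_left (hφ _)]
          simp only [lintegral_const, measure_univ, mul_one]
          refine (add_le_add_left (ih _) _).trans_eq ?_
          rw [← add_mul, ← Nat.cast_add, Finset.card_sdiff_add_card_inter]
      _ = _ := by simp

end Law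

/-! ### Telescoping the decrease over the rounds. -/

section Convergence

theorem sum_range_add_le_of_drift {E a : ℕ → ℝ≥0∞} {c : ℝ≥0∞}
    (h : ∀ t, E (t + 1) + a t ≤ E t + c) (T : ℕ) :
    ∑ t ∈ Finset.range T, a t + E T ≤ E 0 + T * c := by
  induction T with
  | zero => simp
  | succ T ih =>
    rw [Finset.sum_range_succ]
    calc _ = ∑ t ∈ Finset.range T, a t + (E (T + 1) + a T) := by ring
      _ ≤ ∑ t ∈ Finset.range T, a t + (E T + c) := by exact add_le_add_right (h T) _
      _ = (∑ t ∈ Finset.range T, a t + E T) + c := by ring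
      _ ≤ (E 0 + T * c) + c := by gcongr
      _ = _ := by push_cast; ring

variable {M d K b b' A : ℕ} {Z : Type*} [MeasurableSpace Z] {data : ClientData M Z}
  {f : Fin M → Vec d → Z → ℝ} {ηl ηs p L c : ℝ} {H : Fin M → Vec d → Vec d}
  {Ω : Type*} [MeasurableSpace Ω] {P : Measure Ω} [IsProbabilityMeasure P]
  {init : Ω → Fin M → Fin b → Z} {draws : ℕ → Ω → RoundDraw M K b b' Z}

theorem measurable_potential {Φ : Vec d → ℝ} (Φ₀ : ℝ) (hΦ : Measurable Φ)
    (hH : ∀ i, Measurable (H i)) (κ : ℝ) :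
    Measurable fun s : TrackedState M d => potential Φ Φ₀ H κ s := by
  have h1 : Measurable fun s : TrackedState M d => staleness H s := by
    refine (Finset.measurable_sum _ fun i _ => ?_).const_mul _
    exact (((hH i).comp measurable_fst).sub
      ((measurable_pi_apply i).comp measurable_snd.snd)).norm
  have h2 : Measurable fun s : TrackedState M d => ‖cleanDir s‖ := by
    refine (Measurable.const_smul (M := ℝ) (Finset.measurable_sum _ fun i _ => ?_) (M : ℝ)⁻¹).norm
    exact (measurable_pi_apply i).comp measurable_snd.snd
  exact ((hΦ.comp measurable_fst).sub_const _).add ((h1.mul (h1.add h2)).const_mul _)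

theorem IsRandomness.lintegral_cacheNoise_le (hR : IsRandomness data A K b b' p P init draws)
    (hf : ∀ i s, Measurable (fun q : Vec d × (Fin s → Z) => batchGrad f i q.2 q.1))
    (hH : ∀ i, Measurable (H i)) (x₀ : Vec d) (hM : 0 < M) (hA : A ≤ M) (hp : 0 ≤ p)
    (hp1 : p ≤ 1) (hb : (b : ℕ∞) ≤ data.size) (hb' : (b' : ℕ∞) ≤ data.size)
    (h0 : ∀ i x, ∫ B, (batchGrad f i B x - H i x) ∂data.batchLaw i b = 0) {v : ℝ}
    (h2 : ∀ i x, ∫⁻ B, ‖batchGrad f i B x - H i x‖ₑ ^ 2 ∂data.batchLaw i b ≤ ENNReal.ofReal v)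
    (t : ℕ) :
    ∫⁻ s, ‖cacheNoise s‖ₑ ^ 2 ∂stateLaw f H ηl ηs x₀ P init draws t ≤ ENNReal.ofReal (v / M) := by
  have hM' : (0 : ℝ) < M := by exact_mod_cast hM
  have h := hR.lintegral_sum_noise_le (ηl := ηl) (ηs := ηs) hf hH x₀ hA hp hp1 hb hb' h0
    ENNReal.ofReal_ne_top h2 t Finset.univ
  have h3 : ∀ s : TrackedState M d, ‖cacheNoise s‖ₑ ^ 2
      = ENNReal.ofReal ((M : ℝ)⁻¹ ^ 2) * ‖∑ i, (s.2.1 i - s.2.2 i)‖ₑ ^ 2 := by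
    intro s
    rw [cacheNoise, enorm_smul, mul_pow, Real.enorm_of_nonneg (by positivity),
      ENNReal.ofReal_pow (by positivity)]
  simp_rw [h3]
  rw [lintegral_const_mul' _ _ ENNReal.ofReal_ne_top]
  refine (mul_le_mul_right h _).trans_eq ?_
  rw [Finset.card_univ, Fintype.card_fin, ← ENNReal.ofReal_natCast M,
    ← ENNReal.ofReal_mul hM'.le, ← ENNReal.ofReal_mul (by positivity)]
  congr 1
  field_simp

theorem IsRandomness.exists_lintegral_gradient_le
    (hR : IsRandomness data A K b b' p P init draws)
    (hf : ∀ i s, Measurable (fun q : Vec d × (Fin s → Z) => batchGrad f i q.2 q.1))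
    (hG : ∀ i, IsGradientOracle f i (data.batchLaw i b') (H i) L c) (hL : 0 < L)
    (hη : 0 < ηl) (hηs : 0 ≤ ηs) (hηKL : (ηl * K * L) ^ 2 = 1 / 24) (hc : c ≤ K * L ^ 2 / 2)
    (hK : 0 < K) (hA1 : 1 ≤ A) (hA : A ≤ M) (hp : 0 < p) (hp1 : p ≤ 1)
    (hb : (b : ℕ∞) ≤ data.size) (hb' : (b' : ℕ∞) ≤ data.size)
    (h0 : ∀ i x, ∫ B, (batchGrad f i B x - H i x) ∂data.batchLaw i b = 0) {v : ℝ} (hv : 0 ≤ v)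
    (h2 : ∀ i x, ∫⁻ B, ‖batchGrad f i B x - H i x‖ₑ ^ 2 ∂data.batchLaw i b ≤ ENNReal.ofReal v)
    {Φ : Vec d → ℝ} {Φ₀ : ℝ} (hΦ : Differentiable ℝ Φ)
    (hΦL : ∀ v w, ‖gradient Φ v - gradient Φ w‖ ≤ L * ‖v - w‖)
    (hΦH : ∀ v, gradient Φ v = (M : ℝ)⁻¹ • ∑ i, H i v) (hΦ₀ : ∀ v, Φ₀ ≤ Φ v)
    {γ θ Q : ℝ} (hγ : γ = ηs * (ηl * K)) (hθ : θ = 1 - p ^ A) (hQ : Q = A * p / M)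
    (hu : L * γ ≤ 1) (hz : θ * (L * γ) / Q ≤ (1 - L * γ) / 2) (hθγ : 0 < θ * γ)
    (x₀ : Vec d) {T : ℕ} {β : ℝ} (hT : 1 ≤ T)
    (hTβ : Φ x₀ - Φ₀ + T * (1500 * (θ * γ) * (v / M)) ≤ T * (θ * γ / 200 * β)) :
    ∃ t < T, ∫⁻ ω, ‖gradient Φ (trackedRun f H ηl ηs x₀ (init ω) (fun s => draws s ω) t).1‖ₑ ^ 2 ∂P
      ≤ ENNReal.ofReal β := by
  have hM : 0 < M := by omega
  have hH : ∀ i, Measurable (H i) := fun i => (continuous_of_lipschitz (hG i).lipschitz).measurable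
  set κ := 5 / 8 * (θ * γ) / Q with hκ
  have hV : Measurable fun s : TrackedState M d => ENNReal.ofReal (potential Φ Φ₀ H κ s) :=
    (measurable_potential Φ₀ hΦ.continuous.measurable hH κ).ennreal_ofReal
  have hgrad : Measurable fun s : TrackedState M d => ‖gradient Φ s.1‖ₑ ^ 2 :=
    (((continuous_of_lipschitz hΦL).measurable.comp measurable_fst).enorm).pow_const 2
  set μ := stateLaw f H ηl ηs x₀ P init draws with hμ
  set E : ℕ → ℝ≥0∞ := fun t => ∫⁻ s, ENNReal.ofReal (potential Φ Φ₀ H κ s) ∂μ t with hE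
  set a : ℕ → ℝ≥0∞ := fun t => ENNReal.ofReal (θ * γ / 200) * ∫⁻ s, ‖gradient Φ s.1‖ₑ ^ 2 ∂μ t
    with ha
  have hsq : ∀ (k : ℝ) (w : Vec d), 0 ≤ k →
      ENNReal.ofReal (k * ‖w‖ ^ 2) = ENNReal.ofReal k * ‖w‖ₑ ^ 2 := by
    intro k w hk
    rw [ENNReal.ofReal_mul hk, ENNReal.ofReal_pow (norm_nonneg _), ofReal_norm]
  have hstep : ∀ t, E (t + 1) + a t
      ≤ E t + ENNReal.ofReal (1500 * (θ * γ)) * ENNReal.ofReal (v / M) := by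
    intro t
    have hn := hR.lintegral_cacheNoise_le (ηl := ηl) (ηs := ηs) hf hH x₀ hM hA hp.le hp1 hb hb'
      h0 h2 t
    simp only [hE, ha]
    rw [hμ, hR.lintegral_stateLaw_succ hf hH x₀ t hV, ← lintegral_const_mul _ hgrad,
      ← lintegral_add_right _ (hgrad.const_mul _)]
    refine (lintegral_mono fun s => ?_).trans (b := ∫⁻ s, (ENNReal.ofReal (potential Φ Φ₀ H κ s)
      + ENNReal.ofReal (1500 * (θ * γ)) * ‖cacheNoise s‖ₑ ^ 2)
      ∂stateLaw f H ηl ηs x₀ P init draws t) ?_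
    · have h := lintegral_potential_trackedRound_le hG hL hη hηs hηKL hc hK hA1 hA hp hp1 hb hb'
        hΦ hΦL hΦH hΦ₀ hγ hθ hQ hκ hu hz s
      rwa [hsq _ _ (by positivity), hsq _ _ (by positivity)] at h
    · rw [lintegral_add_left hV, lintegral_const_mul' _ _ ENNReal.ofReal_ne_top]
      gcongr
  have hsum := sum_range_add_le_of_drift hstep T
  have hE0 : E 0 = ENNReal.ofReal (Φ x₀ - Φ₀) := by
    have hX := hR.aemeasurable_trackedRun (ηl := ηl) (ηs := ηs) hf hH x₀ 0
    simp only [hE, hμ, stateLaw]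
    rw [lintegral_map' hV.aemeasurable hX]
    -- Every cache is filled at `x₀`, so the initial staleness is zero and only the optimality gap
    -- remains.
    have : ∀ ω, potential Φ Φ₀ H κ (trackedRun f H ηl ηs x₀ (init ω) (fun s => draws s ω) 0)
        = Φ x₀ - Φ₀ := fun ω => by simp [trackedRun, potential, staleness]
    simp [this]
  have ht : ∀ t, ∫⁻ s, ‖gradient Φ s.1‖ₑ ^ 2 ∂μ t = ∫⁻ ω, ‖gradient Φ
      (trackedRun f H ηl ηs x₀ (init ω) (fun s => draws s ω) t).1‖ₑ ^ 2 ∂P := fun t =>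
    lintegral_map' hgrad.aemeasurable (hR.aemeasurable_trackedRun hf hH x₀ t)
  -- If all `T` second moments exceeded `β`, their weighted sum would exceed the telescoped budget
  -- `hTβ`.
  by_contra! hcon
  have hlt : ∑ _t ∈ Finset.range T, ENNReal.ofReal (θ * γ / 200 * β)
      < ∑ t ∈ Finset.range T, a t := by
    refine ENNReal.sum_lt_sum_of_nonempty (Finset.nonempty_range_iff.2 (by omega)) fun t h => ?_
    simp only [ha]
    rw [ENNReal.ofReal_mul (by positivity), ht]
    exact ENNReal.mul_lt_mul_right (ENNReal.ofReal_pos.2 (by positivity)).ne'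
      ENNReal.ofReal_ne_top (hcon t (Finset.mem_range.1 h))
  have hle : E 0 + T * (ENNReal.ofReal (1500 * (θ * γ)) * ENNReal.ofReal (v / M))
      ≤ ∑ _t ∈ Finset.range T, ENNReal.ofReal (θ * γ / 200 * β) := by
    have := sub_nonneg.2 (hΦ₀ x₀)
    rw [hE0, Finset.sum_const, Finset.card_range, nsmul_eq_mul, ← ENNReal.ofReal_natCast T,
      ← ENNReal.ofReal_mul (by positivity), ← ENNReal.ofReal_mul (by positivity),
      ← ENNReal.ofReal_mul (by positivity), ← ENNReal.ofReal_add (by positivity) (by positivity)]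
    exact ENNReal.ofReal_le_ofReal hTβ
  exact absurd (le_self_add.trans (hsum.trans hle)) (not_le.2 hlt)

end Convergence

/-! ### Step sizes and verification of the oracle conditions. -/

section Parameters

variable {M d : ℕ} {Z : Type*} [MeasurableSpace Z] {data : ClientData M Z}
  {f : Fin M → Vec d → Z → ℝ}

theorem isGradientOracle_localLoss (hf : IsLoss data f) {L σ Lσ : ℝ} (hL : LSmooth data f L)
    (hσ : BoundedNoise data f σ) (hLσ : AverageLSmooth data f Lσ) (m : Fin M) {s : ℕ}
    (hs1 : 1 ≤ s) (hs : (s : ℕ∞) ≤ data.size) :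
    IsGradientOracle f m (data.batchLaw m s) (gradient (localLoss data f m)) L (Lσ ^ 2 / s) where
  measurable := measurable_batchGrad hf m s
  mean v w := by
    have := isProbabilityMeasure_batchLaw (data := data) m hs
    have h : ∀ x, Integrable (fun B : Fin s → Z =>
        batchGrad f m B x - gradient (localLoss data f m) x) (data.batchLaw m s) := fun x =>
      (memLp_batchGrad_sub hf hσ m hs1 hs x).integrable one_le_two
    have h1 := integral_sub (h v) (h w)
    rw [integral_batchGrad_sub hf hσ m hs1 hs, integral_batchGrad_sub hf hσ m hs1 hs,
      sub_zero] at h1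
    rw [← h1]
    exact integral_congr_ae (Filter.Eventually.of_forall fun B => by simp only; abel)
  variance v w := hLσ m s hs1 hs v w
  lipschitz := (hL m).2
  nonneg := by positivity

/-- With `r = √θ`, the prescribed rates amount to `L * γ = 1 / (1 + 2 * r / Q)`. Thus `1 / (θ * γ)`
equals `L * (1 / θ + 2 / (Q * r))`, the complexity of the theorem up to a factor `2`. -/
theorem step_sizes {L p : ℝ} {K A M : ℕ} (hL : 0 < L) (hK : 0 < K) (hA1 : 1 ≤ A) (hM : 0 < M)
    (hp : 0 < p) (hp1 : p < 1) {ηl ηs γ θ Q : ℝ} (hηl : ηl = 1 / (2 * √6 * K * L))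
    (hηs : ηs = 2 * √6 / (1 + 2 * M / (A * p) * √(1 - p ^ A)))
    (hγ : γ = ηs * (ηl * K)) (hθ : θ = 1 - p ^ A) (hQ : Q = A * p / M) :
    0 < ηl ∧ 0 ≤ ηs ∧ (ηl * K * L) ^ 2 = 1 / 24 ∧ L * γ ≤ 1
      ∧ θ * (L * γ) / Q ≤ (1 - L * γ) / 2 ∧ 0 < θ * γ
      ∧ 1 / (θ * γ) ≤ 2 * (L * (1 / (1 - p ^ A) + M / (A * p * √(1 - p ^ A)))) := by
  have hK' : (0 : ℝ) < K := by exact_mod_cast hK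
  have hA' : (0 : ℝ) < A := by exact_mod_cast hA1
  have hM' : (0 : ℝ) < M := by exact_mod_cast hM
  have hθ0 : 0 < θ := by rw [hθ, sub_pos]; exact pow_lt_one₀ hp.le hp1 (by omega)
  have hθ1 : θ ≤ 1 := by rw [hθ]; linarith [pow_nonneg hp.le A]
  have hQ0 : 0 < Q := by rw [hQ]; positivity
  rw [← hθ] at hηs ⊢
  have h6 : (√6) ^ 2 = 6 := Real.sq_sqrt (by norm_num)
  have h60 : 0 < √6 := by positivity
  set r := √θ with hr
  have hr0 : 0 < r := Real.sqrt_pos.2 hθ0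
  have hr2 : r ^ 2 = θ := Real.sq_sqrt hθ0.le
  have hr1 : r ≤ 1 := Real.sqrt_le_one.2 hθ1
  have hMQ : (M : ℝ) / (A * p) = 1 / Q := by rw [hQ]; field_simp
  have hden : 1 + 2 * M / (A * p) * r = 1 + 2 * r / Q := by
    rw [mul_div_assoc, hMQ]; ring
  rw [hden] at hηs
  have hu : L * γ = 1 / (1 + 2 * r / Q) := by
    rw [hγ, hηs, hηl]; field_simp
  have hγe : γ = 1 / (L * (1 + 2 * r / Q)) := by
    rw [← mul_right_inj' hL.ne', hu]; field_simp
  have hinv : 1 / (θ * γ) = L * (1 / θ + 2 * (1 / (Q * r))) := by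
    rw [hγe, ← hr2]; field_simp
  have hMr : (M : ℝ) / (A * p * r) = 1 / (Q * r) := by
    rw [hQ]; field_simp
  have hpos : 0 < 1 / (Q * r) := by positivity
  have hpos' : 0 < 1 / θ := by positivity
  refine ⟨by rw [hηl]; positivity, by rw [hηs]; positivity, ?_, ?_, ?_, ?_, ?_⟩
  · rw [hηl]; field_simp; rw [h6]; norm_num
  · rw [hu, div_le_one (by positivity)]
    have : 0 ≤ 2 * r / Q := by positivity
    linarith
  · rw [hu, ← hr2]
    -- After this identity the condition reduces to `r ^ 2 ≤ r`, which holds since `θ ≤ 1`.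
    have : (1 - 1 / (1 + 2 * r / Q)) / 2 = r * (1 / (1 + 2 * r / Q)) / Q := by field_simp; ring
    rw [this]
    gcongr
    nlinarith
  · rw [hγe]; positivity
  · rw [hinv, hMr]
    nlinarith [mul_pos hL hpos']

end Parameters

end FedAMD

end

/-! ### The convergence theorem. -/

theorem theorem3 :
    ∃ C : ℝ, 0 < C ∧
      ∀ (M d K A b b' : ℕ) (Z : Type*) [MeasurableSpace Z] (Ω : Type*) [MeasurableSpace Ω]
        (P : Measure Ω) [IsProbabilityMeasure P]
        (data : FedAMD.ClientData M Z) (f : Fin M → FedAMD.Vec d → Z → ℝ)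
        (L σ Lσ ε p ηl ηs : ℝ) (x₀ : FedAMD.Vec d)
        (init : Ω → Fin M → Fin b → Z) (draws : ℕ → Ω → FedAMD.RoundDraw M K b b' Z),
        -- the problem and the three assumptions
        FedAMD.IsLoss data f →
        BddBelow (Set.range (FedAMD.globalLoss data f)) →
        0 < L → 0 ≤ σ → 0 ≤ Lσ →
        FedAMD.LSmooth data f L →
        FedAMD.BoundedNoise data f σ →
        FedAMD.AverageLSmooth data f Lσ →
        -- the parameters of the algorithm
        0 < ε → 1 ≤ A → A ≤ M → 0 < p → p < 1 →
        1 ≤ b' → b' < b →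
        (b : ℕ∞) = min ((⌈σ ^ 2 / (M * ε)⌉₊ : ℕ) : ℕ∞) data.size →
        max 1 (2 * Lσ ^ 2 / (b' * L ^ 2)) ≤ (K : ℝ) →
        ηl = 1 / (2 * √6 * K * L) →
        ηs = 2 * √6 / (1 + 2 * M / (A * p) * √(1 - p ^ A)) →
        -- the randomness
        FedAMD.IsRandomness data A K b b' p P init draws →
        -- the number of rounds
        ∀ T : ℕ, 1 ≤ T →
          C * (L * (FedAMD.globalLoss data f x₀ - ⨅ x, FedAMD.globalLoss data f x)) / ε *
              (1 / (1 - p ^ A) + M / (A * p * √(1 - p ^ A))) ≤ (T : ℝ) →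
          ∃ t < T,
            Integrable (fun ω => ‖gradient (FedAMD.globalLoss data f)
              (FedAMD.run f ηl ηs x₀ (init ω) (fun s => draws s ω) t).model‖ ^ 2) P ∧
            ∫ ω, ‖gradient (FedAMD.globalLoss data f)
              (FedAMD.run f ηl ηs x₀ (init ω) (fun s => draws s ω) t).model‖ ^ 2 ∂P
              ≤ (if (b : ℕ∞) < data.size then C else 1) * ε := by
  -- Large enough that `C / 200 = 5000` dominates the noise factor `1500` plus the contribution `2 /
  -- C` of the initial gap.
  refine ⟨10 ^ 6, by norm_num, ?_⟩
  intro M d K A b b' Z _ Ω _ P _ data f L σ Lσ ε p ηl ηs x₀ init draws hf hbdd hL hσ0 hLσ0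
    hsm hσ hLσ hε hA1 hA hp hp1 hb'1 hb'b hbeq hKmax hηl hηs hR T hT hTge
  have hM : 0 < M := by omega
  have hM' : (0 : ℝ) < M := by exact_mod_cast hM
  have hb0 : (0 : ℝ) < b := by exact_mod_cast (by omega : 0 < b)
  have hb'0 : (0 : ℝ) < b' := by exact_mod_cast hb'1
  have hK1 : (1 : ℝ) ≤ K := (le_max_left _ _).trans hKmax
  have hK : 0 < K := by exact_mod_cast zero_lt_one.trans_le hK1
  have hc : Lσ ^ 2 / b' ≤ K * L ^ 2 / 2 := by
    have h := (le_max_right _ _).trans hKmax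
    rw [div_le_iff₀ (by positivity)] at h
    rw [div_le_div_iff₀ hb'0 two_pos]
    linarith
  have hb : (b : ℕ∞) ≤ data.size := hbeq ▸ min_le_right _ _
  have hb' : (b' : ℕ∞) ≤ data.size := le_trans (by exact_mod_cast hb'b.le) hb
  obtain ⟨hη, hηs0, hηKL, hu, hz, hθγ, hW⟩ := FedAMD.step_sizes (γ := ηs * (ηl * K)) hL hK hA1 hM
    hp hp1 hηl hηs rfl rfl rfl
  set θγ := (1 - p ^ A) * (ηs * (ηl * K)) with hθγe
  set W := 1 / (1 - p ^ A) + M / (A * p * √(1 - p ^ A)) with hWe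
  set Δ := FedAMD.globalLoss data f x₀ - ⨅ x, FedAMD.globalLoss data f x with hΔ
  have hΔ0 : 0 ≤ Δ := sub_nonneg.2 (ciInf_le hbdd x₀)
  -- The condition on `T` combined with the bound on `1 / (θ * γ)`; the gap becomes a tiny fraction
  -- of the total allowed decrease.
  have hgap : Δ ≤ T * (θγ * (2 / 10 ^ 6 * ε)) := by
    rw [div_mul_eq_mul_div, div_le_iff₀ hε] at hTge
    rw [div_le_iff₀ hθγ] at hW
    calc Δ = Δ * 1 := (mul_one _).symm
      _ ≤ Δ * (2 * (L * W) * θγ) := by gcongr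
      _ = 2 / 10 ^ 6 * (10 ^ 6 * (L * Δ) * W) * θγ := by ring
      _ ≤ 2 / 10 ^ 6 * (T * ε) * θγ := by gcongr
      _ = _ := by ring
  obtain ⟨hΦ, hΦL⟩ := FedAMD.globalLoss_smooth hM hsm
  set β := (if (b : ℕ∞) < data.size then 10 ^ 6 else 1) * ε with hβ
  obtain ⟨v, hv, h2, hTβ⟩ : ∃ v : ℝ, 0 ≤ v ∧
      (∀ i x, ∫⁻ B, ‖FedAMD.batchGrad f i B x - gradient (FedAMD.localLoss data f i) x‖ₑ ^ 2
        ∂data.batchLaw i b ≤ ENNReal.ofReal v) ∧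
      Δ + T * (1500 * θγ * (v / M)) ≤ T * (θγ / 200 * β) := by
    by_cases hbs : (b : ℕ∞) < data.size
    · refine ⟨σ ^ 2 / b, by positivity, fun i x => hσ i b (by omega) hb x, ?_⟩
      have hceil : b = ⌈σ ^ 2 / (M * ε)⌉₊ := by
        rcases min_choice ((⌈σ ^ 2 / (M * ε)⌉₊ : ℕ) : ℕ∞) data.size with h | h
        · rw [h] at hbeq; exact_mod_cast hbeq
        · exact absurd (hbeq.trans h) hbs.ne
      -- Since `b < n`, the minimum defining `b` is the ceiling, so the averaged cache noise is at
      -- most `ε`.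
      have h1 : σ ^ 2 / (M * ε) ≤ b := hceil ▸ Nat.le_ceil _
      have h3 : σ ^ 2 / b / M ≤ ε := by
        rw [div_le_iff₀ (by positivity)] at h1
        rw [div_div, div_le_iff₀ (by positivity)]
        linarith
      rw [hβ, if_pos hbs]
      calc _ ≤ T * (θγ * (2 / 10 ^ 6 * ε)) + T * (1500 * θγ * ε) := by gcongr
        _ = T * (θγ * ((2 / 10 ^ 6 + 1500) * ε)) := by ring
        _ ≤ T * (θγ * (5000 * ε)) := by gcongr; norm_num
        _ = _ := by ring
    · have hbs' : (b : ℕ∞) = data.size := le_antisymm hb (not_lt.1 hbs)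
      refine ⟨0, le_rfl, fun i x => by
        rw [FedAMD.lintegral_batchGrad_sub_full hf i hbs' x]; exact zero_le, ?_⟩
      rw [hβ, if_neg hbs]
      calc _ = Δ := by ring
        _ ≤ T * (θγ * (2 / 10 ^ 6 * ε)) := hgap
        _ ≤ T * (θγ * (200⁻¹ * ε)) := by gcongr; norm_num
        _ = _ := by ring
  have hbg := fun i s => FedAMD.measurable_batchGrad hf i s
  obtain ⟨t, ht, hle⟩ := hR.exists_lintegral_gradient_le
    (H := fun i => gradient (FedAMD.localLoss data f i)) hbg
    (fun i => FedAMD.isGradientOracle_localLoss hf hsm hσ hLσ i hb'1 hb') hL hη hηs0 hηKL hc hK hA1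
    hA hp hp1.le hb hb' (fun i x => FedAMD.integral_batchGrad_sub hf hσ i (by omega) hb x) hv h2
    hΦ hΦL (FedAMD.gradient_globalLoss hsm) (fun x => ciInf_le hbdd x) rfl rfl rfl hu hz hθγ x₀
    hT hTβ
  have hmeas : AEStronglyMeasurable (fun ω => gradient (FedAMD.globalLoss data f)
      (FedAMD.trackedRun f (fun i => gradient (FedAMD.localLoss data f i)) ηl ηs x₀ (init ω)
        (fun s => draws s ω) t).1) P :=
    ((FedAMD.continuous_of_lipschitz hΦL).measurable.comp_aemeasurable
      (measurable_fst.comp_aemeasurable (hR.aemeasurable_trackedRun hbg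
        (fun i => (FedAMD.continuous_of_lipschitz (hsm i).2).measurable) x₀ t))).aestronglyMeasurable
  have hβ0 : 0 ≤ β := by rw [hβ]; split_ifs <;> positivity
  -- The bound on the extended integral also gives integrability, so the real integral is a genuine
  -- expectation.
  obtain ⟨hmem, hint⟩ := FedAMD.integral_norm_sq_le hmeas hβ0 hle
  refine ⟨t, ht, ?_⟩
  simp_rw [FedAMD.run_eq_trackedRun (H := fun i => gradient (FedAMD.localLoss data f i))]
  exact ⟨hmem.norm.integrable_sq, hint⟩
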